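/- Let $\mathbb A_n^m$ be a commutative associative algebra with unit over $\mathbb C$, with a basis $I_1,\dots,I_n$ such that: $I_rI_s=\delta_{rs}I_r$ for $r,s\le m$; $I_rI_s=\sum_{p=\max\{r,s\}+1}^n\Upsilon_{r,p}^{s}I_p$ with $\Upsilon_{r,p}^s\in\mathbb C$ for $r,s>m$; and for each $s>m$ there is an index $u_s\le m$ with $I_{u_s}I_s=I_s$ and $I_rI_s=0$ for all $r\le m$, $r\ne u_s$. For $u\le m$ let $f_u$ be the linear functional with $f_u(I_u)=1$ and $f_u(I_r)=0$ for $r\neq u$. Let $k\ge2$, let $e_1=1,e_2,\dots,e_k\in\mathbb A_n^m$ be linearly independent over $\mathbb R$, let $E_k$ be their real linear span, and put $M_u=\{\zeta\in E_k: f_u(\zeta)=0\}$. For $\zeta\in E_k$ write $\xi_u=f_u(\zeta)$, and let $T_s$ be the coefficient of $I_s$ in $\zeta$ ($s>m$). Put $B_{q,s}=\sum_{p=m+1}^{s-1}T_p\Upsilon_{q,s}^p$, $Q_{2,s}=T_s$, and $Q_{r,s}=\sum_{q=r+m-2}^{s-1}Q_{r-1,q}B_{q,s}$ for $3\le r\le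 s-m+1$. Suppose that $f_u(E_k)=\mathbb C$ for every $u=1,\dots,m$, and that $\Omega\subset E_k$ is a domain which, for every $u=1,\dots,m$, contains the segment joining $\zeta_1$ to $\zeta_2$ whenever $\zeta_1,\zeta_2\in\Omega$ and $\zeta_2-\zeta_1\in M_u$. Put $D_u=f_u(\Omega)$. Let $\Phi:\Omega\to\mathbb A_n^m$ be monogenic, that is, continuous and such that for every $\zeta\in\Omega$ there is $\Phi'(\zeta)\in\mathbb A_n^m$ with $\lim_{\varepsilon\to0+}\varepsilon^{-1}(\Phi(\zeta+\varepsilon h)-\Phi(\zeta))=h\,\Phi'(\zeta)$ for all $h\in E_k$. Then there are functions $F_u$ holomorphic in $D_u$ ($u=1,\dots,m$) and $G_s$ holomorphic in $D_{u_s}$ ($s=m+1,\dots,n$) such that, for every $\zeta\in\Omega$, $$\Phi(\zeta)=\sum_{u=1}^m I_u\frac1{2\pi i}\int_{\Gamma_u}F_u(t)(te_1-\zeta)^{-1}\,dt+\sum_{s=m+1}^n I_s\frac1{2\pi i}\int_{\Gamma_{u_s}}G_s(t)(te_1-\zeta)^{-1}\,dt$$ for all positively oriented closed Jordan rectifiable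 curves $\Gamma_1,\dots,\Gamma_m$ such that $\Gamma_q$ lies together with its interior in $D_q$, surrounds $\xi_q$, and passes through none of the points $\xi_1,\dots,\xi_m$; such curves exist for every $\zeta\in\Omega$. With the same functions, for every $\zeta\in\Omega$, $$\Phi(\zeta)=\sum_{u=1}^mF_u(\xi_u)I_u+\sum_{s=m+1}^n\sum_{r=2}^{s-m+1}\frac{Q_{r,s}}{(r-1)!}F_{u_s}^{(r-1)}(\xi_{u_s})I_s+\sum_{q=m+1}^nG_q(\xi_{u_q})I_q+\sum_{q=m+1}^n\sum_{s=m+1}^n\sum_{r=2}^{s-m+1}\frac{Q_{r,s}}{(r-1)!}G_q^{(r-1)}(\xi_{u_q})I_qI_s .$$ The two representations are equivalent: for arbitrary holomorphic $F_u$ in $D_u$ and $G_s$ in $D_{u_s}$, the right-hand sides of the two formulas are equal at every $\zeta\in\Omega$, for all curves $\Gamma_q$ as above. -/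

import Mathlib

open Set Filter Topology

noncomputable section

namespace CommAlg

section Algebra

variable {A : Type*} [NormedCommRing A] [NormedAlgebra ℂ A] {m d : ℕ}

/-- The structure constant `Υ_{r,p}^s`: the coefficient of `I_p` in the product `I_r I_s` of two
nilpotent basis vectors. -/
def structConst (I : Module.Basis (Fin m ⊕ Fin d) ℂ A) (r p s : Fin d) : ℂ :=
  I.repr (I (Sum.inr r) * I (Sum.inr s)) (Sum.inr p)

/-- A Cartan basis of a commutative associative unital complex algebra of dimension `n = m + d`
with `m` idempotents. The vectors `I (Sum.inl u)` are the idempotents `I_1, …, I_m`, the vectors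
`I (Sum.inr s)` are the nilpotent vectors `I_{m+1}, …, I_n` in this order. -/
structure IsCartanBasis (I : Module.Basis (Fin m ⊕ Fin d) ℂ A) (u : Fin d → Fin m) : Prop where
  idem_mul_idem : ∀ r s : Fin m,
    I (Sum.inl r) * I (Sum.inl s) = if r = s then I (Sum.inl r) else 0
  nil_mul_nil : ∀ r s : Fin d,
    I (Sum.inr r) * I (Sum.inr s) =
      ∑ p ∈ Finset.univ.filter (fun p => max r s < p), structConst I r p s • I (Sum.inr p)
  idem_mul_nil : ∀ (r : Fin m) (s : Fin d),
    I (Sum.inl r) * I (Sum.inr s) = if r = u s then I (Sum.inr s) else 0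

/-- The linear functional `f_u`: it is `1` at `I_u` and vanishes at all other basis vectors. -/
def functional (I : Module.Basis (Fin m ⊕ Fin d) ℂ A) (v : Fin m) : A →ₗ[ℂ] ℂ :=
  I.coord (Sum.inl v)

/-- `E_k`, the real linear span of `e_1, …, e_k`. -/
abbrev spanE {k : ℕ} (e : Fin k → A) : Submodule ℝ A := Submodule.span ℝ (Set.range e)

/-- `M_u`, the set of those `ζ ∈ E_k` for which `f_u(ζ) = 0`. -/
def directions (I : Module.Basis (Fin m ⊕ Fin d) ℂ A) (E : Submodule ℝ A) (v : Fin m) : Set E :=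
  {ζ | functional I v (ζ : A) = 0}

/-- `Ω` is convex with respect to the set of directions `M`. -/
def ConvexWrt {E : Submodule ℝ A} (Ω M : Set E) : Prop :=
  ∀ ζ₁ ∈ Ω, ∀ ζ₂ ∈ Ω, ζ₂ - ζ₁ ∈ M → segment ℝ ζ₁ ζ₂ ⊆ Ω

/-- `Φ` is monogenic in `Ω`: continuous, and differentiable in the sense of Gateaux at every point
of `Ω`. -/
def Monogenic {E : Submodule ℝ A} (Ω : Set E) (Φ : E → A) : Prop :=
  ContinuousOn Φ Ω ∧
    ∀ ζ ∈ Ω, ∃ Φ' : A, ∀ h : E,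
      Tendsto (fun ε : ℝ => ε⁻¹ • (Φ (ζ + ε • h) - Φ ζ)) (𝓝[>] 0) (𝓝 ((h : A) * Φ'))

/-- `D_u`, the image of `Ω` under `f_u`. -/
def imageD (I : Module.Basis (Fin m ⊕ Fin d) ℂ A) {E : Submodule ℝ A} (Ω : Set E) (v : Fin m) :
    Set ℂ :=
  (fun ζ : E => functional I v (ζ : A)) '' Ω

/-- `B_{q,s} = ∑_{p < s} T_p Υ_{q,s}^p`, where `T_p` is the coefficient of `I_p` in `ζ`. For
`ζ = ∑ x_j e_j` with `e_1 = 1 = ∑ I_u`, this coefficient is `T_p = ∑_{j ≥ 2} x_j a_{jp}`. -/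
def coeffB (I : Module.Basis (Fin m ⊕ Fin d) ℂ A) (ζ : A) (q s : Fin d) : ℂ :=
  ∑ p ∈ Finset.univ.filter (fun p => p < s), I.repr ζ (Sum.inr p) * structConst I q s p

/-- The coefficients `Q_{r,s}`, `r ≥ 2`, of the resolvent expansion:
`Q_{2,s} = T_s` and `Q_{r,s} = ∑_{q=r+m-2}^{s-1} Q_{r-1,q} B_{q,s}` for `r ≥ 3`.
The element `q : Fin d` stands for the index `m + 1 + q`, so that the range of summation for
`r = r' + 3` is `r' ≤ q < s`. The values at `r = 0, 1` are not used. -/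
def coeffQ (I : Module.Basis (Fin m ⊕ Fin d) ℂ A) (ζ : A) : ℕ → Fin d → ℂ
  | 0, _ => 0
  | 1, _ => 0
  | 2, s => I.repr ζ (Sum.inr s)
  | r + 3, s =>
      ∑ q ∈ Finset.univ.filter (fun q : Fin d => r ≤ (q : ℕ) ∧ q < s),
        coeffQ I ζ (r + 2) q * coeffB I ζ q s

end Algebra

section Curves

/-- The trace of a curve parametrized by `[0, 1]`. -/
def trace (γ : ℝ → ℂ) : Set ℂ := γ '' Icc 0 1

/-- A closed Jordan rectifiable curve, given by a Lipschitz parametrization on `[0, 1]` (such as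
the one proportional to arc length, which every rectifiable curve has). -/
structure IsRectifiableJordan (γ : ℝ → ℂ) : Prop where
  lipschitz : ∃ K : NNReal, LipschitzOnWith K γ (Icc 0 1)
  closed : γ 0 = γ 1
  simple : InjOn γ (Ico 0 1)

/-- The points surrounded by the curve: those of the bounded part of the complement. -/
def inside (γ : ℝ → ℂ) : Set ℂ :=
  {z | z ∉ trace γ ∧ Bornology.IsBounded (connectedComponentIn (trace γ)ᶜ z)}

/-- The integral `∫_γ g(t) dt`. -/
def curveInt {F : Type*} [NormedAddCommGroup F] [NormedSpace ℂ F] (γ : ℝ → ℂ) (g : ℂ → F) : F :=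
  ∫ x in (0 : ℝ)..1, deriv γ x • g (γ x)

/-- The curve runs once, counterclockwise, around each point that it surrounds. -/
def PositivelyOriented (γ : ℝ → ℂ) : Prop :=
  ∀ z ∈ inside γ, (2 * Real.pi * Complex.I)⁻¹ * curveInt γ (fun t => (t - z)⁻¹) = 1

end Curves

section Representation

variable {A : Type*} [NormedCommRing A] [NormedAlgebra ℂ A] {m d : ℕ}

/-- `Γ_1, …, Γ_m` are contours for the point `ζ`: `Γ_q` is a positively oriented closed Jordan
rectifiable curve which lies, together with the points that it surrounds, in `D_q`, surrounds the
point `ξ_q = f_q(ζ)`, and passes through none of the points `ξ_1, …, ξ_m`. -/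
def AreContours (I : Module.Basis (Fin m ⊕ Fin d) ℂ A) {E : Submodule ℝ A} (Ω : Set E) (ζ : E)
    (Γ : Fin m → ℝ → ℂ) : Prop :=
  ∀ q : Fin m,
    IsRectifiableJordan (Γ q) ∧ PositivelyOriented (Γ q) ∧
    trace (Γ q) ∪ inside (Γ q) ⊆ imageD I Ω q ∧
    functional I q (ζ : A) ∈ inside (Γ q) ∧
    ∀ l : Fin m, functional I l (ζ : A) ∉ trace (Γ q)

/-- `(2πi)⁻¹ ∫_γ f(t) (t e_1 - ζ)⁻¹ dt`, where `e_1 = 1`. -/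
def resolventInt (γ : ℝ → ℂ) (f : ℂ → ℂ) (ζ : A) : A :=
  (2 * Real.pi * Complex.I : ℂ)⁻¹ •
    curveInt γ (fun t => f t • Ring.inverse (t • (1 : A) - ζ))

/-- The right-hand side of the integral representation. -/
def integralExpr (I : Module.Basis (Fin m ⊕ Fin d) ℂ A) (u : Fin d → Fin m)
    (F : Fin m → ℂ → ℂ) (G : Fin d → ℂ → ℂ) (Γ : Fin m → ℝ → ℂ) (ζ : A) : A :=
  ∑ v, I (Sum.inl v) * resolventInt (Γ v) (F v) ζ +
    ∑ s, I (Sum.inr s) * resolventInt (Γ (u s)) (G s) ζ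

/-- The right-hand side of the explicit representation. The element `s : Fin d` stands for the
index `m + 1 + s`, so that `r` runs from `2` to `(m + 1 + s) - m + 1 = s + 2`. -/
def explicitExpr (I : Module.Basis (Fin m ⊕ Fin d) ℂ A) (u : Fin d → Fin m)
    (F : Fin m → ℂ → ℂ) (G : Fin d → ℂ → ℂ) (ζ : A) : A :=
  ∑ v, F v (functional I v ζ) • I (Sum.inl v) +
  ∑ s : Fin d, ∑ r ∈ Finset.Icc 2 ((s : ℕ) + 2),
    (((r - 1).factorial : ℂ)⁻¹ * coeffQ I ζ r s *
      iteratedDeriv (r - 1) (F (u s)) (functional I (u s) ζ)) • I (Sum.inr s) +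
  ∑ q, G q (functional I (u q) ζ) • I (Sum.inr q) +
  ∑ q : Fin d, ∑ s : Fin d, ∑ r ∈ Finset.Icc 2 ((s : ℕ) + 2),
    (((r - 1).factorial : ℂ)⁻¹ * coeffQ I ζ r s *
      iteratedDeriv (r - 1) (G q) (functional I (u q) ζ)) • (I (Sum.inr q) * I (Sum.inr s))

/-- `F_v` is holomorphic in `D_v` and `G_s` is holomorphic in `D_{u_s}`. -/
def HolomorphicData (I : Module.Basis (Fin m ⊕ Fin d) ℂ A) (u : Fin d → Fin m)
    {E : Submodule ℝ A} (Ω : Set E) (F : Fin m → ℂ → ℂ) (G : Fin d → ℂ → ℂ) : Prop :=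
  (∀ v, DifferentiableOn ℂ (F v) (imageD I Ω v)) ∧
    ∀ s, DifferentiableOn ℂ (G s) (imageD I Ω (u s))

end Representation

end CommAlg

end

noncomputable section

namespace CommAlg

open MeasureTheory

/-! ### Calculus of Lipschitz functions of a real variable -/

section FundamentalTheorem

open scoped NNReal

/-! Each `f_v` is multiplicative, so `f_v ∘ Φ` has derivative `f_v(h) f_v(Φ')` in the direction `h`.
It is therefore constant along segments in `M_v`, and convexity of `Ω` in these directions makes it
a function `F_v` of `ξ_v`. Since `f_v` maps `E` onto `ℂ`, directions with `f_v(h) = 1` and `f_v(h) =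
i` exist, so `F_v` is continuous with partial derivatives satisfying the Cauchy-Riemann equation at
each point. As `Φ'` is not assumed continuous, holomorphy of `F_v` needs the full Looman-Menchoff
theorem (`differentiableOn_of_cauchyRiemann`).

The principal extension of `F_v` is the finite Taylor sum of `F_v^{(r)}(ξ_v) N^r I_v / r!`, with `N`
the nilpotent part of `ζ`; it has a Gateaux derivative of the required kind
(`IsCartanBasis.hasGateauxDeriv_extension`). Subtracting these sums from `Φ` leaves a function with
values in the radical. The multiplication is triangular: if the coordinates of `b` below `q` vanish,
coordinate `q` of `a * b` is `f_{u_q}(a) b_q` (`IsCartanBasis.repr_mul_inr`). Hence the first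
remaining nilpotent coordinate is again a holomorphic function `G_q` of `ξ_{u_q}`, and subtracting
`I_q` times its extension removes it without disturbing the earlier ones. After `d` such steps
nothing is left.

Both formulas are expansions of this sum of extensions. The `Q_{r,s}` are the coefficients of the
powers of `N` (`IsCartanBasis.nilPart_pow`), which gives the explicit formula. On `I_v` the
resolvent is a terminating geometric series in `N` (`IsCartanBasis.inverse_eq`), and Cauchy's
formula for derivatives turns its integral into the same Taylor sum. Cauchy's formula is proved for
closed Lipschitz curves by Dixon's argument.

Looman-Menchoff itself rests on Baire's theorem: near some point of the singular set `P` the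
increments of the function from points of `P` are uniformly Lipschitz. Then boundary integrals over
rectangles of bounded eccentricity are controlled by the area outside `P`. Subdividing, only cells
meeting `P` count, and their part outside `P` has total area tending to zero. Morera's theorem
concludes. -/

theorem ae_differentiableAt_of_lipschitzOnWith {f : ℝ → ℂ} {a b : ℝ} {K : ℝ≥0}
    (hf : LipschitzOnWith K f (Icc a b)) :
    ∀ᵐ x, x ∈ Icc a b → DifferentiableAt ℝ f x := by
  have h1 := (ae_restrict_iff' measurableSet_Icc).1
    (hf.ae_differentiableWithinAt (μ := volume) measurableSet_Icc)
  have ha : ∀ᵐ x : ℝ, x ≠ a := by simp [ae_iff]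
  have hb : ∀ᵐ x : ℝ, x ≠ b := by simp [ae_iff]
  filter_upwards [h1, ha, hb] with x hx hxa hxb hmem
  exact (hx hmem).differentiableAt
    (Icc_mem_nhds (lt_of_le_of_ne hmem.1 (Ne.symm hxa)) (lt_of_le_of_ne hmem.2 hxb))

theorem norm_deriv_le_of_lipschitzOnWith_Icc {f : ℝ → ℂ} {a b x : ℝ} {K : ℝ≥0}
    (hf : LipschitzOnWith K f (Icc a b)) (hx : x ∈ Ioo a b) : ‖deriv f x‖ ≤ K :=
  norm_deriv_le_of_lipschitzOn (Icc_mem_nhds hx.1 hx.2) hf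

theorem ae_norm_deriv_le {f : ℝ → ℂ} {a b : ℝ} {K : ℝ≥0}
    (hf : LipschitzOnWith K f (Icc a b)) :
    ∀ᵐ x, x ∈ Ioc a b → ‖deriv f x‖ ≤ K := by
  have hb : ∀ᵐ x : ℝ, x ≠ b := by simp [ae_iff]
  filter_upwards [hb] with x hxb hmem
  exact norm_deriv_le_of_lipschitzOnWith_Icc hf ⟨hmem.1, lt_of_le_of_ne hmem.2 hxb⟩

theorem intervalIntegrable_deriv_of_lipschitzOnWith {f : ℝ → ℂ} {a b : ℝ} {K : ℝ≥0}
    (hab : a ≤ b) (hf : LipschitzOnWith K f (Icc a b)) :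
    IntervalIntegrable (deriv f) volume a b := by
  rw [intervalIntegrable_iff_integrableOn_Ioc_of_le hab]
  refine Measure.integrableOn_of_bounded (M := K) (by simp)
    (measurable_deriv f).aestronglyMeasurable ?_
  rw [ae_restrict_iff' measurableSet_Ioc]
  exact ae_norm_deriv_le hf

/-- The fundamental theorem of calculus for Lipschitz functions. -/
theorem integral_deriv_eq_sub_of_lipschitzOnWith {f : ℝ → ℂ} {a b : ℝ} {K : ℝ≥0}
    (hab : a ≤ b) (hf : LipschitzOnWith K f (Icc a b)) :
    ∫ x in a..b, deriv f x = f b - f a := by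
  have hint := intervalIntegrable_deriv_of_lipschitzOnWith hab hf
  have hd := ae_differentiableAt_of_lipschitzOnWith hf
  -- Real linear functionals reduce the claim to real-valued absolutely continuous functions.
  have key : ∀ L : ℂ →L[ℝ] ℝ, L (∫ x in a..b, deriv f x) = L (f b - f a) := by
    intro L
    rw [← L.intervalIntegral_comp_comm hint, map_sub]
    have hL : AbsolutelyContinuousOnInterval (fun x => L (f x)) a b := by
      refine (L.lipschitz.comp_lipschitzOnWith (s := uIcc a b) (Kg := K) ?_).absolutelyContinuousOnInterval
      rwa [uIcc_of_le hab]
    rw [← hL.integral_deriv_eq_sub]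
    refine intervalIntegral.integral_congr_ae ?_
    filter_upwards [hd] with x hx hmem
    rw [uIoc_of_le hab] at hmem
    exact ((L.hasFDerivAt.comp_hasDerivAt x (hx (Ioc_subset_Icc_self hmem)).hasDerivAt).deriv).symm
  apply Complex.ext
  · simpa using key Complex.reCLM
  · simpa using key Complex.imCLM

end FundamentalTheorem

/-! ### Increments along a line and the derivative on a closed set -/

section LineEstimate

open scoped NNReal

/-- Two functions that agree on `K` have the same derivative at almost every point of `K`. -/
theorem ae_deriv_eq_of_eqOn {f g f' : ℝ → ℂ} {K : Set ℝ} (hfg : EqOn f g K)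
    (hf : ∀ p ∈ K, HasDerivAt f (f' p) p) (hg : ∀ᵐ x, x ∈ K → DifferentiableAt ℝ g x) :
    ∀ᵐ x, x ∈ K → deriv g x = f' x := by
  -- Points of `K` isolated in `K` from the right are countably many, hence null. At the others `K`
  -- accumulates, so a derivative along `K` is unique.
  have hc : ∀ᵐ x, x ∉ {x ∈ K | 𝓝[K ∩ Ioi x] x = ⊥} :=
    (countable_setOfPred_isolated_right_within (s := K)).ae_notMem volume
  filter_upwards [hc, hg] with x hx hgx hxK
  have hne : (𝓝[K ∩ Ioi x] x).NeBot := ⟨fun h => hx ⟨hxK, h⟩⟩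
  have hacc : AccPt x (𝓟 K) := by
    rw [accPt_principal_iff_nhdsWithin]
    refine hne.mono (nhdsWithin_mono _ ?_)
    rintro y ⟨hy, hxy⟩
    exact ⟨hy, by simpa using (ne_of_gt hxy)⟩
  refine UniqueDiffWithinAt.eq_deriv K hacc.uniqueDiffWithinAt
    ((hgx hxK).hasDerivAt.hasDerivWithinAt) ?_
  exact ((hf x hxK).hasDerivWithinAt).congr (fun y hy => (hfg hy).symm) (hfg hxK).symm

/-- The constant of the estimate on a line. -/
def lineConst : ℝ := 2 + 3 * (lipschitzExtensionConstant ℂ : ℝ)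

theorem lineConst_nonneg : 0 ≤ lineConst := by
  unfold lineConst; positivity

/-- If the increments of `f` from the points of the closed set `K` are bounded by `M`, then the
total increment of `f` differs from the integral of the derivative over `K` by at most a multiple
of the measure of the complement of `K`. -/
theorem norm_sub_sub_integral_indicator_le {f f' : ℝ → ℂ} {K : Set ℝ} {a b M : ℝ}
    (hab : a ≤ b) (hK : IsClosed K) (hKab : K ⊆ Icc a b) (hKn : K.Nonempty) (hM : 0 ≤ M)
    (hlip : ∀ p ∈ K, ∀ x ∈ Icc a b, ‖f x - f p‖ ≤ M * |x - p|)
    (hderiv : ∀ p ∈ K, HasDerivAt f (f' p) p) :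
    ‖f b - f a - ∫ x in a..b, K.indicator f' x‖ ≤
      lineConst * M * volume.real (Ioc a b \ K) := by
  set L : ℝ := (lipschitzExtensionConstant ℂ : ℝ) with hL
  have hL0 : 0 ≤ L := NNReal.coe_nonneg _
  lift M to ℝ≥0 using hM
  have hfK : LipschitzOnWith M f K := by
    refine LipschitzOnWith.of_dist_le_mul fun x hx y hy => ?_
    rw [dist_eq_norm, Real.dist_eq]
    exact hlip y hy x (hKab hx)
  -- The extension `g` obeys the fundamental theorem of calculus on all of `[a, b]`, which `f` need
  -- not, and shares its derivative with `f` almost everywhere on `K`.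
  obtain ⟨g, hg, hfg⟩ := hfK.extend_finite_dimension
  have hgint : IntervalIntegrable (deriv g) volume a b :=
    intervalIntegrable_deriv_of_lipschitzOnWith hab hg.lipschitzOnWith
  have hgftc : ∫ x in a..b, deriv g x = g b - g a :=
    integral_deriv_eq_sub_of_lipschitzOnWith hab hg.lipschitzOnWith
  have hgle : ∀ x y, ‖g x - g y‖ ≤ L * M * |x - y| := fun x y => by
    simpa [hL] using hg.norm_sub_le x y
  have hae := ae_deriv_eq_of_eqOn hfg hderiv
    ((hg.ae_differentiableAt (μ := volume)).mono fun x hx _ => hx)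
  have hKm : MeasurableSet K := hK.measurableSet
  have hbdd : BddAbove K ∧ BddBelow K := ⟨bddAbove_Icc.mono hKab, bddBelow_Icc.mono hKab⟩
  have hfin : volume (Ioc a b \ K) ≠ ⊤ :=
    ((measure_mono sdiff_subset).trans_lt (by simp : volume (Ioc a b) < ⊤)).ne
  have hI : ∫ x in a..b, K.indicator f' x = g b - g a - ∫ x in a..b, Kᶜ.indicator (deriv g) x := by
    have h1 : ∫ x in a..b, K.indicator f' x = ∫ x in a..b, K.indicator (deriv g) x := by
      refine intervalIntegral.integral_congr_ae ?_
      filter_upwards [hae] with x hx _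
      by_cases h : x ∈ K
      · simp [h, hx h]
      · simp [h]
    have hi1 : IntervalIntegrable (K.indicator (deriv g)) volume a b := by
      rw [intervalIntegrable_iff] at hgint ⊢
      exact hgint.indicator hKm
    have hi2 : IntervalIntegrable (Kᶜ.indicator (deriv g)) volume a b := by
      rw [intervalIntegrable_iff] at hgint ⊢
      exact hgint.indicator hKm.compl
    rw [h1, ← hgftc, eq_sub_iff_add_eq, ← intervalIntegral.integral_add hi1 hi2]
    refine intervalIntegral.integral_congr fun x _ => ?_
    exact congrFun (indicator_self_add_compl K (deriv g)) x
  have hcompl : ‖∫ x in a..b, Kᶜ.indicator (deriv g) x‖ ≤ L * M * volume.real (Ioc a b \ K) := by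
    rw [intervalIntegral.integral_of_le hab, setIntegral_indicator hKm.compl, ← sdiff_eq]
    refine norm_setIntegral_le_of_norm_le_const hfin.lt_top fun x _ => ?_
    simpa [hL] using norm_deriv_le_of_lipschitz hg (x₀ := x)
  have hcl : ∀ p ∈ K, ∀ x ∈ Icc a b, ‖f x - g x‖ ≤ (1 + L) * M * |x - p| := by
    intro p hp x hx
    have : f x - g x = (f x - f p) - (g x - g p) := by rw [hfg hp]; ring
    rw [this]
    refine (norm_sub_le _ _).trans ?_
    have := hlip p hp x hx
    have := hgle x p
    linarith
  have hb : ‖f b - g b‖ ≤ (1 + L) * M * volume.real (Ioc a b \ K) := by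
    -- The point of `K` nearest to `b` is used: the gap between them lies outside `K`, so its length
    -- is at most the measure on the right.
    have hp := hK.csSup_mem hKn hbdd.1
    refine (hcl _ hp b (right_mem_Icc.2 hab)).trans ?_
    refine mul_le_mul_of_nonneg_left ?_ (by positivity)
    have hle : sSup K ≤ b := (hKab hp).2
    rw [abs_of_nonneg (by linarith)]
    have : Ioc (sSup K) b ⊆ Ioc a b \ K := fun x hx =>
      ⟨⟨(hKab hp).1.trans_lt hx.1, hx.2⟩, fun h => (le_csSup hbdd.1 h).not_gt hx.1⟩
    simpa [hle] using measureReal_mono (μ := volume) this hfin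
  have ha : ‖f a - g a‖ ≤ (1 + L) * M * volume.real (Ioc a b \ K) := by
    have hp := hK.csInf_mem hKn hbdd.2
    refine (hcl _ hp a (left_mem_Icc.2 hab)).trans ?_
    refine mul_le_mul_of_nonneg_left ?_ (by positivity)
    have hle : a ≤ sInf K := (hKab hp).1
    rw [abs_of_nonpos (by linarith)]
    have : Ioo a (sInf K) ⊆ Ioc a b \ K := fun x hx =>
      ⟨⟨hx.1, hx.2.le.trans (hKab hp).2⟩, fun h => (csInf_le hbdd.2 h).not_gt hx.2⟩
    simpa [hle] using measureReal_mono (μ := volume) this hfin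
  have hsplit : f b - f a - ∫ x in a..b, K.indicator f' x =
      (f b - g b) - (f a - g a) + ∫ x in a..b, Kᶜ.indicator (deriv g) x := by
    rw [hI]; ring
  rw [hsplit]
  refine (norm_add_le _ _).trans ?_
  have := norm_sub_le (f b - g b) (f a - g a)
  -- This is the origin of `lineConst`: `1 + L` for each endpoint and `L` for the derivative of `g`
  -- off `K`.
  have he : lineConst * M * volume.real (Ioc a b \ K) =
    (1 + L) * M * volume.real (Ioc a b \ K) + (1 + L) * M * volume.real (Ioc a b \ K) +
      L * M * volume.real (Ioc a b \ K) := by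
    rw [lineConst, ← hL]; ring
  rw [he]
  linarith

end LineEstimate

/-! ### Integrating the line estimate over a rectangle -/

section PlaneEstimate

/-- The horizontal part of the boundary integral over the rectangle `[a₀, b₀] × [c₀, d₀]`, compared
with the integral of the partial derivative over `P`. -/
theorem norm_integral_sub_setIntegral_le {f u : ℝ × ℝ → ℂ} {P : Set (ℝ × ℝ)}
    {a b c d a₀ b₀ c₀ d₀ M κ : ℝ} (hP : IsClosed P) (ha : a ≤ a₀) (hab : a₀ ≤ b₀) (hb : b₀ ≤ b)
    (hc : c ≤ c₀) (hcd : c₀ ≤ d₀) (hd : d₀ ≤ d) (hM : 0 ≤ M) (hκ : 0 ≤ κ)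
    (hratio : d - c ≤ κ * (b - a))
    (hf : ContinuousOn f (Icc a b ×ˢ Icc c d))
    (hx : ∀ p ∈ P, p ∈ Icc a b ×ˢ Icc c d → ∀ x ∈ Icc a b, ‖f (x, p.2) - f p‖ ≤ M * |x - p.1|)
    (hy : ∀ p ∈ P, p ∈ Icc a b ×ˢ Icc c d → ∀ y ∈ Icc c d, ‖f (p.1, y) - f p‖ ≤ M * |y - p.2|)
    (hdx : ∀ p ∈ P, p ∈ Icc a b ×ˢ Icc c d → HasDerivAt (fun x => f (x, p.2)) (u p) p.1)
    (hu : IntegrableOn (P.indicator u) (Icc a b ×ˢ Icc c d))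
    (hsub : P ∩ Icc a b ×ˢ Icc c d ⊆ Icc a₀ b₀ ×ˢ Icc c₀ d₀)
    (hl : ∃ y ∈ Icc c d, (a₀, y) ∈ P) (hr : ∃ y ∈ Icc c d, (b₀, y) ∈ P) :
    ‖(∫ y in c₀..d₀, (f (b₀, y) - f (a₀, y))) -
        ∫ p in Ioc a₀ b₀ ×ˢ Ioc c₀ d₀, P.indicator u p‖ ≤
      (lineConst + 3 * κ + 1) * M * volume.real ((Ioc a b ×ˢ Ioc c d) \ P) := by
  set T : Set (ℝ × ℝ) := (Ioc a b ×ˢ Ioc c d) \ P with hT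
  have hTm : MeasurableSet T := (measurableSet_Ioc.prod measurableSet_Ioc).diff hP.measurableSet
  set r : ℝ → ℝ := fun y => volume.real (Ioc a b \ {x | (x, y) ∈ P}) with hrdef
  have hPy : ∀ y, IsClosed {x | (x, y) ∈ P} := fun y => hP.preimage (by fun_prop)
  have ha0 : a₀ ∈ Icc a b := ⟨ha, hab.trans hb⟩
  have hb0 : b₀ ∈ Icc a b := ⟨ha.trans hab, hb⟩
  have hκ' : 0 ≤ lineConst := lineConst_nonneg
  -- the estimate on each line
  have hrow : ∀ y ∈ Icc c₀ d₀, ‖(f (b₀, y) - f (a₀, y)) -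
      ∫ x in a₀..b₀, P.indicator u (x, y)‖ ≤ (lineConst + 3 * κ + 1) * M * r y := by
    intro y hymem
    have hycd : y ∈ Icc c d := ⟨hc.trans hymem.1, hymem.2.trans hd⟩
    -- A row meeting `P` is covered by the line estimate. On a row missing `P` the right side has
    -- the full length `b - a` as a factor, so a crude bound of order `M (b - a)` suffices.
    by_cases hK : (Icc a₀ b₀ ∩ {x | (x, y) ∈ P}).Nonempty
    · set K := Icc a₀ b₀ ∩ {x | (x, y) ∈ P} with hKdef
      have hKab : Icc a₀ b₀ ⊆ Icc a b := Icc_subset_Icc ha hb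
      have h1 := norm_sub_sub_integral_indicator_le (f := fun x => f (x, y))
        (f' := fun x => u (x, y)) (K := K) (M := M) hab (isClosed_Icc.inter (hPy y))
        inter_subset_left hK hM
        (fun p hp x hxx => hx (p, y) hp.2 ⟨hKab hp.1, hycd⟩ x (hKab hxx))
        (fun p hp => hdx (p, y) hp.2 ⟨hKab hp.1, hycd⟩)
      have h2 : ∫ x in a₀..b₀, K.indicator (fun x => u (x, y)) x =
          ∫ x in a₀..b₀, P.indicator u (x, y) := by
        refine intervalIntegral.integral_congr fun x hxx => ?_
        rw [uIcc_of_le hab] at hxx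
        by_cases h : (x, y) ∈ P
        · have : x ∈ K := ⟨hxx, h⟩
          simp [h, this]
        · have : x ∉ K := fun hk => h hk.2
          simp [h, this]
      rw [h2] at h1
      refine h1.trans ?_
      have h3 : volume.real (Ioc a₀ b₀ \ K) ≤ r y := by
        refine measureReal_mono ?_ ((measure_mono sdiff_subset).trans_lt
          (by simp : volume (Ioc a b) < ⊤)).ne
        rintro x ⟨hx1, hx2⟩
        exact ⟨Ioc_subset_Ioc ha hb hx1, fun h => hx2 ⟨Ioc_subset_Icc_self hx1, h⟩⟩
      have hr0 : 0 ≤ r y := measureReal_nonneg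
      calc lineConst * M * volume.real (Ioc a₀ b₀ \ K) ≤ lineConst * M * r y := by gcongr
        _ ≤ (lineConst + 3 * κ + 1) * M * r y := by gcongr; linarith
    · have hno : ∀ x ∈ Icc a b, (x, y) ∉ P := fun x hxx hxy =>
        hK ⟨x, (hsub ⟨hxy, hxx, hycd⟩).1, hxy⟩
      have h2 : ∫ x in a₀..b₀, P.indicator u (x, y) = 0 := by
        rw [← intervalIntegral.integral_zero (a := a₀) (b := b₀)]
        refine intervalIntegral.integral_congr fun x hxx => ?_
        rw [uIcc_of_le hab] at hxx
        simp [hno x ⟨ha.trans hxx.1, hxx.2.trans hb⟩]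
      have hry : r y = b - a := by
        have : Ioc a b \ {x | (x, y) ∈ P} = Ioc a b := by
          ext x
          simp only [Set.mem_sdiff, mem_ofPred_eq, and_iff_left_iff_imp]
          exact fun hxx => hno x (Ioc_subset_Icc_self hxx)
        rw [hrdef]
        simp only [this]
        simp [ha.trans (hab.trans hb)]
      obtain ⟨y1, hy1, hp1⟩ := hl
      obtain ⟨y2, hy2, hp2⟩ := hr
      have habs : ∀ s ∈ Icc c d, ∀ t ∈ Icc c d, |s - t| ≤ d - c := fun s hs t ht => by
        rw [abs_le]; constructor <;> linarith [hs.1, hs.2, ht.1, ht.2]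
      have e1 := hy _ hp1 ⟨ha0, hy1⟩ y hycd
      have e2 := hy _ hp2 ⟨hb0, hy2⟩ y hycd
      have e3 := hy _ hp1 ⟨ha0, hy1⟩ y2 hy2
      have e4 := hx _ hp2 ⟨hb0, hy2⟩ a₀ ha0
      have e5 : |a₀ - b₀| ≤ b - a := by rw [abs_le]; constructor <;> linarith
      have n1 := mul_le_mul_of_nonneg_left (habs y hycd y1 hy1) hM
      have n2 := mul_le_mul_of_nonneg_left (habs y hycd y2 hy2) hM
      have n3 := mul_le_mul_of_nonneg_left (habs y2 hy2 y1 hy1) hM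
      have n4 := mul_le_mul_of_nonneg_left e5 hM
      have n5 := mul_le_mul_of_nonneg_left hratio hM
      simp only at e1 e2 e3 e4
      rw [h2, sub_zero, hry]
      -- The two points are joined through `(b₀, y2)`, `(a₀, y2)` and `(a₀, y1)`, where the first
      -- and last lie in `P`. Three vertical moves cost at most `κ (b - a)` each and the horizontal
      -- one `b - a`; hence `3 * κ + 1`.
      have hsplit : f (b₀, y) - f (a₀, y) = (f (b₀, y) - f (b₀, y2)) -
          (f (a₀, y) - f (a₀, y1)) - (f (a₀, y2) - f (b₀, y2)) + (f (a₀, y2) - f (a₀, y1)) := by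
        ring
      have hba : 0 ≤ b - a := by linarith
      have hpos : 0 ≤ lineConst * M * (b - a) := by positivity
      calc ‖f (b₀, y) - f (a₀, y)‖ ≤ ‖f (b₀, y) - f (b₀, y2)‖ + ‖f (a₀, y) - f (a₀, y1)‖ +
            ‖f (a₀, y2) - f (b₀, y2)‖ + ‖f (a₀, y2) - f (a₀, y1)‖ := by
            rw [hsplit]
            refine (norm_add_le _ _).trans (add_le_add_left ?_ _)
            refine (norm_sub_le _ _).trans (add_le_add_left ?_ _)
            exact norm_sub_le _ _
        _ ≤ (lineConst + 3 * κ + 1) * M * (b - a) := by nlinarith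
  -- integration over the lines
  have hTy : ∀ y ∈ Ioc c d, (fun x => (x, y)) ⁻¹' T = Ioc a b \ {x | (x, y) ∈ P} := by
    intro y hyy
    ext x
    simp only [hT, mem_preimage, Set.mem_sdiff, mem_prod, mem_ofPred_eq]
    tauto
  have hTfin : volume T ≠ ⊤ := by
    refine ((measure_mono sdiff_subset).trans_lt ?_).ne
    rw [Measure.volume_eq_prod, Measure.prod_prod]
    exact ENNReal.mul_lt_top (by simp) (by simp)
  -- Unlike `T`, the whole strip has these sections for every `y`, which makes `r` measurable on the
  -- line.
  have hstrip : ∀ y, (fun x => (x, y)) ⁻¹' ((Ioc a b ×ˢ univ) \ P) =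
      Ioc a b \ {x | (x, y) ∈ P} := fun y => by
    ext x
    simp
  have hrmeas : Measurable r := by
    have : MeasurableSet ((Ioc a b ×ˢ univ) \ P) :=
      (measurableSet_Ioc.prod MeasurableSet.univ).diff hP.measurableSet
    have h2 := (measurable_measure_prodMk_right (μ := (volume : Measure ℝ)) this).ennreal_toReal
    simp only [hstrip] at h2
    exact h2
  have hrle : ∀ y, r y ≤ b - a := fun y => by
    have : r y ≤ volume.real (Ioc a b) := measureReal_mono sdiff_subset (by simp)
    simpa [ha.trans (hab.trans hb)] using this
  have hrint : IntervalIntegrable r volume c₀ d₀ := by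
    rw [intervalIntegrable_iff]
    refine Measure.integrableOn_of_bounded (M := b - a) (by simp) hrmeas.aestronglyMeasurable ?_
    refine Eventually.of_forall fun y => ?_
    rw [Real.norm_of_nonneg measureReal_nonneg]
    exact hrle y
  have hrT : ∫ y in c₀..d₀, r y ≤ volume.real T := by
    rw [intervalIntegral.integral_of_le hcd]
    simp only [hrdef, Measure.real]
    rw [integral_toReal]
    · refine ENNReal.toReal_mono hTfin ?_
      rw [Measure.volume_eq_prod, Measure.prod_apply_symm hTm]
      calc ∫⁻ y in Ioc c₀ d₀, volume (Ioc a b \ {x | (x, y) ∈ P}) =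
          ∫⁻ y in Ioc c₀ d₀, volume ((fun x => (x, y)) ⁻¹' T) :=
            setLIntegral_congr_fun measurableSet_Ioc fun y hyy => by
              simp only [hTy y (Ioc_subset_Ioc hc hd hyy)]
        _ ≤ ∫⁻ y, volume ((fun x => (x, y)) ⁻¹' T) := setLIntegral_le_lintegral _ _
    · have h2 := measurable_measure_prodMk_right (μ := (volume : Measure ℝ)) (
        (measurableSet_Ioc.prod MeasurableSet.univ).diff hP.measurableSet :
          MeasurableSet (((Ioc a b : Set ℝ) ×ˢ univ) \ P))
      refine Measurable.aemeasurable ?_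
      simpa only [hstrip] using h2
    · exact Eventually.of_forall fun y => (measure_mono sdiff_subset).trans_lt (by simp)
  have hsub' : Ioc a₀ b₀ ×ˢ Ioc c₀ d₀ ⊆ Icc a b ×ˢ Icc c d :=
    prod_mono (Ioc_subset_Icc_self.trans (Icc_subset_Icc ha hb))
      (Ioc_subset_Icc_self.trans (Icc_subset_Icc hc hd))
  have hu' : Integrable (P.indicator u)
      ((volume.restrict (Ioc a₀ b₀)).prod (volume.restrict (Ioc c₀ d₀))) := by
    rw [Measure.prod_restrict]
    exact hu.mono_set hsub'
  have hdouble : ∫ p in Ioc a₀ b₀ ×ˢ Ioc c₀ d₀, P.indicator u p =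
      ∫ y in c₀..d₀, ∫ x in a₀..b₀, P.indicator u (x, y) := by
    rw [Measure.volume_eq_prod, ← Measure.prod_restrict, integral_prod_symm _ hu',
      intervalIntegral.integral_of_le hcd]
    simp only [intervalIntegral.integral_of_le hab]
  have hcont : ∀ x ∈ Icc a b, IntervalIntegrable (fun y => f (x, y)) volume c₀ d₀ := by
    intro x hxx
    refine ContinuousOn.intervalIntegrable ?_
    rw [uIcc_of_le hcd]
    exact hf.comp (by fun_prop) fun y hyy => ⟨hxx, hc.trans hyy.1, hyy.2.trans hd⟩
  have hint2 : IntervalIntegrable (fun y => ∫ x in a₀..b₀, P.indicator u (x, y)) volume c₀ d₀ := by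
    rw [intervalIntegrable_iff_integrableOn_Ioc_of_le hcd]
    simp only [intervalIntegral.integral_of_le hab]
    exact hu'.integral_prod_right
  rw [hdouble, ← intervalIntegral.integral_sub ((hcont _ hb0).sub (hcont _ ha0)) hint2]
  calc ‖∫ y in c₀..d₀, ((f (b₀, y) - f (a₀, y)) - ∫ x in a₀..b₀, P.indicator u (x, y))‖
      ≤ ∫ y in c₀..d₀, (lineConst + 3 * κ + 1) * M * r y :=
        intervalIntegral.norm_integral_le_of_norm_le hcd
          (Eventually.of_forall fun y hyy => hrow y (Ioc_subset_Icc_self hyy))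
          (hrint.const_mul _)
    _ = (lineConst + 3 * κ + 1) * M * ∫ y in c₀..d₀, r y := by
        rw [intervalIntegral.integral_const_mul]
    _ ≤ (lineConst + 3 * κ + 1) * M * volume.real T := by gcongr

end PlaneEstimate

/-! ### Boundary integrals over rectangles -/

section RectangleIntegral

/-- The integral of `f` over the boundary of the rectangle `[a, b] × [c, d]`. -/
def rectInt (f : ℝ × ℝ → ℂ) (a b c d : ℝ) : ℂ :=
  (∫ x in a..b, f (x, c)) - (∫ x in a..b, f (x, d)) +
    Complex.I * (∫ y in c..d, f (b, y)) - Complex.I * ∫ y in c..d, f (a, y)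

theorem intervalIntegrable_fst {f : ℝ × ℝ → ℂ} {a b c d a' b' y : ℝ}
    (hf : ContinuousOn f (Icc a b ×ˢ Icc c d)) (ha : a' ∈ Icc a b) (hb : b' ∈ Icc a b)
    (hy : y ∈ Icc c d) : IntervalIntegrable (fun x => f (x, y)) volume a' b' :=
  (hf.comp (by fun_prop) fun _ hx => ⟨uIcc_subset_Icc ha hb hx, hy⟩ :
    ContinuousOn (fun x => f (x, y)) (uIcc a' b')).intervalIntegrable

theorem intervalIntegrable_snd {f : ℝ × ℝ → ℂ} {a b c d c' d' x : ℝ}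
    (hf : ContinuousOn f (Icc a b ×ˢ Icc c d)) (hc : c' ∈ Icc c d) (hd : d' ∈ Icc c d)
    (hx : x ∈ Icc a b) : IntervalIntegrable (fun y => f (x, y)) volume c' d' :=
  (hf.comp (by fun_prop) fun _ hy => ⟨hx, uIcc_subset_Icc hc hd hy⟩ :
    ContinuousOn (fun y => f (x, y)) (uIcc c' d')).intervalIntegrable

theorem rectInt_add_fst {f : ℝ × ℝ → ℂ} {a b c d m : ℝ}
    (hf : ContinuousOn f (Icc a b ×ˢ Icc c d)) (hm : m ∈ Icc a b) (hcd : c ≤ d) :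
    rectInt f a m c d + rectInt f m b c d = rectInt f a b c d := by
  have hab := hm.1.trans hm.2
  have h : ∀ y ∈ Icc c d, (∫ x in a..m, f (x, y)) + (∫ x in m..b, f (x, y)) =
      ∫ x in a..b, f (x, y) := fun y hy =>
    intervalIntegral.integral_add_adjacent_intervals
      (intervalIntegrable_fst hf (left_mem_Icc.2 hab) hm hy)
      (intervalIntegrable_fst hf hm (right_mem_Icc.2 hab) hy)
  simp only [rectInt]
  rw [← h c (left_mem_Icc.2 hcd), ← h d (right_mem_Icc.2 hcd)]
  ring

theorem rectInt_add_snd {f : ℝ × ℝ → ℂ} {a b c d m : ℝ}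
    (hf : ContinuousOn f (Icc a b ×ˢ Icc c d)) (hm : m ∈ Icc c d) (hab : a ≤ b) :
    rectInt f a b c m + rectInt f a b m d = rectInt f a b c d := by
  have hcd := hm.1.trans hm.2
  have h : ∀ x ∈ Icc a b, (∫ y in c..m, f (x, y)) + (∫ y in m..d, f (x, y)) =
      ∫ y in c..d, f (x, y) := fun x hx =>
    intervalIntegral.integral_add_adjacent_intervals
      (intervalIntegrable_snd hf (left_mem_Icc.2 hcd) hm hx)
      (intervalIntegrable_snd hf hm (right_mem_Icc.2 hcd) hx)
  simp only [rectInt]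
  rw [← h a (left_mem_Icc.2 hab), ← h b (right_mem_Icc.2 hab)]
  ring

/-- A function on a rectangle whose increments from the points of `P` along the two axes are
controlled, which satisfies the Cauchy-Riemann equation at the points of `P`, and whose integral
over the boundary of each rectangle that misses `P` vanishes. -/
structure LineControl (f u : ℝ × ℝ → ℂ) (P : Set (ℝ × ℝ)) (a b c d M : ℝ) : Prop where
  isClosed : IsClosed P
  nonneg : 0 ≤ M
  cont : ContinuousOn f (Icc a b ×ˢ Icc c d)
  lip_fst : ∀ p ∈ P, p ∈ Icc a b ×ˢ Icc c d → ∀ x ∈ Icc a b, ‖f (x, p.2) - f p‖ ≤ M * |x - p.1|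
  lip_snd : ∀ p ∈ P, p ∈ Icc a b ×ˢ Icc c d → ∀ y ∈ Icc c d, ‖f (p.1, y) - f p‖ ≤ M * |y - p.2|
  deriv_fst : ∀ p ∈ P, p ∈ Icc a b ×ˢ Icc c d → HasDerivAt (fun x => f (x, p.2)) (u p) p.1
  deriv_snd : ∀ p ∈ P, p ∈ Icc a b ×ˢ Icc c d →
    HasDerivAt (fun y => f (p.1, y)) (Complex.I * u p) p.2
  integrable : IntegrableOn (P.indicator u) (Icc a b ×ˢ Icc c d)
  rectInt_eq_zero : ∀ a' b' c' d', a ≤ a' → a' ≤ b' → b' ≤ b → c ≤ c' → c' ≤ d' → d' ≤ d →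
    Disjoint (Ioo a' b' ×ˢ Ioo c' d') P → rectInt f a' b' c' d' = 0

theorem LineControl.mono {f u : ℝ × ℝ → ℂ} {P : Set (ℝ × ℝ)} {a b c d a' b' c' d' M : ℝ}
    (h : LineControl f u P a b c d M) (ha : a ≤ a') (hb : b' ≤ b) (hc : c ≤ c') (hd : d' ≤ d) :
    LineControl f u P a' b' c' d' M := by
  have h1 : Icc a' b' ⊆ Icc a b := Icc_subset_Icc ha hb
  have h2 : Icc c' d' ⊆ Icc c d := Icc_subset_Icc hc hd
  have h3 := prod_mono h1 h2
  exact
    { isClosed := h.isClosed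
      nonneg := h.nonneg
      cont := h.cont.mono h3
      lip_fst := fun p hp hpm x hx => h.lip_fst p hp (h3 hpm) x (h1 hx)
      lip_snd := fun p hp hpm x hx => h.lip_snd p hp (h3 hpm) x (h2 hx)
      deriv_fst := fun p hp hpm => h.deriv_fst p hp (h3 hpm)
      deriv_snd := fun p hp hpm => h.deriv_snd p hp (h3 hpm)
      integrable := h.integrable.mono_set h3
      rectInt_eq_zero := fun a'' b'' c'' d'' h1 h2 h3 h4 h5 h6 =>
        h.rectInt_eq_zero a'' b'' c'' d'' (ha.trans h1) h2 (h3.trans hb) (hc.trans h4) h5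
          (h6.trans hd) }

theorem volume_real_preimage_swap (T : Set (ℝ × ℝ)) (hT : MeasurableSet T) :
    volume.real (Prod.swap ⁻¹' T) = volume.real T := by
  simp only [Measure.real, Measure.volume_eq_prod]
  rw [Measure.measurePreserving_swap.measure_preimage hT.nullMeasurableSet]

/-- The boundary integral over a rectangle of bounded eccentricity is bounded by the measure of the
part of the rectangle outside `P`. -/
theorem LineControl.norm_rectInt_le {f u : ℝ × ℝ → ℂ} {P : Set (ℝ × ℝ)} {a b c d M κ : ℝ}
    (h : LineControl f u P a b c d M) (hab : a ≤ b) (hcd : c ≤ d) (hκ : 0 ≤ κ)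
    (h1 : d - c ≤ κ * (b - a)) (h2 : b - a ≤ κ * (d - c)) :
    ‖rectInt f a b c d‖ ≤
      2 * ((lineConst + 3 * κ + 1) * M) * volume.real ((Ioc a b ×ˢ Ioc c d) \ P) := by
  set R := Icc a b ×ˢ Icc c d with hR
  have hpos : 0 ≤ (lineConst + 3 * κ + 1) * M := by
    have := lineConst_nonneg
    have := h.nonneg
    positivity
  by_cases hne : (P ∩ R).Nonempty
  swap
  · rw [h.rectInt_eq_zero a b c d le_rfl hab le_rfl le_rfl hcd le_rfl, norm_zero]
    · positivity
    · rw [Set.disjoint_left]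
      exact fun p hp hpP => hne ⟨p, hpP, prod_mono Ioo_subset_Icc_self Ioo_subset_Icc_self hp⟩
  have hcomp : IsCompact (P ∩ R) := (isCompact_Icc.prod isCompact_Icc).inter_left h.isClosed
  obtain ⟨p₁, hp₁, hmin1⟩ := hcomp.exists_isMinOn hne continuous_fst.continuousOn
  obtain ⟨p₂, hp₂, hmax1⟩ := hcomp.exists_isMaxOn hne continuous_fst.continuousOn
  obtain ⟨p₃, hp₃, hmin2⟩ := hcomp.exists_isMinOn hne continuous_snd.continuousOn
  obtain ⟨p₄, hp₄, hmax2⟩ := hcomp.exists_isMaxOn hne continuous_snd.continuousOn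
  set a₀ := p₁.1 with ha₀
  set b₀ := p₂.1 with hb₀
  set c₀ := p₃.2 with hc₀
  set d₀ := p₄.2 with hd₀
  have haa : a ≤ a₀ := hp₁.2.1.1
  have hbb : b₀ ≤ b := hp₂.2.1.2
  have hcc : c ≤ c₀ := hp₃.2.2.1
  have hdd : d₀ ≤ d := hp₄.2.2.2
  have hab₀ : a₀ ≤ b₀ := hmin1 hp₂
  have hcd₀ : c₀ ≤ d₀ := hmin2 hp₄
  have hsub : P ∩ R ⊆ Icc a₀ b₀ ×ˢ Icc c₀ d₀ := fun p hp =>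
    ⟨⟨hmin1 hp, hmax1 hp⟩, ⟨hmin2 hp, hmax2 hp⟩⟩
  have hdis : ∀ a' b' c' d', a ≤ a' → b' ≤ b → c ≤ c' → d' ≤ d →
      (b' ≤ a₀ ∨ b₀ ≤ a' ∨ d' ≤ c₀ ∨ d₀ ≤ c') → Disjoint (Ioo a' b' ×ˢ Ioo c' d') P := by
    intro a' b' c' d' e1 e2 e3 e4 e5
    rw [Set.disjoint_left]
    rintro p ⟨⟨q1, q2⟩, ⟨q3, q4⟩⟩ hpP
    have hpR : p ∈ Icc a₀ b₀ ×ˢ Icc c₀ d₀ := hsub ⟨hpP, ⟨by linarith, by linarith⟩,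
      ⟨by linarith, by linarith⟩⟩
    obtain ⟨⟨q5, q6⟩, ⟨q7, q8⟩⟩ := hpR
    rcases e5 with e | e | e | e <;> linarith
  -- reduction to the smallest rectangle that contains the points of `P`
  have hred : rectInt f a b c d = rectInt f a₀ b₀ c₀ d₀ := by
    have hcm : ∀ {a' b' c' d'}, a ≤ a' → b' ≤ b → c ≤ c' → d' ≤ d →
        ContinuousOn f (Icc a' b' ×ˢ Icc c' d') := fun e1 e2 e3 e4 =>
      h.cont.mono (prod_mono (Icc_subset_Icc e1 e2) (Icc_subset_Icc e3 e4))
    rw [← rectInt_add_fst h.cont ⟨haa, hab₀.trans hbb⟩ hcd,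
      ← rectInt_add_fst (hcm haa le_rfl le_rfl le_rfl) ⟨hab₀, hbb⟩ hcd,
      ← rectInt_add_snd (hcm haa hbb le_rfl le_rfl) ⟨hcc, hcd₀.trans hdd⟩ hab₀,
      ← rectInt_add_snd (hcm haa hbb hcc le_rfl) ⟨hcd₀, hdd⟩ hab₀,
      h.rectInt_eq_zero a a₀ c d le_rfl haa (hab₀.trans hbb) le_rfl hcd le_rfl
        (hdis _ _ _ _ le_rfl (hab₀.trans hbb) le_rfl le_rfl (Or.inl le_rfl)),
      h.rectInt_eq_zero b₀ b c d (haa.trans hab₀) hbb le_rfl le_rfl hcd le_rfl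
        (hdis _ _ _ _ (haa.trans hab₀) le_rfl le_rfl le_rfl (Or.inr (Or.inl le_rfl))),
      h.rectInt_eq_zero a₀ b₀ c c₀ haa hab₀ hbb le_rfl hcc (hcd₀.trans hdd)
        (hdis _ _ _ _ haa hbb le_rfl (hcd₀.trans hdd) (Or.inr (Or.inr (Or.inl le_rfl)))),
      h.rectInt_eq_zero a₀ b₀ d₀ d haa hab₀ hbb (hcc.trans hcd₀) hdd le_rfl
        (hdis _ _ _ _ haa hbb (hcc.trans hcd₀) le_rfl (Or.inr (Or.inr (Or.inr le_rfl))))]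
    ring
  have key1 := norm_integral_sub_setIntegral_le h.isClosed haa hab₀ hbb hcc hcd₀ hdd h.nonneg hκ
    h1 h.cont h.lip_fst h.lip_snd h.deriv_fst h.integrable hsub
    ⟨p₁.2, hp₁.2.2, hp₁.1⟩ ⟨p₂.2, hp₂.2.2, hp₂.1⟩
  have hswap : MeasurePreserving (Prod.swap : ℝ × ℝ → ℝ × ℝ) volume volume := by
    simpa only [Measure.volume_eq_prod] using
      (Measure.measurePreserving_swap (μ := (volume : Measure ℝ)) (ν := (volume : Measure ℝ)))
  have hemb : MeasurableEmbedding (Prod.swap : ℝ × ℝ → ℝ × ℝ) :=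
    MeasurableEquiv.prodComm.measurableEmbedding
  have hind : (Prod.swap ⁻¹' P).indicator (fun p => Complex.I * u p.swap) =
      fun p => Complex.I * P.indicator u p.swap := by
    ext p
    by_cases hp : p.swap ∈ P
    · simp [hp]
    · simp [hp]
  -- The estimate for the other pair of sides is the same one with the coordinates exchanged; the
  -- partial derivative is then `I * u`.
  have key2 := norm_integral_sub_setIntegral_le (f := f ∘ Prod.swap)
    (u := fun p => Complex.I * u p.swap) (P := Prod.swap ⁻¹' P)
    (h.isClosed.preimage continuous_swap) hcc hcd₀ hdd haa hab₀ hbb h.nonneg hκ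
    h2 (h.cont.comp continuous_swap.continuousOn fun p hp => ⟨hp.2, hp.1⟩)
    (fun p hp hpm x hx => h.lip_snd p.swap hp ⟨hpm.2, hpm.1⟩ x hx)
    (fun p hp hpm x hx => h.lip_fst p.swap hp ⟨hpm.2, hpm.1⟩ x hx)
    (fun p hp hpm => h.deriv_snd p.swap hp ⟨hpm.2, hpm.1⟩)
    (by
      rw [hind]
      refine Integrable.const_mul ?_ _
      have := (hswap.integrableOn_comp_preimage hemb (s := R)).2 h.integrable
      rw [hR, preimage_swap_prod] at this
      exact this)
    (fun p hp => by
      have := hsub (a := p.swap) ⟨hp.1, hp.2.2, hp.2.1⟩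
      exact ⟨this.2, this.1⟩)
    ⟨p₃.1, hp₃.2.1, hp₃.1⟩ ⟨p₄.1, hp₄.2.1, hp₄.1⟩
  have hvol : volume.real ((Ioc c d ×ˢ Ioc a b) \ Prod.swap ⁻¹' P) =
      volume.real ((Ioc a b ×ˢ Ioc c d) \ P) := by
    rw [← volume_real_preimage_swap _
      ((measurableSet_Ioc.prod measurableSet_Ioc).diff h.isClosed.measurableSet), preimage_sdiff,
      preimage_swap_prod]
  have hint : ∫ p in Ioc c₀ d₀ ×ˢ Ioc a₀ b₀,
      (Prod.swap ⁻¹' P).indicator (fun p => Complex.I * u p.swap) p =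
      Complex.I * ∫ p in Ioc a₀ b₀ ×ˢ Ioc c₀ d₀, P.indicator u p := by
    rw [hind, integral_const_mul]
    have := hswap.setIntegral_preimage_emb hemb (P.indicator u) (Ioc a₀ b₀ ×ˢ Ioc c₀ d₀)
    rw [preimage_swap_prod] at this
    rw [this]
  rw [hint, hvol] at key2
  simp only [Function.comp, Prod.swap_prod_mk] at key2
  have hd₀m : d₀ ∈ Icc c d := ⟨hcc.trans hcd₀, hdd⟩
  have hc₀m : c₀ ∈ Icc c d := ⟨hcc, hcd₀.trans hdd⟩
  have ha₀m : a₀ ∈ Icc a b := ⟨haa, hab₀.trans hbb⟩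
  have hb₀m : b₀ ∈ Icc a b := ⟨haa.trans hab₀, hbb⟩
  rw [intervalIntegral.integral_sub (intervalIntegrable_snd h.cont hc₀m hd₀m hb₀m)
    (intervalIntegrable_snd h.cont hc₀m hd₀m ha₀m)] at key1
  rw [intervalIntegral.integral_sub (intervalIntegrable_fst h.cont ha₀m hb₀m hd₀m)
    (intervalIntegrable_fst h.cont ha₀m hb₀m hc₀m)] at key2
  rw [hred, rectInt]
  set J := ∫ p in Ioc a₀ b₀ ×ˢ Ioc c₀ d₀, P.indicator u p
  set X := (∫ y in c₀..d₀, f (b₀, y)) - ∫ y in c₀..d₀, f (a₀, y) with hX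
  set Y := (∫ x in a₀..b₀, f (x, d₀)) - ∫ x in a₀..b₀, f (x, c₀) with hY
  -- The Cauchy-Riemann equation enters here: both area integrals equal `I * J` and cancel.
  have hsplit : (∫ x in a₀..b₀, f (x, c₀)) - (∫ x in a₀..b₀, f (x, d₀)) +
      Complex.I * (∫ y in c₀..d₀, f (b₀, y)) - Complex.I * ∫ y in c₀..d₀, f (a₀, y) =
      Complex.I * (X - J) - (Y - Complex.I * J) := by
    rw [hX, hY]; ring
  rw [hsplit]
  refine (norm_sub_le _ _).trans ?_
  rw [norm_mul, Complex.norm_I, one_mul]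
  linarith

end RectangleIntegral

/-! ### Subdivision: the boundary integral vanishes -/

section Grid

theorem sum_rectInt_fst {f : ℝ × ℝ → ℂ} {c d : ℝ} (hcd : c ≤ d) {x : ℕ → ℝ} (hx : Monotone x)
    (n : ℕ) (hf : ContinuousOn f (Icc (x 0) (x n) ×ˢ Icc c d)) :
    ∑ i ∈ Finset.range n, rectInt f (x i) (x (i + 1)) c d = rectInt f (x 0) (x n) c d := by
  induction n with
  | zero => simp [rectInt]
  | succ n ih =>
    have hle := hx n.le_succ
    rw [Finset.sum_range_succ,
      ih (hf.mono (prod_mono (Icc_subset_Icc le_rfl hle) le_rfl)),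
      rectInt_add_fst hf ⟨hx n.zero_le, hle⟩ hcd]

theorem sum_rectInt_snd {f : ℝ × ℝ → ℂ} {a b : ℝ} (hab : a ≤ b) {y : ℕ → ℝ} (hy : Monotone y)
    (n : ℕ) (hf : ContinuousOn f (Icc a b ×ˢ Icc (y 0) (y n))) :
    ∑ j ∈ Finset.range n, rectInt f a b (y j) (y (j + 1)) = rectInt f a b (y 0) (y n) := by
  induction n with
  | zero => simp [rectInt]
  | succ n ih =>
    have hle := hy n.le_succ
    rw [Finset.sum_range_succ,
      ih (hf.mono (prod_mono le_rfl (Icc_subset_Icc le_rfl hle))),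
      rectInt_add_snd hf ⟨hy n.zero_le, hle⟩ hab]

/-- An `n × n` grid has cells of the same shape as the rectangle, so one `κ` serves them all. Cells
missing `P` contribute nothing; a cell meeting `P` lies within its side lengths of `K`, so its part
outside `P` lies in the thin collar of `K`. Half-open cells are disjoint, hence these areas add up
to at most that of the collar. -/
theorem LineControl.norm_rectInt_le_cthickening {f u : ℝ × ℝ → ℂ} {P : Set (ℝ × ℝ)}
    {a b c d M κ : ℝ} (h : LineControl f u P a b c d M) (hab : a ≤ b) (hcd : c ≤ d) (hκ : 0 ≤ κ)
    (h1 : d - c ≤ κ * (b - a)) (h2 : b - a ≤ κ * (d - c)) {n : ℕ} (hn : 0 < n) :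
    ‖rectInt f a b c d‖ ≤ 2 * ((lineConst + 3 * κ + 1) * M) *
      volume.real (Metric.cthickening ((b - a + (d - c)) / n) (P ∩ Icc a b ×ˢ Icc c d) \
        (P ∩ Icc a b ×ˢ Icc c d)) := by
  set K := P ∩ Icc a b ×ˢ Icc c d with hK
  set W := Metric.cthickening ((b - a + (d - c)) / n) K \ K with hW
  have hKc : IsCompact K := (isCompact_Icc.prod isCompact_Icc).inter_left h.isClosed
  have hWm : MeasurableSet W :=
    Metric.isClosed_cthickening.measurableSet.diff hKc.isClosed.measurableSet
  have hWfin : volume W ≠ ⊤ :=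
    ((measure_mono sdiff_subset).trans_lt hKc.cthickening.measure_lt_top).ne
  have hn' : (0 : ℝ) < n := by exact_mod_cast hn
  set x : ℕ → ℝ := fun i => a + i * ((b - a) / n) with hx
  set y : ℕ → ℝ := fun i => c + i * ((d - c) / n) with hy
  have hba : 0 ≤ (b - a) / n := div_nonneg (by linarith) hn'.le
  have hdc : 0 ≤ (d - c) / n := div_nonneg (by linarith) hn'.le
  have hxm : Monotone x := fun i j hij => by simp only [hx]; gcongr
  have hym : Monotone y := fun i j hij => by simp only [hy]; gcongr
  have hx0 : x 0 = a := by simp [hx]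
  have hy0 : y 0 = c := by simp [hy]
  have hxn : x n = b := by simp only [hx]; field_simp; ring
  have hyn : y n = d := by simp only [hy]; field_simp; ring
  have hxs : ∀ i, x (i + 1) - x i = (b - a) / n := fun i => by simp only [hx]; push_cast; ring
  have hys : ∀ i, y (i + 1) - y i = (d - c) / n := fun i => by simp only [hy]; push_cast; ring
  have hC : 0 ≤ 2 * ((lineConst + 3 * κ + 1) * M) := by
    have := lineConst_nonneg
    have := h.nonneg
    positivity
  have hsum : rectInt f a b c d = ∑ i ∈ Finset.range n, ∑ j ∈ Finset.range n,
      rectInt f (x i) (x (i + 1)) (y j) (y (j + 1)) := by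
    have e1 := sum_rectInt_fst hcd hxm n (f := f) (by rw [hx0, hxn]; exact h.cont)
    rw [hx0, hxn] at e1
    rw [← e1]
    refine Finset.sum_congr rfl fun i hi => ?_
    have hi' : i + 1 ≤ n := Finset.mem_range.1 hi
    have hxi : a ≤ x i := hx0 ▸ hxm i.zero_le
    have hxi' : x (i + 1) ≤ b := hxn ▸ hxm hi'
    have e2 := sum_rectInt_snd (hxm i.le_succ) hym n (f := f) (by
      rw [hy0, hyn]
      exact h.cont.mono (prod_mono (Icc_subset_Icc hxi hxi') le_rfl))
    rw [hy0, hyn] at e2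
    exact e2.symm
  set S : ℕ × ℕ → Set (ℝ × ℝ) := fun p =>
    Ioc (x p.1) (x (p.1 + 1)) ×ˢ Ioc (y p.2) (y (p.2 + 1)) with hS
  have hterm : ∀ p ∈ Finset.range n ×ˢ Finset.range n,
      ‖rectInt f (x p.1) (x (p.1 + 1)) (y p.2) (y (p.2 + 1))‖ ≤
      2 * ((lineConst + 3 * κ + 1) * M) * volume.real (S p ∩ W) := by
    rintro ⟨i, j⟩ hp
    rw [Finset.mem_product, Finset.mem_range, Finset.mem_range] at hp
    have hi' : i + 1 ≤ n := hp.1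
    have hj' : j + 1 ≤ n := hp.2
    have hxi : a ≤ x i := hx0 ▸ hxm i.zero_le
    have hxi' : x (i + 1) ≤ b := hxn ▸ hxm hi'
    have hyj : c ≤ y j := hy0 ▸ hym j.zero_le
    have hyj' : y (j + 1) ≤ d := hyn ▸ hym hj'
    simp only
    by_cases hne : (P ∩ Icc (x i) (x (i + 1)) ×ˢ Icc (y j) (y (j + 1))).Nonempty
    · refine ((h.mono hxi hxi' hyj hyj').norm_rectInt_le (hxm i.le_succ) (hym j.le_succ) hκ
        ?_ ?_).trans ?_
      · rw [hxs, hys, ← mul_div_assoc]; gcongr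
      · rw [hxs, hys, ← mul_div_assoc]; gcongr
      · refine mul_le_mul_of_nonneg_left (measureReal_mono ?_
          ((measure_mono inter_subset_right).trans_lt hWfin.lt_top).ne) hC
        rintro z ⟨hz, hzP⟩
        refine ⟨hz, ?_, fun hzK => hzP hzK.1⟩
        obtain ⟨q, hqP, hq⟩ := hne
        have hqK : q ∈ K := ⟨hqP, prod_mono (Icc_subset_Icc hxi hxi') (Icc_subset_Icc hyj hyj') hq⟩
        refine Metric.mem_cthickening_of_dist_le z q _ K hqK ?_
        have d1 : dist z.1 q.1 ≤ (b - a) / n := by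
          rw [← hxs i]
          exact Real.dist_le_of_mem_Icc (Ioc_subset_Icc_self hz.1) hq.1
        have d2 : dist z.2 q.2 ≤ (d - c) / n := by
          rw [← hys j]
          exact Real.dist_le_of_mem_Icc (Ioc_subset_Icc_self hz.2) hq.2
        rw [Prod.dist_eq, add_div]
        exact max_le (by linarith) (by linarith)
    · rw [h.rectInt_eq_zero _ _ _ _ hxi (hxm i.le_succ) hxi' hyj (hym j.le_succ) hyj', norm_zero]
      · positivity
      · rw [Set.disjoint_left]
        exact fun p hp hpP => hne ⟨p, hpP, prod_mono Ioo_subset_Icc_self Ioo_subset_Icc_self hp⟩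
  have hdisj : ∀ p q : ℕ × ℕ, p ≠ q → Disjoint (S p ∩ W) (S q ∩ W) := by
    intro p q hpq
    refine Disjoint.mono inter_subset_left inter_subset_left ?_
    rw [Set.disjoint_prod]
    by_cases h1 : p.1 = q.1
    · right
      exact hym.pairwise_disjoint_on_Ioc_succ fun h2 => hpq (Prod.ext h1 h2)
    · left
      exact hxm.pairwise_disjoint_on_Ioc_succ h1
  calc ‖rectInt f a b c d‖ ≤ ∑ p ∈ Finset.range n ×ˢ Finset.range n,
        ‖rectInt f (x p.1) (x (p.1 + 1)) (y p.2) (y (p.2 + 1))‖ := by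
        rw [hsum, ← Finset.sum_product']
        exact norm_sum_le _ _
    _ ≤ ∑ p ∈ Finset.range n ×ˢ Finset.range n,
        2 * ((lineConst + 3 * κ + 1) * M) * volume.real (S p ∩ W) := Finset.sum_le_sum hterm
    _ = 2 * ((lineConst + 3 * κ + 1) * M) *
        volume.real (⋃ p ∈ Finset.range n ×ˢ Finset.range n, S p ∩ W) := by
        rw [← Finset.mul_sum, measureReal_biUnion_finset]
        · exact fun p _ q _ hpq => hdisj p q hpq
        · exact fun p _ => (measurableSet_Ioc.prod measurableSet_Ioc).inter hWm
    _ ≤ 2 * ((lineConst + 3 * κ + 1) * M) * volume.real W := by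
        refine mul_le_mul_of_nonneg_left (measureReal_mono ?_ hWfin) hC
        exact iUnion₂_subset fun p _ => inter_subset_right

/-- The closed thickenings of a compact set decrease to the set, so the area of the collar tends to
zero as the grid is refined. -/
theorem LineControl.rectInt_self_eq_zero {f u : ℝ × ℝ → ℂ} {P : Set (ℝ × ℝ)}
    {a b c d M : ℝ} (h : LineControl f u P a b c d M) (hab : a < b) (hcd : c < d) :
    rectInt f a b c d = 0 := by
  set K := P ∩ Icc a b ×ˢ Icc c d with hK
  have hKc : IsCompact K := (isCompact_Icc.prod isCompact_Icc).inter_left h.isClosed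
  have hba : 0 < b - a := sub_pos.2 hab
  have hdc : 0 < d - c := sub_pos.2 hcd
  -- The sum of the two aspect ratios dominates each of them.
  set κ : ℝ := (d - c) / (b - a) + (b - a) / (d - c) with hκ
  have h1 : d - c ≤ κ * (b - a) := by
    rw [hκ, add_mul, div_mul_cancel₀ _ hba.ne']
    have : 0 ≤ (b - a) / (d - c) * (b - a) := by positivity
    linarith
  have h2 : b - a ≤ κ * (d - c) := by
    rw [hκ, add_mul, div_mul_cancel₀ _ hdc.ne']
    have : 0 ≤ (d - c) / (b - a) * (d - c) := by positivity
    linarith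
  have hlim0 : Tendsto (fun n : ℕ => (b - a + (d - c)) / n) atTop (𝓝 0) :=
    tendsto_const_div_atTop_nhds_zero_nat _
  have hlim1 : Tendsto (fun n : ℕ => volume.real
      (Metric.cthickening ((b - a + (d - c)) / n) K \ K)) atTop (𝓝 0) := by
    have e1 := (tendsto_measure_cthickening_of_isClosed (μ := volume)
      ⟨1, one_pos, (hKc.cthickening (r := 1)).measure_lt_top.ne⟩ hKc.isClosed).comp hlim0
    have e2 := ((ENNReal.tendsto_toReal hKc.measure_lt_top.ne).comp e1).sub_const (volume.real K)
    simp only [Measure.real, sub_self] at e2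
    refine e2.congr fun n => ?_
    have e3 := measureReal_sdiff (μ := volume)
      (Metric.self_subset_cthickening (δ := (b - a + (d - c)) / n) K)
      hKc.isClosed.measurableSet hKc.cthickening.measure_lt_top.ne
    simp only [Function.comp]
    exact e3.symm
  have hle : ∀ᶠ n : ℕ in atTop, ‖rectInt f a b c d‖ ≤ 2 * ((lineConst + 3 * κ + 1) * M) *
      volume.real (Metric.cthickening ((b - a + (d - c)) / n) K \ K) :=
    (eventually_gt_atTop 0).mono fun n hn =>
      h.norm_rectInt_le_cthickening hab.le hcd.le (by positivity) h1 h2 hn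
  have := ge_of_tendsto (hlim1.const_mul (2 * ((lineConst + 3 * κ + 1) * M))) hle
  simpa using this

end Grid

/-! ### The Looman-Menchoff theorem -/

section LoomanMenchoff

theorem rectInt_eq_zero_of_forall_le {f : ℝ × ℝ → ℂ} {Q : Set (ℝ × ℝ)}
    (h : ∀ a b c d, a < b → c < d → Icc a b ×ˢ Icc c d ⊆ Q → rectInt f a b c d = 0)
    (a b c d : ℝ) (hQ : uIcc a b ×ˢ uIcc c d ⊆ Q) : rectInt f a b c d = 0 := by
  have h1 : ∀ a b c d, rectInt f b a c d = -rectInt f a b c d := fun a b c d => by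
    simp only [rectInt]
    rw [intervalIntegral.integral_symm a b, intervalIntegral.integral_symm a b]
    ring
  have h2 : ∀ a b c d, rectInt f a b d c = -rectInt f a b c d := fun a b c d => by
    simp only [rectInt]
    rw [intervalIntegral.integral_symm c d, intervalIntegral.integral_symm c d]
    ring
  rcases lt_trichotomy a b with hab | rfl | hab
  · rcases lt_trichotomy c d with hcd | rfl | hcd
    · rw [uIcc_of_lt hab, uIcc_of_lt hcd] at hQ
      exact h _ _ _ _ hab hcd hQ
    · simp [rectInt]
    · rw [uIcc_of_lt hab, uIcc_of_gt hcd] at hQ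
      rw [h2, h _ _ _ _ hab hcd hQ, neg_zero]
  · simp [rectInt]
  · rcases lt_trichotomy c d with hcd | rfl | hcd
    · rw [uIcc_of_gt hab, uIcc_of_lt hcd] at hQ
      rw [h1, h _ _ _ _ hab hcd hQ, neg_zero]
    · simp [rectInt]
    · rw [uIcc_of_gt hab, uIcc_of_gt hcd] at hQ
      rw [h1, h2, h _ _ _ _ hab hcd hQ, neg_zero, neg_zero]

variable {F F' : ℂ → ℂ} {Q : Set ℂ} {M : ℝ}

/-- With `P` the set of non-analytic points, closedness is automatic, and rectangles whose interior
misses `P` are handled by Cauchy's theorem for functions continuous up to the boundary. The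
derivative is integrable on `P` because it is bounded by `M` there and is a limit of measurable
difference quotients. -/
theorem lineControl_of_cauchyRiemann (hQ : IsOpen Q) (hF : ContinuousOn F Q)
    (hx : ∀ z ∈ Q, HasDerivAt (fun t : ℝ => F (z + t)) (F' z) 0)
    (hy : ∀ z ∈ Q, HasDerivAt (fun t : ℝ => F (z + t * Complex.I)) (Complex.I * F' z) 0)
    (hM : 0 ≤ M)
    (hlx : ∀ z ∈ Q, ¬ AnalyticAt ℂ F z → ∀ t : ℝ, z + t ∈ Q → ‖F (z + t) - F z‖ ≤ M * |t|)
    (hly : ∀ z ∈ Q, ¬ AnalyticAt ℂ F z → ∀ t : ℝ, z + t * Complex.I ∈ Q →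
      ‖F (z + t * Complex.I) - F z‖ ≤ M * |t|)
    {a b c d : ℝ} (hR : ∀ p ∈ Icc a b ×ˢ Icc c d, (p.1 + p.2 * Complex.I : ℂ) ∈ Q) :
    LineControl (fun p => F (p.1 + p.2 * Complex.I)) (fun p => F' (p.1 + p.2 * Complex.I))
      {p | ¬ AnalyticAt ℂ F (p.1 + p.2 * Complex.I)} a b c d M := by
  set e : ℝ × ℝ → ℂ := fun p => p.1 + p.2 * Complex.I with he
  have hec : Continuous e := by fun_prop
  have hclosed : IsClosed {p | ¬ AnalyticAt ℂ F (e p)} :=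
    ((isOpen_analyticAt ℂ F).isClosed_compl).preimage hec
  have hcont : ContinuousOn (fun p => F (e p)) (Icc a b ×ˢ Icc c d) :=
    hF.comp hec.continuousOn hR
  refine
    { isClosed := hclosed
      nonneg := hM
      cont := hcont
      lip_fst := ?_
      lip_snd := ?_
      deriv_fst := ?_
      deriv_snd := ?_
      integrable := ?_
      rectInt_eq_zero := ?_ }
  · intro p hp hpm x hxm
    have h1 := hlx (e p) (hR p hpm) hp (x - p.1)
    have h2 : e p + ((x - p.1 : ℝ) : ℂ) = e (x, p.2) := by simp only [he]; push_cast; ring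
    rw [h2] at h1
    exact h1 (hR (x, p.2) ⟨hxm, hpm.2⟩)
  · intro p hp hpm x hxm
    have h1 := hly (e p) (hR p hpm) hp (x - p.2)
    have h2 : e p + ((x - p.2 : ℝ) : ℂ) * Complex.I = e (p.1, x) := by
      simp only [he]; push_cast; ring
    rw [h2] at h1
    exact h1 (hR (p.1, x) ⟨hpm.1, hxm⟩)
  · intro p hp hpm
    have h1 : HasDerivAt (fun t : ℝ => F (e p + t)) (F' (e p)) (p.1 - p.1) := by
      rw [sub_self]; exact hx (e p) (hR p hpm)
    have h2 := h1.comp_sub_const p.1 p.1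
    refine h2.congr_of_eventuallyEq (Eventually.of_forall fun x => ?_)
    simp only [he]
    congr 1
    push_cast; ring
  · intro p hp hpm
    have h1 : HasDerivAt (fun t : ℝ => F (e p + t * Complex.I)) (Complex.I * F' (e p))
        (p.2 - p.2) := by
      rw [sub_self]; exact hy (e p) (hR p hpm)
    have h2 := h1.comp_sub_const p.2 p.2
    refine h2.congr_of_eventuallyEq (Eventually.of_forall fun x => ?_)
    simp only [he]
    congr 1
    push_cast; ring
  · classical
    set P := {p | ¬ AnalyticAt ℂ F (e p)} with hP
    set R := Icc a b ×ˢ Icc c d with hRdef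
    have hRm : MeasurableSet R := measurableSet_Icc.prod measurableSet_Icc
    have hRfin : volume (P ∩ R) < ⊤ :=
      (measure_mono inter_subset_right).trans_lt (isCompact_Icc.prod isCompact_Icc).measure_lt_top
    rw [IntegrableOn, integrable_indicator_iff hclosed.measurableSet, IntegrableOn,
      Measure.restrict_restrict hclosed.measurableSet]
    have hPR : MeasurableSet (P ∩ R) := hclosed.measurableSet.inter hRm
    have : IsFiniteMeasure (volume.restrict (P ∩ R)) := ⟨by simpa using hRfin⟩
    refine Integrable.of_bound ?_ M ?_
    -- Extension by zero outside `Q` gives a Borel function on the plane whose difference quotients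
    -- with step `1 / (n + 1)` converge to `F'` on the rectangle.
    · have hGm : Measurable (Q.piecewise F 0) :=
        hF.measurable_piecewise continuousOn_const hQ.measurableSet
      have hlim0 : Tendsto (fun n : ℕ => (1 / ((n : ℝ) + 1))) atTop (𝓝[≠] 0) := by
        refine tendsto_nhdsWithin_iff.2 ⟨tendsto_one_div_add_atTop_nhds_zero_nat, ?_⟩
        exact Eventually.of_forall fun n => (by positivity : (1 / ((n : ℝ) + 1)) ≠ 0)
      have hmeas : ∀ n : ℕ, Measurable (fun p : ℝ × ℝ => (1 / ((n : ℝ) + 1))⁻¹ •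
          (Q.piecewise F 0 (e p + ((1 / ((n : ℝ) + 1) : ℝ) : ℂ)) - Q.piecewise F 0 (e p))) := by
        intro n
        have h1 : Measurable fun p : ℝ × ℝ =>
            Q.piecewise F 0 (e p + ((1 / ((n : ℝ) + 1) : ℝ) : ℂ)) :=
          hGm.comp (hec.measurable.add_const _)
        exact (h1.sub (hGm.comp hec.measurable)).const_smul (1 / ((n : ℝ) + 1))⁻¹
      have hR' : AEStronglyMeasurable (fun p => F' (e p)) (volume.restrict R) := by
        refine aestronglyMeasurable_of_tendsto_ae atTop
          (fun n => (hmeas n).aestronglyMeasurable) ?_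
        rw [ae_restrict_iff' hRm]
        refine Eventually.of_forall fun p hp => ?_
        have h1 := ((hx (e p) (hR p hp)).tendsto_slope_zero).comp hlim0
        simp only [zero_add, Complex.ofReal_zero, add_zero] at h1
        refine h1.congr' ?_
        have h2 : ∀ᶠ n : ℕ in atTop, e p + ((1 / ((n : ℝ) + 1) : ℝ) : ℂ) ∈ Q := by
          have h3 : Tendsto (fun n : ℕ => e p + ((1 / ((n : ℝ) + 1) : ℝ) : ℂ)) atTop
              (𝓝 (e p + ((0 : ℝ) : ℂ))) :=
            ((Complex.continuous_ofReal.tendsto 0).comp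
              tendsto_one_div_add_atTop_nhds_zero_nat).const_add _
          rw [Complex.ofReal_zero, add_zero] at h3
          exact h3 (hQ.mem_nhds (hR p hp))
        filter_upwards [h2] with n hn
        simp only [Function.comp]
        rw [piecewise_eq_of_mem _ _ _ hn, piecewise_eq_of_mem _ _ _ (hR p hp)]
      exact hR'.mono_measure (Measure.restrict_mono inter_subset_right le_rfl)
    · rw [ae_restrict_iff' hPR]
      refine Eventually.of_forall fun p hp => ?_
      refine (hx (e p) (hR p hp.2)).le_of_lip' hM ?_
      have h2 : ∀ᶠ t : ℝ in 𝓝 0, e p + (t : ℂ) ∈ Q := by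
        have h3 : ContinuousAt (fun t : ℝ => e p + (t : ℂ)) 0 := by fun_prop
        refine h3 (hQ.mem_nhds ?_)
        simpa using hR p hp.2
      filter_upwards [h2] with t ht
      simpa using hlx (e p) (hR p hp.2) hp.1 t ht
  · intro a' b' c' d' h1 h2 h3 h4 h5 h6 hdis
    have hzero := Complex.integral_boundary_rect_eq_zero_of_continuousOn_of_differentiableOn F
      (a' + c' * Complex.I) (b' + d' * Complex.I) ?_ ?_
    · simpa [rectInt] using hzero
    · simp only [Complex.add_re, Complex.ofReal_re, Complex.mul_re, Complex.I_re, mul_zero,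
        Complex.ofReal_im, Complex.I_im, mul_one, sub_self, add_zero, Complex.add_im,
        Complex.mul_im, zero_add, uIcc_of_le h2, uIcc_of_le h5]
      refine hF.mono fun z hz => ?_
      have := hR (z.re, z.im) ⟨⟨h1.trans hz.1.1, hz.1.2.trans h3⟩,
        ⟨h4.trans hz.2.1, hz.2.2.trans h6⟩⟩
      simpa [Complex.re_add_im] using this
    · simp only [Complex.add_re, Complex.ofReal_re, Complex.mul_re, Complex.I_re, mul_zero,
        Complex.ofReal_im, Complex.I_im, mul_one, sub_self, add_zero, Complex.add_im,
        Complex.mul_im, zero_add, min_eq_left h2, max_eq_right h2, min_eq_left h5, max_eq_right h5]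
      intro z hz
      have := Set.disjoint_left.1 hdis (show (z.re, z.im) ∈ _ from ⟨hz.1, hz.2⟩)
      simp only [mem_ofPred_eq, not_not, Complex.re_add_im] at this
      exact this.differentiableAt.differentiableWithinAt

/-- Morera's theorem: the integrals over all rectangles in `Q` vanish by the collar estimate. -/
theorem differentiableOn_of_lipschitz_at_singularities (hQ : IsOpen Q) (hF : ContinuousOn F Q)
    (hx : ∀ z ∈ Q, HasDerivAt (fun t : ℝ => F (z + t)) (F' z) 0)
    (hy : ∀ z ∈ Q, HasDerivAt (fun t : ℝ => F (z + t * Complex.I)) (Complex.I * F' z) 0)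
    (hM : 0 ≤ M)
    (hlx : ∀ z ∈ Q, ¬ AnalyticAt ℂ F z → ∀ t : ℝ, z + t ∈ Q → ‖F (z + t) - F z‖ ≤ M * |t|)
    (hly : ∀ z ∈ Q, ¬ AnalyticAt ℂ F z → ∀ t : ℝ, z + t * Complex.I ∈ Q →
      ‖F (z + t * Complex.I) - F z‖ ≤ M * |t|) : DifferentiableOn ℂ F Q := by
  refine (Complex.isConservativeOn_and_continuousOn_iff_isDifferentiableOn hQ).1 ⟨?_, hF⟩
  intro z w hzw
  rw [← add_eq_zero_iff_eq_neg, Complex.wedgeIntegral_add_wedgeIntegral_eq]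
  have := rectInt_eq_zero_of_forall_le (f := fun p => F (p.1 + p.2 * Complex.I))
    (Q := {p | (p.1 + p.2 * Complex.I : ℂ) ∈ Q})
    (fun a b c d hab hcd hR =>
      (lineControl_of_cauchyRiemann hQ hF hx hy hM hlx hly hR).rectInt_self_eq_zero hab hcd)
    z.re w.re z.im w.im (fun p hp => hzw ?_)
  · simpa [rectInt] using this
  · rw [Complex.Rectangle, Complex.mem_reProdIm]
    exact ⟨by simpa using hp.1, by simpa using hp.2⟩

/-- **The Looman-Menchoff theorem**: a continuous function which has partial derivatives that
satisfy the Cauchy-Riemann equation at each point of an open set is holomorphic. -/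
theorem differentiableOn_of_cauchyRiemann {U : Set ℂ} (hU : IsOpen U) (hF : ContinuousOn F U)
    (hx : ∀ z ∈ U, HasDerivAt (fun t : ℝ => F (z + t)) (F' z) 0)
    (hy : ∀ z ∈ U, HasDerivAt (fun t : ℝ => F (z + t * Complex.I)) (Complex.I * F' z) 0) :
    DifferentiableOn ℂ F U := by
  by_contra hcon
  have hne : ∃ z₀ ∈ U, ¬ AnalyticAt ℂ F z₀ := by
    by_contra! hall
    exact hcon fun z hz => (hall z hz).differentiableAt.differentiableWithinAt
  obtain ⟨z₀, hz₀U, hz₀⟩ := hne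
  obtain ⟨r₂, hr₂, hball⟩ := Metric.isOpen_iff.1 hU z₀ hz₀U
  -- With this radius, points of `K` can be shifted by up to `r` without leaving `U`.
  set r := r₂ / 3 with hr
  have hr0 : 0 < r := by positivity
  have hcb : Metric.closedBall z₀ (2 * r) ⊆ U :=
    (Metric.closedBall_subset_ball (by linarith)).trans hball
  set N := {z | ¬ AnalyticAt ℂ F z} with hN
  have hNc : IsClosed N := (isOpen_analyticAt ℂ F).isClosed_compl
  set K := N ∩ Metric.closedBall z₀ r with hK
  have hKc : IsCompact K := (isCompact_closedBall z₀ r).inter_left hNc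
  have hKU : K ⊆ U := fun z hz => hcb (Metric.closedBall_subset_closedBall (by linarith) hz.2)
  have hshift : ∀ z ∈ K, ∀ v : ℂ, ‖v‖ ≤ r → z + v ∈ U := fun z hz v hv => by
    refine hcb ?_
    have h1 : dist z z₀ ≤ r := hz.2
    rw [Metric.mem_closedBall, dist_eq_norm] at *
    calc ‖z + v - z₀‖ = ‖(z - z₀) + v‖ := by congr 1; ring
      _ ≤ 2 * r := (norm_add_le _ _).trans (by linarith)
  have : CompactSpace K := isCompact_iff_compactSpace.1 hKc
  -- The sets for Baire's theorem in the compact space `K`: on `E n` the Lipschitz constant and the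
  -- range of increments are uniform. They are closed by continuity of `F` and cover `K` because
  -- both partial derivatives exist.
  set E : ℕ → Set K := fun n => {z : K | ∀ t : ℝ, |t| ≤ r / (n + 1) →
    ‖F (z + t) - F z‖ ≤ n * |t| ∧ ‖F (z + t * Complex.I) - F z‖ ≤ n * |t|} with hE
  have hFK : Continuous (fun z : K => F z) :=
    (hF.mono hKU).comp_continuous continuous_subtype_val fun z => z.2
  have hrn : ∀ n : ℕ, r / (n + 1) ≤ r := fun n => div_le_self hr0.le (by linarith [n.cast_nonneg (α := ℝ)])
  have hEc : ∀ n, IsClosed (E n) := by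
    intro n
    simp only [hE, ofPred_forall]
    refine isClosed_iInter fun t => isClosed_iInter fun ht => ?_
    have h1 : Continuous (fun z : K => F (z + t)) :=
      hF.comp_continuous (by fun_prop) fun z => hshift z z.2 _ (by
        simpa using ht.trans (hrn n))
    have h2 : Continuous (fun z : K => F (z + t * Complex.I)) :=
      hF.comp_continuous (by fun_prop) fun z => hshift z z.2 _ (by
        simpa using ht.trans (hrn n))
    exact (isClosed_le (h1.sub hFK).norm continuous_const).inter
      (isClosed_le (h2.sub hFK).norm continuous_const)
  have hEu : ⋃ n, E n = univ := by
    refine eq_univ_of_forall fun z => ?_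
    have hb : ∀ (g : ℝ → ℂ) (g' : ℂ), HasDerivAt g g' 0 → ∃ C : ℝ, ∃ δ > 0, ∀ t : ℝ, |t| < δ →
        ‖g t - g 0‖ ≤ C * |t| := by
      intro g g' hg
      obtain ⟨C, hC⟩ := (hg.isBigO_sub).bound
      obtain ⟨δ, hδ, hδ'⟩ := Metric.eventually_nhds_iff.1 hC
      exact ⟨C, δ, hδ, fun t ht => by simpa using hδ' (y := t) (by simpa using ht)⟩
    obtain ⟨C₁, δ₁, hδ₁, hC₁⟩ := hb _ _ (hx z (hKU z.2))
    obtain ⟨C₂, δ₂, hδ₂, hC₂⟩ := hb _ _ (hy z (hKU z.2))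
    obtain ⟨n, hn⟩ := exists_nat_gt (max (max C₁ C₂) (max (r / δ₁) (r / δ₂)))
    simp only [max_lt_iff] at hn
    obtain ⟨⟨n1, n2⟩, n3, n4⟩ := hn
    refine mem_iUnion.2 ⟨n, fun t ht => ?_⟩
    have hn0 : (0 : ℝ) < n + 1 := by positivity
    have ht1 : |t| < δ₁ := ht.trans_lt (by
      rw [div_lt_iff₀ hδ₁] at n3
      rw [div_lt_iff₀ hn0]
      nlinarith)
    have ht2 : |t| < δ₂ := ht.trans_lt (by
      rw [div_lt_iff₀ hδ₂] at n4
      rw [div_lt_iff₀ hn0]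
      nlinarith)
    have e1 := hC₁ t ht1
    have e2 := hC₂ t ht2
    simp only [Complex.ofReal_zero, add_zero, zero_mul] at e1 e2
    exact ⟨e1.trans (by gcongr), e2.trans (by gcongr)⟩
  have hdense := dense_iUnion_interior_of_closed hEc hEu
  have hopen : IsOpen {z : K | (z : ℂ) ∈ Metric.ball z₀ r} :=
    Metric.isOpen_ball.preimage continuous_subtype_val
  obtain ⟨z₁, hz₁b, hz₁⟩ := hdense.inter_open_nonempty _ hopen
    ⟨⟨z₀, hz₀, Metric.mem_closedBall_self hr0.le⟩, Metric.mem_ball_self hr0⟩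
  obtain ⟨n, hn⟩ := mem_iUnion.1 hz₁
  have hnhds : E n ∈ 𝓝 z₁ := mem_interior_iff_mem_nhds.1 hn
  obtain ⟨ρ₁, hρ₁, hE₁⟩ := Metric.mem_nhds_iff.1 hnhds
  obtain ⟨ρ₂, hρ₂, hE₂⟩ := Metric.isOpen_iff.1 Metric.isOpen_ball (z₁ : ℂ) hz₁b
  -- The bound `ρ₂` puts non-analytic points of the ball into `K`, and `ρ₁` puts them into `E n`.
  -- The last bound keeps the distance between two points of the ball within the range allowed by `E
  -- n`.
  set ρ := min (min ρ₁ ρ₂) (r / (n + 1) / 2) with hρ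
  have hρ0 : 0 < ρ := by positivity
  have hq1 : ρ ≤ ρ₁ := (min_le_left _ _).trans (min_le_left _ _)
  have hq2 : ρ ≤ ρ₂ := (min_le_left _ _).trans (min_le_right _ _)
  have hq3 : ρ ≤ r / (n + 1) / 2 := min_le_right _ _
  have hQU : Metric.ball (z₁ : ℂ) ρ ⊆ U := fun z hz =>
    hcb (Metric.closedBall_subset_closedBall (by linarith)
      (Metric.ball_subset_closedBall (hE₂ (Metric.ball_subset_ball hq2 hz))))
  have hmem : ∀ z ∈ Metric.ball (z₁ : ℂ) ρ, ∀ hz : ¬ AnalyticAt ℂ F z,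
      ∃ hzK : z ∈ K, (⟨z, hzK⟩ : K) ∈ E n := fun z hz hzN => by
    have hzK : z ∈ K :=
      ⟨hzN, Metric.ball_subset_closedBall (hE₂ (Metric.ball_subset_ball hq2 hz))⟩
    refine ⟨hzK, hE₁ ?_⟩
    exact Metric.ball_subset_ball hq1 hz
  have hsmall : ∀ z ∈ Metric.ball (z₁ : ℂ) ρ, ∀ v : ℂ, z + v ∈ Metric.ball (z₁ : ℂ) ρ →
      ‖v‖ ≤ r / (n + 1) := fun z hz v hv => by
    rw [Metric.mem_ball, dist_eq_norm] at hz hv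
    calc ‖v‖ = ‖(z + v - z₁) - (z - z₁)‖ := by congr 1; ring
      _ ≤ ‖z + v - z₁‖ + ‖z - z₁‖ := norm_sub_le _ _
      _ ≤ r / (n + 1) := by linarith
  have hdiff : DifferentiableOn ℂ F (Metric.ball (z₁ : ℂ) ρ) := by
    refine differentiableOn_of_lipschitz_at_singularities (M := n) Metric.isOpen_ball
      (hF.mono hQU) (fun z hz => hx z (hQU hz)) (fun z hz => hy z (hQU hz)) n.cast_nonneg ?_ ?_
    · intro z hz hzN t ht
      obtain ⟨hzK, hzE⟩ := hmem z hz hzN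
      exact (hzE t (by simpa using hsmall z hz t ht)).1
    · intro z hz hzN t ht
      obtain ⟨hzK, hzE⟩ := hmem z hz hzN
      exact (hzE t (by simpa using hsmall z hz (t * Complex.I) ht)).2
  -- The centre `z₁` belongs to `K`, so it is itself non-analytic: a contradiction.
  exact z₁.2.1 (hdiff.analyticAt (Metric.ball_mem_nhds _ hρ0))

end LoomanMenchoff

/-! ### Integrals along Lipschitz curves and winding numbers -/

section LipschitzCurves

open scoped NNReal

variable {γ : ℝ → ℂ} {K : ℝ≥0}

theorem isCompact_trace (hγ : LipschitzOnWith K γ (Icc 0 1)) : IsCompact (trace γ) :=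
  isCompact_Icc.image_of_continuousOn hγ.continuousOn

theorem mem_trace {x : ℝ} (hx : x ∈ Icc (0 : ℝ) 1) : γ x ∈ trace γ := mem_image_of_mem γ hx

theorem intervalIntegrable_deriv_smul {F : Type*} [NormedAddCommGroup F] [NormedSpace ℂ F]
    (hγ : LipschitzOnWith K γ (Icc 0 1)) {g : ℂ → F} (hg : ContinuousOn g (trace γ)) :
    IntervalIntegrable (fun x => deriv γ x • g (γ x)) volume 0 1 := by
  refine (intervalIntegrable_deriv_of_lipschitzOnWith zero_le_one hγ).smul_continuousOn ?_
  rw [uIcc_of_le zero_le_one]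
  exact hg.comp hγ.continuousOn fun x hx => mem_trace hx

theorem norm_curveInt_le (hγ : LipschitzOnWith K γ (Icc 0 1)) {g : ℂ → ℂ} {B : ℝ}
    (hB : ∀ w ∈ trace γ, ‖g w‖ ≤ B) : ‖curveInt γ g‖ ≤ K * B := by
  have h := intervalIntegral.norm_integral_le_of_norm_le_const_ae (a := 0) (b := 1)
    (f := fun x => deriv γ x • g (γ x)) (C := K * B) ?_
  · simpa [curveInt] using h
  · filter_upwards [ae_norm_deriv_le hγ] with x hx hxm
    rw [uIoc_of_le zero_le_one] at hxm
    rw [norm_smul]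
    exact mul_le_mul (hx hxm) (hB _ (mem_trace (Ioc_subset_Icc_self hxm))) (norm_nonneg _)
      K.coe_nonneg

theorem curveInt_sub (hγ : LipschitzOnWith K γ (Icc 0 1)) {g h : ℂ → ℂ}
    (hg : ContinuousOn g (trace γ)) (hh : ContinuousOn h (trace γ)) :
    curveInt γ (fun w => g w - h w) = curveInt γ g - curveInt γ h := by
  simp only [curveInt, smul_sub]
  exact intervalIntegral.integral_sub (intervalIntegrable_deriv_smul hγ hg)
    (intervalIntegrable_deriv_smul hγ hh)

theorem curveInt_const_mul (c : ℂ) (g : ℂ → ℂ) :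
    curveInt γ (fun w => c * g w) = c * curveInt γ g := by
  simp only [curveInt, smul_eq_mul]
  rw [← intervalIntegral.integral_const_mul]
  congr 1
  ext x
  ring

theorem curveInt_congr {F : Type*} [NormedAddCommGroup F] [NormedSpace ℂ F] {g h : ℂ → F}
    (hgh : EqOn g h (trace γ)) : curveInt γ g = curveInt γ h := by
  refine intervalIntegral.integral_congr fun x hx => ?_
  rw [uIcc_of_le zero_le_one] at hx
  simp only [hgh (mem_trace hx)]

/-- Differentiation of a curve integral with respect to a complex parameter. -/
theorem hasDerivAt_curveInt (hγ : LipschitzOnWith K γ (Icc 0 1)) {g g' : ℂ → ℂ → ℂ} {z₀ : ℂ}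
    {s : Set ℂ} {B : ℝ} (hs : s ∈ 𝓝 z₀) (hg : ∀ z ∈ s, ContinuousOn (g z) (trace γ))
    (hg' : ContinuousOn (g' z₀) (trace γ))
    (hd : ∀ z ∈ s, ∀ w ∈ trace γ, HasDerivAt (fun z => g z w) (g' z w) z)
    (hB : ∀ z ∈ s, ∀ w ∈ trace γ, ‖g' z w‖ ≤ B) :
    HasDerivAt (fun z => curveInt γ (g z)) (curveInt γ (g' z₀)) z₀ := by
  refine (intervalIntegral.hasDerivAt_integral_of_dominated_loc_of_deriv_le (μ := volume)
    (a := 0) (b := 1) (bound := fun _ => K * B)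
    (F := fun z x => deriv γ x • g z (γ x)) (F' := fun z x => deriv γ x • g' z (γ x))
    hs ?_ ?_ ?_ ?_ ?_ ?_).2
  · filter_upwards [hs] with z hz
    exact (intervalIntegrable_iff.1 (intervalIntegrable_deriv_smul hγ (hg z hz))).1
  · exact intervalIntegrable_deriv_smul hγ (hg z₀ (mem_of_mem_nhds hs))
  · exact (intervalIntegrable_iff.1 (intervalIntegrable_deriv_smul hγ hg')).1
  · filter_upwards [ae_norm_deriv_le hγ] with x hx hxm z hz
    rw [uIoc_of_le zero_le_one] at hxm
    rw [norm_smul]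
    exact mul_le_mul (hx hxm) (hB z hz _ (mem_trace (Ioc_subset_Icc_self hxm))) (norm_nonneg _)
      K.coe_nonneg
  · exact intervalIntegrable_const
  · refine Eventually.of_forall fun x hxm z hz => ?_
    rw [uIoc_of_le zero_le_one] at hxm
    exact (hd z hz _ (mem_trace (Ioc_subset_Icc_self hxm))).const_smul (deriv γ x)

theorem exists_le_norm_sub_trace (hγ : LipschitzOnWith K γ (Icc 0 1)) {z : ℂ}
    (hz : z ∉ trace γ) : ∃ δ > 0, ∀ z' ∈ Metric.ball z δ, ∀ w ∈ trace γ, δ ≤ ‖w - z'‖ := by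
  obtain ⟨r, hr, hr'⟩ := Metric.isOpen_iff.1 (isCompact_trace hγ).isClosed.isOpen_compl z hz
  refine ⟨r / 2, by positivity, fun z' hz' w hw => ?_⟩
  by_contra! hlt
  refine hr' (a := w) ?_ hw
  rw [Metric.mem_ball, dist_eq_norm] at *
  calc ‖w - z‖ = ‖(w - z') + (z' - z)‖ := by congr 1; ring
    _ ≤ ‖w - z'‖ + ‖z' - z‖ := norm_add_le _ _
    _ < r := by linarith

theorem continuousOn_cauchyKernel {f : ℂ → ℂ} (hf : ContinuousOn f (trace γ)) {z : ℂ}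
    (hz : z ∉ trace γ) (n : ℕ) :
    ContinuousOn (fun w => f w * ((w - z) ^ n)⁻¹) (trace γ) := by
  refine hf.mul (ContinuousOn.inv₀ (by fun_prop) fun w hw => ?_)
  exact pow_ne_zero _ (sub_ne_zero.2 fun h => hz (h ▸ hw))

/-- Differentiation under the integral sign: away from the curve the kernels are uniformly bounded.
Only continuity of `f` on the curve matters. -/
theorem hasDerivAt_cauchyIntegral (hγ : LipschitzOnWith K γ (Icc 0 1)) {f : ℂ → ℂ}
    (hf : ContinuousOn f (trace γ)) {z : ℂ} (hz : z ∉ trace γ) (n : ℕ) :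
    HasDerivAt (fun z => curveInt γ (fun w => f w * ((w - z) ^ (n + 1))⁻¹))
      ((n + 1) * curveInt γ (fun w => f w * ((w - z) ^ (n + 2))⁻¹)) z := by
  obtain ⟨δ, hδ, hδ'⟩ := exists_le_norm_sub_trace hγ hz
  obtain ⟨B, hB⟩ := (isCompact_trace hγ).exists_bound_of_continuousOn hf
  have hnot : ∀ z' ∈ Metric.ball z δ, z' ∉ trace γ := fun z' hz' hmem => by
    have := hδ' z' hz' z' hmem
    simp at this
    linarith
  rw [← curveInt_const_mul]
  refine hasDerivAt_curveInt hγ (B := (n + 1) * (B * (δ ^ (n + 2))⁻¹))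
    (g := fun z w => f w * ((w - z) ^ (n + 1))⁻¹)
    (g' := fun z w => (n + 1) * (f w * ((w - z) ^ (n + 2))⁻¹)) (Metric.ball_mem_nhds z hδ)
    (fun z' hz' => continuousOn_cauchyKernel hf (hnot z' hz') _)
    (continuousOn_const.mul (continuousOn_cauchyKernel hf hz _)) ?_ ?_
  · intro z' hz' w hw
    have hne : w - z' ≠ 0 := sub_ne_zero.2 fun h => hnot z' hz' (h ▸ hw)
    have h1 : HasDerivAt (fun z => (w - z) ^ (n + 1)) (((n + 1 : ℕ) : ℂ) * (w - z') ^ n * (-1)) z' :=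
      ((hasDerivAt_id z').const_sub w).pow (n + 1)
    have h2 := (h1.inv (pow_ne_zero _ hne)).const_mul (f w)
    refine h2.congr_deriv ?_
    push_cast
    field_simp
    ring
  · intro z' hz' w hw
    have h1 := hδ' z' hz' w hw
    have hB0 : 0 ≤ B := (norm_nonneg _).trans (hB w hw)
    rw [norm_mul, norm_mul, norm_inv, norm_pow]
    have h2 : ‖(n + 1 : ℂ)‖ = n + 1 := by
      rw [← Nat.cast_add_one, Complex.norm_natCast]; push_cast; rfl
    rw [h2]
    gcongr
    exact hB w hw

/-- The integral of `(w - z)⁻¹` along the curve. -/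
def windingInt (γ : ℝ → ℂ) (z : ℂ) : ℂ := curveInt γ (fun w => (w - z)⁻¹)

/-- The derivative is the integral of `(w - z)⁻²`, which has the primitive `-(w - z)⁻¹`; on a closed
curve its increment is zero. Along the curve the primitive is Lipschitz, so the fundamental theorem
applies. -/
theorem hasDerivAt_windingInt (hγ : LipschitzOnWith K γ (Icc 0 1)) (hc : γ 0 = γ 1) {z : ℂ}
    (hz : z ∉ trace γ) : HasDerivAt (windingInt γ) 0 z := by
  have h1 := hasDerivAt_cauchyIntegral hγ (f := fun _ => 1) continuousOn_const hz 0
  simp only [zero_add, pow_one, one_mul, Nat.cast_zero] at h1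
  refine h1.congr_deriv ?_
  obtain ⟨δ, hδ, hδ'⟩ := exists_le_norm_sub_trace hγ hz
  have hle := hδ' z (Metric.mem_ball_self hδ)
  have hne : ∀ w ∈ trace γ, w - z ≠ 0 := fun w hw h => by
    have := hle w hw
    rw [h, norm_zero] at this
    linarith
  lift δ to ℝ≥0 using hδ.le
  have hLip : LipschitzOnWith (K / δ ^ 2) (fun x => -(γ x - z)⁻¹) (Icc 0 1) := by
    refine LipschitzOnWith.of_dist_le_mul fun x hx y hy => ?_
    rw [dist_eq_norm, dist_eq_norm]
    have e1 := hne _ (mem_trace hx)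
    have e2 := hne _ (mem_trace hy)
    have e3 : -(γ x - z)⁻¹ - -(γ y - z)⁻¹ = (γ x - γ y) / ((γ x - z) * (γ y - z)) := by
      field_simp
      ring
    have e4 : ‖γ x - γ y‖ ≤ K * ‖x - y‖ := hγ.norm_sub_le hx hy
    rw [e3, norm_div, norm_mul]
    push_cast
    rw [div_mul_eq_mul_div, sq]
    exact div_le_div₀ (by positivity) e4 (by positivity)
      (mul_le_mul (hle _ (mem_trace hx)) (hle _ (mem_trace hy)) (by positivity) (norm_nonneg _))
  have hftc := integral_deriv_eq_sub_of_lipschitzOnWith zero_le_one hLip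
  rw [hc, sub_self] at hftc
  rw [← hftc, curveInt]
  refine intervalIntegral.integral_congr_ae ?_
  filter_upwards [ae_differentiableAt_of_lipschitzOnWith hγ] with x hx hxm
  rw [uIoc_of_le zero_le_one] at hxm
  have hxm' := Ioc_subset_Icc_self hxm
  have hd := (((hx hxm').hasDerivAt.sub_const z).inv (hne _ (mem_trace hxm'))).neg
  have hd' : deriv (fun x => -(γ x - z)⁻¹) x = _ := hd.deriv
  rw [hd', smul_eq_mul]
  have := hne _ (mem_trace hxm')
  field_simp

/-- The ray from `z` pointing away from `c` is connected, unbounded and disjoint from the ball, so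
the component of `z` is unbounded. -/
theorem not_mem_trace_of_closedBall {c z : ℂ} {B : ℝ} (hB : trace γ ⊆ Metric.closedBall c B)
    (hz : z ∉ Metric.closedBall c B) : z ∉ trace γ ∧ z ∉ inside γ := by
  refine ⟨fun h => hz (hB h), fun h => ?_⟩
  rw [Metric.mem_closedBall, dist_eq_norm, not_le] at hz
  set S : Set ℂ := (fun t : ℝ => c + t * (z - c)) '' Ici 1 with hS
  have hSconn : IsPreconnected S := isPreconnected_Ici.image _ (by fun_prop)
  have hzS : z ∈ S := ⟨1, self_mem_Ici, by simp⟩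
  -- If `z = c` then `B < 0`, which would make the trace empty.
  by_cases hzc : z = c
  · subst hzc
    simp only [sub_self, norm_zero] at hz
    have hempty : trace γ = ∅ := by
      rw [eq_empty_iff_forall_notMem]
      intro w hw
      have := Metric.mem_closedBall.1 (hB hw)
      linarith [dist_nonneg (x := w) (y := z)]
    have := mem_trace (γ := γ) (x := 0) (by simp)
    rw [hempty] at this
    exact this
  have hpos : 0 < ‖z - c‖ := norm_pos_iff.2 (sub_ne_zero.2 hzc)
  have hnorm : ∀ t : ℝ, 1 ≤ t → ‖(c + t * (z - c)) - c‖ = t * ‖z - c‖ := fun t ht => by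
    rw [add_sub_cancel_left, norm_mul, Complex.norm_real, Real.norm_of_nonneg (by linarith)]
  have hSsub : S ⊆ (trace γ)ᶜ := by
    rintro w ⟨t, ht, rfl⟩ hw
    have h1 := Metric.mem_closedBall.1 (hB hw)
    rw [dist_eq_norm, hnorm t ht] at h1
    have : (1 : ℝ) ≤ t := ht
    nlinarith
  have hbd := h.2.subset (hSconn.subset_connectedComponentIn hzS hSsub)
  obtain ⟨R, hR⟩ := hbd.subset_closedBall c
  -- A point of the ray at distance at least `|R| + ‖z - c‖` from `c`, beyond the supposed bound
  -- `R`.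
  have hmem := hR (⟨max 1 (|R| / ‖z - c‖ + 1), mem_Ici.2 (le_max_left _ _), rfl⟩ :
    c + ((max 1 (|R| / ‖z - c‖ + 1) : ℝ) : ℂ) * (z - c) ∈ S)
  rw [Metric.mem_closedBall, dist_eq_norm, hnorm _ (le_max_left _ _)] at hmem
  have h2 : (|R| / ‖z - c‖ + 1) * ‖z - c‖ ≤ R :=
    (mul_le_mul_of_nonneg_right (le_max_right _ _) hpos.le).trans hmem
  rw [add_mul, div_mul_cancel₀ _ hpos.ne', one_mul] at h2
  linarith [le_abs_self R]

theorem connectedComponentIn_subset_of_not_mem_inside {z : ℂ} (hz : z ∉ trace γ)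
    (hz' : z ∉ inside γ) :
    ∀ w ∈ connectedComponentIn (trace γ)ᶜ z, w ∉ trace γ ∧ w ∉ inside γ := fun w hw => by
  refine ⟨connectedComponentIn_subset _ _ hw, fun h => hz' ⟨hz, ?_⟩⟩
  rw [connectedComponentIn_eq hw]
  exact h.2

theorem isOpen_outside (hγ : LipschitzOnWith K γ (Icc 0 1)) :
    IsOpen {z | z ∉ trace γ ∧ z ∉ inside γ} := by
  rw [isOpen_iff_mem_nhds]
  rintro z ⟨hz, hz'⟩
  exact mem_of_superset ((isCompact_trace hγ).isClosed.isOpen_compl.connectedComponentIn.mem_nhds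
    (mem_connectedComponentIn hz)) (connectedComponentIn_subset_of_not_mem_inside hz hz')

theorem isOpen_inside (hγ : LipschitzOnWith K γ (Icc 0 1)) : IsOpen (inside γ) := by
  rw [isOpen_iff_mem_nhds]
  rintro z ⟨hz, hz'⟩
  refine mem_of_superset ((isCompact_trace hγ).isClosed.isOpen_compl.connectedComponentIn.mem_nhds
    (mem_connectedComponentIn hz)) fun w hw => ⟨connectedComponentIn_subset _ _ hw, ?_⟩
  rwa [← connectedComponentIn_eq hw]

theorem exists_norm_trace_le (hγ : LipschitzOnWith K γ (Icc 0 1)) :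
    ∃ B : ℝ, 0 ≤ B ∧ trace γ ⊆ Metric.closedBall 0 B := by
  obtain ⟨B, hB⟩ := (isCompact_trace hγ).isBounded.subset_closedBall 0
  exact ⟨max B 0, le_max_right _ _,
    hB.trans (Metric.closedBall_subset_closedBall (le_max_left _ _))⟩

theorem norm_curveInt_cauchyKernel_le (hγ : LipschitzOnWith K γ (Icc 0 1)) {f : ℂ → ℂ} {B C : ℝ}
    (hB : trace γ ⊆ Metric.closedBall 0 B) (hC : ∀ w ∈ trace γ, ‖f w‖ ≤ C) {z : ℂ} (hz : B < ‖z‖) :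
    ‖curveInt γ (fun w => f w * (w - z)⁻¹)‖ ≤ K * (C * (‖z‖ - B)⁻¹) := by
  refine norm_curveInt_le hγ fun w hw => ?_
  have hC0 : 0 ≤ C := (norm_nonneg _).trans (hC w hw)
  have h1 : ‖w‖ ≤ B := by simpa using hB hw
  have h2 : ‖z‖ - B ≤ ‖w - z‖ := by
    have := norm_sub_norm_le z w
    rw [norm_sub_rev] at this
    linarith
  have h3 : 0 < ‖z‖ - B := by linarith
  rw [norm_mul, norm_inv]
  gcongr
  exact hC w hw

/-- The curve does not wind around the points of the unbounded part of the complement. -/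
theorem windingInt_eq_zero (hγ : LipschitzOnWith K γ (Icc 0 1)) (hc : γ 0 = γ 1) {z : ℂ}
    (hz : z ∉ trace γ) (hz' : z ∉ inside γ) : windingInt γ z = 0 := by
  obtain ⟨B, hB0, hB⟩ := exists_norm_trace_le hγ
  have hopen := (isCompact_trace hγ).isClosed.isOpen_compl
  set C := connectedComponentIn (trace γ)ᶜ z with hC
  have hCsub : C ⊆ (trace γ)ᶜ := connectedComponentIn_subset _ _
  have hconst : ∀ w ∈ C, windingInt γ z = windingInt γ w := fun w hw =>
    hopen.connectedComponentIn.is_const_of_deriv_eq_zero isPreconnected_connectedComponentIn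
      (fun v hv => (hasDerivAt_windingInt hγ hc (hCsub hv)).differentiableAt.differentiableWithinAt)
      (fun v hv => (hasDerivAt_windingInt hγ hc (hCsub hv)).deriv)
      (mem_connectedComponentIn hz) hw
  have hunb : ¬ Bornology.IsBounded C := fun h => hz' ⟨hz, h⟩
  by_contra hne
  have hpos : 0 < ‖windingInt γ z‖ := norm_pos_iff.2 hne
  -- The winding integral is constant on the component and decays like `K / (‖w‖ - B)`; a nonzero
  -- value would confine the component to a bounded set.
  refine hunb (isBounded_iff_forall_norm_le.2 ⟨B + (K + 1) / ‖windingInt γ z‖, fun w hw => ?_⟩)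
  by_contra! hlt
  have hwB : B < ‖w‖ := lt_of_le_of_lt (by linarith [show 0 ≤ (K + 1) / ‖windingInt γ z‖ by positivity]) hlt
  have h1 := norm_curveInt_cauchyKernel_le hγ (f := fun _ => 1) (C := 1) hB (by simp) hwB
  simp only [one_mul] at h1
  have h2 : ‖windingInt γ z‖ ≤ K * (‖w‖ - B)⁻¹ := by rw [hconst w hw]; exact h1
  have h3 : 0 < ‖w‖ - B := by linarith
  rw [← div_eq_mul_inv, le_div_iff₀ h3] at h2
  have h4 : (K + 1) / ‖windingInt γ z‖ < ‖w‖ - B := by linarith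
  rw [div_lt_iff₀ hpos] at h4
  linarith [mul_comm (‖w‖ - B) ‖windingInt γ z‖]

end LipschitzCurves

/-! ### Cauchy's integral formula by Dixon's method -/

section CauchyFormula

open scoped NNReal

variable {γ : ℝ → ℂ} {K : ℝ≥0} {U : Set ℂ} {f : ℂ → ℂ}

theorem dslope_comm (f : ℂ → ℂ) (a b : ℂ) : dslope f a b = dslope f b a := by
  by_cases h : a = b
  · rw [h]
  · rw [dslope_of_ne _ (Ne.symm h), dslope_of_ne _ h, slope_comm]

/-- The derivative of the divided difference `f[z, w]` in `z` is `f[z, z, w]`. On the diagonal,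
symmetry of `dslope` reduces this to the known regularity in the other argument. -/
theorem hasDerivAt_dslope_left (hU : IsOpen U) (hf : DifferentiableOn ℂ f U) {z w : ℂ}
    (hz : z ∈ U) :
    HasDerivAt (fun z => dslope f z w) (dslope (dslope f z) z w) z := by
  by_cases h : w = z
  · subst h
    have h1 : DifferentiableAt ℂ (dslope f w) w :=
      ((Complex.differentiableOn_dslope (hU.mem_nhds hz)).2 hf).differentiableAt (hU.mem_nhds hz)
    rw [dslope_same]
    exact h1.hasDerivAt.congr_of_eventuallyEq (Eventually.of_forall fun z => dslope_comm f z w)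
  · have hne : w - z ≠ 0 := sub_ne_zero.2 h
    have hd := (hf.differentiableAt (hU.mem_nhds hz)).hasDerivAt
    have h1 : HasDerivAt (fun z => (w - z)⁻¹ * (f w - f z))
        (-(-1) / (w - z) ^ 2 * (f w - f z) + (w - z)⁻¹ * (-deriv f z)) z :=
      (((hasDerivAt_id z).const_sub w).inv hne).mul (hd.const_sub (f w))
    have h2 : (fun z => dslope f z w) =ᶠ[𝓝 z] fun z => (w - z)⁻¹ * (f w - f z) := by
      filter_upwards [isOpen_ne.mem_nhds (Ne.symm h : z ≠ w)] with z' hz'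
      rw [dslope_of_ne _ (Ne.symm hz'), slope_def_field, div_eq_inv_mul]
    refine (h1.congr_of_eventuallyEq h2).congr_deriv ?_
    rw [dslope_of_ne _ h, slope_def_field, dslope_same, dslope_of_ne _ h, slope_def_field]
    field_simp
    ring

theorem continuousOn_dslope_of_differentiableOn (hU : IsOpen U) (hf : DifferentiableOn ℂ f U)
    {z : ℂ} (hz : z ∈ U) : ContinuousOn (dslope f z) U :=
  ((Complex.differentiableOn_dslope (hU.mem_nhds hz)).2 hf).continuousOn

/-- Near the diagonal the mean value inequality bounds the divided difference; away from it the
denominator is bounded below. -/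
theorem exists_norm_dslope_le (hU : IsOpen U) (hf : DifferentiableOn ℂ f U) {T : Set ℂ}
    (hT : IsCompact T) (hTU : T ⊆ U) {z₀ : ℂ} (hz₀ : z₀ ∈ U) :
    ∃ ρ > 0, ∃ C : ℝ, Metric.closedBall z₀ (2 * ρ) ⊆ U ∧
      ∀ z ∈ Metric.closedBall z₀ (2 * ρ), ∀ w ∈ T, ‖dslope f z w‖ ≤ C := by
  obtain ⟨r, hr, hrU⟩ := Metric.isOpen_iff.1 hU z₀ hz₀
  have hsub4 : Metric.closedBall z₀ (4 * (r / 5)) ⊆ U :=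
    (Metric.closedBall_subset_ball (by linarith)).trans hrU
  have hsub2 : Metric.closedBall z₀ (2 * (r / 5)) ⊆ Metric.closedBall z₀ (4 * (r / 5)) :=
    Metric.closedBall_subset_closedBall (by linarith)
  have hcomp := isCompact_closedBall z₀ (4 * (r / 5))
  obtain ⟨M, hM⟩ := hcomp.exists_bound_of_continuousOn ((hf.deriv hU).continuousOn.mono hsub4)
  obtain ⟨B₁, hB₁⟩ := hcomp.exists_bound_of_continuousOn (hf.continuousOn.mono hsub4)
  obtain ⟨B₂, hB₂⟩ := hT.exists_bound_of_continuousOn (hf.continuousOn.mono hTU)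
  -- With `ρ = r / 5` and `z` within `2ρ` of `z₀`, either `w` is within `4ρ`, inside the convex
  -- ball, or `‖w - z‖ ≥ 2ρ`.
  refine ⟨r / 5, by positivity, max M ((B₁ + B₂) / (2 * (r / 5))), hsub2.trans hsub4, ?_⟩
  intro z hz w hw
  have hz4 := hsub2 hz
  by_cases hzw : w = z
  · rw [hzw, dslope_same]
    exact (hM z hz4).trans (le_max_left _ _)
  · have hpos : 0 < ‖w - z‖ := norm_pos_iff.2 (sub_ne_zero.2 hzw)
    rw [dslope_of_ne _ hzw, slope_def_field, norm_div, div_le_iff₀ hpos]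
    by_cases hw4 : w ∈ Metric.closedBall z₀ (4 * (r / 5))
    · have h1 := (convex_closedBall z₀ (4 * (r / 5))).norm_image_sub_le_of_norm_deriv_le
        (fun x hx => hf.differentiableAt (hU.mem_nhds (hsub4 hx))) hM hz4 hw4
      exact h1.trans (mul_le_mul_of_nonneg_right (le_max_left _ _) (norm_nonneg _))
    · have h2 : 2 * (r / 5) ≤ ‖w - z‖ := by
        rw [Metric.mem_closedBall, dist_eq_norm] at hz hw4
        rw [not_le] at hw4
        have : ‖w - z₀‖ ≤ ‖w - z‖ + ‖z - z₀‖ := by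
          calc ‖w - z₀‖ = ‖(w - z) + (z - z₀)‖ := by congr 1; ring
            _ ≤ _ := norm_add_le _ _
        linarith
      have h3 : ‖f w - f z‖ ≤ B₁ + B₂ := by
        have := norm_sub_le (f w) (f z)
        have := hB₁ z hz4
        have := hB₂ w hw
        linarith
      have h4 : 0 ≤ B₁ + B₂ := (norm_nonneg _).trans h3
      calc ‖f w - f z‖ ≤ (B₁ + B₂) / (2 * (r / 5)) * (2 * (r / 5)) := by
            rw [div_mul_cancel₀ _ (by positivity)]; exact h3
        _ ≤ max M ((B₁ + B₂) / (2 * (r / 5))) * ‖w - z‖ := by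
            gcongr
            exact le_max_right _ _

/-- Cauchy's estimate on discs of radius `ρ` turns the uniform bound on the divided difference into
one on its `z`-derivative, as needed for domination. -/
theorem differentiableAt_curveInt_dslope (hγ : LipschitzOnWith K γ (Icc 0 1)) (hU : IsOpen U)
    (hf : DifferentiableOn ℂ f U) (hγU : trace γ ⊆ U) {z₀ : ℂ} (hz₀ : z₀ ∈ U) :
    DifferentiableAt ℂ (fun z => curveInt γ (dslope f z)) z₀ := by
  obtain ⟨ρ, hρ, C, hsub, hC⟩ := exists_norm_dslope_le hU hf (isCompact_trace hγ) hγU hz₀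
  have hball : Metric.ball z₀ ρ ⊆ U := fun z hz =>
    hsub (Metric.closedBall_subset_closedBall (by linarith) (Metric.ball_subset_closedBall hz))
  refine (hasDerivAt_curveInt hγ (g := fun z w => dslope f z w)
    (g' := fun z w => dslope (dslope f z) z w) (s := Metric.ball z₀ ρ) (B := C / ρ)
    (Metric.ball_mem_nhds z₀ hρ) ?_ ?_ ?_ ?_).differentiableAt
  · exact fun z hz => (continuousOn_dslope_of_differentiableOn hU hf (hball hz)).mono hγU
  · exact (continuousOn_dslope_of_differentiableOn hU
      ((Complex.differentiableOn_dslope (hU.mem_nhds hz₀)).2 hf) hz₀).mono hγU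
  · exact fun z hz w _ => hasDerivAt_dslope_left hU hf (hball hz)
  · intro z hz w hw
    rw [← (hasDerivAt_dslope_left hU hf (hball hz)).deriv]
    have hcb : Metric.closedBall z ρ ⊆ Metric.closedBall z₀ (2 * ρ) := by
      refine Metric.closedBall_subset_closedBall' ?_
      have := Metric.mem_ball.1 hz
      linarith
    refine Complex.norm_deriv_le_of_forall_mem_sphere_norm_le hρ ?_ fun v hv =>
      hC v (hcb (Metric.sphere_subset_closedBall hv)) w hw
    refine DifferentiableOn.diffContOnCl_ball (U := U) (fun v hv => ?_) (hcb.trans hsub)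
    exact (hasDerivAt_dslope_left hU hf hv).differentiableAt.differentiableWithinAt

/-- **Cauchy's integral formula** for a closed Lipschitz curve. -/
theorem curveInt_cauchyKernel (hγ : LipschitzOnWith K γ (Icc 0 1)) (hc : γ 0 = γ 1)
    (hU : IsOpen U) (hf : DifferentiableOn ℂ f U) (hγU : trace γ ∪ inside γ ⊆ U) {z : ℂ}
    (hz : z ∈ inside γ) :
    curveInt γ (fun w => f w * (w - z)⁻¹) = windingInt γ z * f z := by
  classical
  have hTU : trace γ ⊆ U := subset_union_left.trans hγU
  have hIU : inside γ ⊆ U := subset_union_right.trans hγU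
  have hfT : ContinuousOn f (trace γ) := hf.continuousOn.mono hTU
  have hker : ∀ z ∉ trace γ, ∀ g : ℂ → ℂ, ContinuousOn g (trace γ) →
      ContinuousOn (fun w => g w * (w - z)⁻¹) (trace γ) := fun z hz g hg => by
    simpa using continuousOn_cauchyKernel hg hz 1
  have hsplit : ∀ z ∉ trace γ, curveInt γ (dslope f z) =
      curveInt γ (fun w => f w * (w - z)⁻¹) - windingInt γ z * f z := by
    intro z hz
    have h1 : curveInt γ (fun w => f z * (w - z)⁻¹) = windingInt γ z * f z := by
      rw [curveInt_const_mul, windingInt, mul_comm]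
    rw [← h1, ← curveInt_sub hγ (hker z hz f hfT) (hker z hz (fun _ => f z) continuousOn_const)]
    refine curveInt_congr fun w hw => ?_
    have hne : w ≠ z := fun h => hz (h ▸ hw)
    rw [dslope_of_ne _ hne, slope_def_field]
    ring
  -- Dixon's function. Outside the curve the winding integral vanishes, so the two expressions agree
  -- there and `H` is entire; it tends to zero at infinity, so Liouville's theorem gives `H = 0`.
  set H : ℂ → ℂ := fun z => if z ∈ U then curveInt γ (dslope f z)
    else curveInt γ (fun w => f w * (w - z)⁻¹) with hH
  have hout : ∀ z, z ∉ trace γ → z ∉ inside γ →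
      H z = curveInt γ (fun w => f w * (w - z)⁻¹) := by
    intro z hz hz'
    by_cases hzU : z ∈ U
    · simp only [hH, hzU, if_true]
      rw [hsplit z hz, windingInt_eq_zero hγ hc hz hz', zero_mul, sub_zero]
    · simp only [hH, hzU, if_false]
  have hdiff : Differentiable ℂ H := by
    intro z
    by_cases hzU : z ∈ U
    · refine (differentiableAt_curveInt_dslope hγ hU hf hTU hzU).congr_of_eventuallyEq ?_
      filter_upwards [hU.mem_nhds hzU] with z' hz'
      simp only [hH, hz', if_true]
    · have hz1 : z ∉ trace γ := fun h => hzU (hTU h)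
      have hz2 : z ∉ inside γ := fun h => hzU (hIU h)
      have h1 := (hasDerivAt_cauchyIntegral hγ hfT hz1 0).differentiableAt
      simp only [zero_add, pow_one] at h1
      refine h1.congr_of_eventuallyEq ?_
      filter_upwards [(isOpen_outside hγ).mem_nhds ⟨hz1, hz2⟩] with z' hz'
      exact hout z' hz'.1 hz'.2
  obtain ⟨B, hB0, hB⟩ := exists_norm_trace_le hγ
  obtain ⟨C, hC⟩ := (isCompact_trace hγ).exists_bound_of_continuousOn hfT
  have hlim : Tendsto H (cocompact ℂ) (𝓝 0) := by
    have h1 : Tendsto (fun z : ℂ => K * (C * (‖z‖ - B)⁻¹)) (cocompact ℂ) (𝓝 0) := by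
      have h2 : Tendsto (fun z : ℂ => ‖z‖ - B) (cocompact ℂ) atTop :=
        tendsto_atTop_add_const_right _ _ tendsto_norm_cocompact_atTop
      simpa using ((tendsto_inv_atTop_zero.comp h2).const_mul C).const_mul (K : ℝ)
    refine squeeze_zero_norm' ?_ h1
    filter_upwards [(tendsto_norm_cocompact_atTop (E := ℂ)).eventually_gt_atTop B] with z hz
    have hzB : z ∉ Metric.closedBall 0 B := by simpa using hz
    obtain ⟨e1, e2⟩ := not_mem_trace_of_closedBall hB hzB
    rw [hout z e1 e2]
    exact norm_curveInt_cauchyKernel_le hγ hB hC hz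
  have hzero : H z = 0 := by
    rw [hdiff.eq_const_of_tendsto_cocompact hlim]
    rfl
  have hzU : z ∈ U := hIU hz
  simp only [hH, hzU, if_true] at hzero
  rw [hsplit z hz.1] at hzero
  exact sub_eq_zero.1 hzero

/-- Cauchy's integral formula for the derivatives. -/
theorem curveInt_cauchyKernel_pow (hγ : LipschitzOnWith K γ (Icc 0 1)) (hc : γ 0 = γ 1)
    (hpos : PositivelyOriented γ) (hU : IsOpen U) (hf : DifferentiableOn ℂ f U)
    (hγU : trace γ ∪ inside γ ⊆ U) (n : ℕ) {z : ℂ} (hz : z ∈ inside γ) :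
    (2 * Real.pi * Complex.I)⁻¹ * curveInt γ (fun w => f w * ((w - z) ^ (n + 1))⁻¹) =
      (n.factorial : ℂ)⁻¹ * iteratedDeriv n f z := by
  have hfT : ContinuousOn f (trace γ) := hf.continuousOn.mono (subset_union_left.trans hγU)
  induction n generalizing z with
  | zero =>
    simp only [zero_add, pow_one, Nat.factorial_zero, Nat.cast_one, inv_one, one_mul,
      iteratedDeriv_zero]
    rw [curveInt_cauchyKernel hγ hc hU hf hγU hz, ← mul_assoc]
    have := hpos z hz
    rw [windingInt, this, one_mul]
  | succ n ih =>
    -- The inside is open, so the formula of order `n` holds near `z` and may be differentiated.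
    have h1 := (hasDerivAt_cauchyIntegral hγ hfT hz.1 n).const_mul (2 * Real.pi * Complex.I : ℂ)⁻¹
    have h2 : (fun z => (2 * Real.pi * Complex.I : ℂ)⁻¹ *
        curveInt γ (fun w => f w * ((w - z) ^ (n + 1))⁻¹)) =ᶠ[𝓝 z]
        fun z => (n.factorial : ℂ)⁻¹ * iteratedDeriv n f z := by
      filter_upwards [(isOpen_inside hγ).mem_nhds hz] with z' hz'
      exact ih hz'
    have h3 := h2.deriv_eq
    rw [h1.deriv, deriv_const_mul_field, ← iteratedDeriv_succ] at h3
    have hn : (n + 1 : ℂ) ≠ 0 := by exact_mod_cast n.succ_ne_zero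
    have h4 : (((n + 1).factorial : ℕ) : ℂ)⁻¹ = (n + 1 : ℂ)⁻¹ * (n.factorial : ℂ)⁻¹ := by
      rw [Nat.factorial_succ, Nat.cast_mul, mul_inv, Nat.cast_add_one]
    rw [h4, mul_assoc (n + 1 : ℂ)⁻¹, ← h3, mul_left_comm, inv_mul_cancel_left₀ hn]

end CauchyFormula

/-! ### Circles as admissible contours -/

section Circle

open Real in
/-- The circle, parametrized by `[0, 1]`. -/
def circleCurve (c : ℂ) (R : ℝ) (x : ℝ) : ℂ := circleMap c R (2 * π * x)

variable {c : ℂ} {R : ℝ}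

theorem lipschitz_circleCurve (c : ℂ) (R : ℝ) : ∃ K : NNReal, LipschitzWith K (circleCurve c R) :=
  ⟨_, (lipschitzWith_circleMap c R).comp
    (LipschitzWith.of_dist_le_mul (K := Real.nnabs (2 * Real.pi)) fun x y => by
      simp [Real.dist_eq, ← mul_sub, abs_mul])⟩

theorem trace_circleCurve (hR : 0 < R) : trace (circleCurve c R) = Metric.sphere c R := by
  refine Subset.antisymm ?_ ?_
  · rintro _ ⟨x, _, rfl⟩
    exact circleMap_mem_sphere c hR.le _
  · intro w hw
    rw [← abs_of_pos hR, ← image_circleMap_Ioc] at hw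
    obtain ⟨θ, hθ, rfl⟩ := hw
    have h2 := Real.two_pi_pos
    refine ⟨θ / (2 * Real.pi), ⟨div_nonneg hθ.1.le h2.le, (div_le_one h2).2 hθ.2⟩, ?_⟩
    rw [circleCurve, mul_div_cancel₀ _ h2.ne']

theorem isRectifiableJordan_circleCurve (hR : 0 < R) : IsRectifiableJordan (circleCurve c R) where
  lipschitz := (lipschitz_circleCurve c R).imp fun _ h => h.lipschitzOnWith
  closed := by simp [circleCurve, circleMap]
  simple := by
    have h := injOn_circleMap_of_abs_sub_le' (c := c) hR.ne' (a := 0) (b := 2 * Real.pi) (by simp)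
    intro x hx y hy hxy
    have h2 := Real.two_pi_pos
    have := h (x₁ := 2 * Real.pi * x) (x₂ := 2 * Real.pi * y)
      ⟨mul_nonneg h2.le hx.1, by nlinarith [hx.2]⟩ ⟨mul_nonneg h2.le hy.1, by nlinarith [hy.2]⟩ hxy
    exact mul_left_cancel₀ h2.ne' this

/-- A component starting in the open ball cannot cross to the disjoint open exterior, hence is
bounded; exterior points are excluded by the ray argument. -/
theorem inside_circleCurve (hR : 0 < R) : inside (circleCurve c R) = Metric.ball c R := by
  have htr := trace_circleCurve (c := c) hR
  ext z
  constructor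
  · intro hz
    by_contra hball
    have hout : z ∉ Metric.closedBall c R := fun h => by
      rw [← Metric.ball_union_sphere] at h
      rcases h with h | h
      · exact hball h
      · exact hz.1 (htr ▸ h)
    exact (not_mem_trace_of_closedBall (htr ▸ Metric.sphere_subset_closedBall) hout).2 hz
  · intro hz
    have hzt : z ∉ trace (circleCurve c R) := by
      rw [htr, Metric.mem_sphere]
      exact (Metric.mem_ball.1 hz).ne
    refine ⟨hzt, Metric.isBounded_ball.subset (isPreconnected_connectedComponentIn
      |>.subset_left_of_subset_union Metric.isOpen_ball (isOpen_compl_iff.2 Metric.isClosed_closedBall)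
      (disjoint_compl_right.mono_left Metric.ball_subset_closedBall) ?_
      ⟨z, mem_connectedComponentIn hzt, hz⟩)⟩
    refine (connectedComponentIn_subset _ _).trans fun w hw => ?_
    rw [htr] at hw
    by_cases hwb : w ∈ Metric.closedBall c R
    · rw [← Metric.ball_union_sphere] at hwb
      exact Or.inl (hwb.resolve_right hw)
    · exact Or.inr hwb

theorem positivelyOriented_circleCurve (hR : 0 < R) : PositivelyOriented (circleCurve c R) := by
  intro z hz
  rw [inside_circleCurve hR] at hz
  have h1 : curveInt (circleCurve c R) (fun t => (t - z)⁻¹) = ∮ w in C(c, R), (w - z)⁻¹ := by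
    rw [circleIntegral, curveInt]
    have h2 := intervalIntegral.integral_comp_mul_left (a := 0) (b := 1)
      (fun θ => deriv (circleMap c R) θ • (fun w => (w - z)⁻¹) (circleMap c R θ))
      Real.two_pi_pos.ne'
    rw [mul_zero, mul_one] at h2
    have h3 := (eq_inv_smul_iff₀ Real.two_pi_pos.ne').1 h2
    rw [← h3, ← intervalIntegral.integral_smul]
    refine intervalIntegral.integral_congr fun x _ => ?_
    have hd : deriv (circleCurve c R) x =
        (2 * Real.pi : ℝ) • deriv (circleMap c R) (2 * Real.pi * x) := by
      have e1 : HasDerivAt (fun x : ℝ => 2 * Real.pi * x) (2 * Real.pi) x := by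
        simpa using (hasDerivAt_id x).const_mul (2 * Real.pi)
      rw [(hasDerivAt_circleMap c R _).deriv]
      exact ((hasDerivAt_circleMap c R (2 * Real.pi * x)).scomp x e1).deriv
    simp only [hd, circleCurve, smul_assoc]
  rw [h1, circleIntegral.integral_sub_inv_of_mem_ball hz]
  exact inv_mul_cancel₀ (by simp [Real.pi_ne_zero])

end Circle

/-! ### Multiplication in a Cartan basis -/

section CartanBasis

variable {A : Type*} [NormedCommRing A] [NormedAlgebra ℂ A] {m d : ℕ}
  {I : Module.Basis (Fin m ⊕ Fin d) ℂ A} {u : Fin d → Fin m}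

theorem functional_inl (v w : Fin m) :
    functional I v (I (Sum.inl w)) = if w = v then 1 else 0 := by
  simp [functional, Finsupp.single_apply]

theorem functional_inr (v : Fin m) (s : Fin d) : functional I v (I (Sum.inr s)) = 0 := by
  simp [functional]

theorem eq_sum_add_sum (ζ : A) :
    ζ = ∑ v, functional I v ζ • I (Sum.inl v) + ∑ s, I.repr ζ (Sum.inr s) • I (Sum.inr s) := by
  conv_lhs => rw [← I.sum_repr ζ, Fintype.sum_sum_type]
  simp [functional]

theorem IsCartanBasis.idem_mul (hI : IsCartanBasis I u) (v : Fin m) (ζ : A) :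
    I (Sum.inl v) * ζ = functional I v ζ • I (Sum.inl v) +
      ∑ s, if v = u s then I.repr ζ (Sum.inr s) • I (Sum.inr s) else 0 := by
  conv_lhs => rw [eq_sum_add_sum (I := I) ζ]
  rw [mul_add, Finset.mul_sum, Finset.mul_sum]
  congr 1
  · simp only [mul_smul_comm, hI.idem_mul_idem]
    rw [Finset.sum_eq_single v]
    · simp
    · intro w _ hw
      simp [Ne.symm hw]
    · simp
  · refine Finset.sum_congr rfl fun s _ => ?_
    rw [mul_smul_comm, hI.idem_mul_nil]
    split_ifs <;> simp

/-- Comparing coefficients in `I_v * 1 = I_v` shows that `f_v(1) = 1` for all `v` and that the unit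
has no nilpotent component. -/
theorem IsCartanBasis.sum_idem (hI : IsCartanBasis I u) : ∑ v, I (Sum.inl v) = 1 := by
  have h1 : ∀ v : Fin m, functional I v (1 : A) = 1 := fun v => by
    have h := congrArg (functional I v) (hI.idem_mul v 1)
    rw [mul_one, map_add, map_smul, map_sum, functional_inl] at h
    have h2 : ∑ s, functional I v (if v = u s then I.repr (1 : A) (Sum.inr s) • I (Sum.inr s)
        else 0) = 0 := by
      refine Finset.sum_eq_zero fun s _ => ?_
      split_ifs <;> simp [functional_inr]
    rw [h2] at h
    simpa using h.symm
  have h2 : ∀ s : Fin d, I.repr (1 : A) (Sum.inr s) = 0 := fun s => by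
    have h := congrArg (fun x => I.repr x (Sum.inr s)) (hI.idem_mul (u s) 1)
    simp only [mul_one, map_add, map_smul, map_sum, Finsupp.add_apply, Finsupp.smul_apply,
      Finsupp.finsetSum_apply, Module.Basis.repr_self] at h
    rw [Finset.sum_eq_single s] at h
    · simpa using h.symm
    · intro q _ hq
      split_ifs <;> simp [hq]
    · simp
  conv_rhs => rw [eq_sum_add_sum (I := I) (1 : A)]
  simp [h1, h2]

theorem IsCartanBasis.repr_nil_mul_nil_inl (hI : IsCartanBasis I u) (r s : Fin d) (v : Fin m) :
    I.repr (I (Sum.inr r) * I (Sum.inr s)) (Sum.inl v) = 0 := by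
  rw [hI.nil_mul_nil]
  simp only [map_sum, map_smul, Finsupp.finsetSum_apply, Finsupp.smul_apply,
    Module.Basis.repr_self]
  simp

theorem IsCartanBasis.structConst_eq_zero (hI : IsCartanBasis I u) {r p s : Fin d}
    (h : ¬ max r s < p) : structConst I r p s = 0 := by
  rw [structConst, hI.nil_mul_nil]
  simp only [map_sum, map_smul, Finsupp.finsetSum_apply, Finsupp.smul_apply,
    Module.Basis.repr_self]
  refine Finset.sum_eq_zero fun q hq => ?_
  have : q ≠ p := fun hqp => h (hqp ▸ (Finset.mem_filter.1 hq).2)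
  simp [this]

/-- Both sides are bilinear, so basis vectors suffice; products involving a nilpotent vector have no
idempotent component. -/
theorem IsCartanBasis.functional_mul (hI : IsCartanBasis I u) (v : Fin m) (a b : A) :
    functional I v (a * b) = functional I v a * functional I v b := by
  have key : (LinearMap.mul ℂ A).compr₂ (functional I v) =
      (LinearMap.mul ℂ ℂ).compl₁₂ (functional I v) (functional I v) := by
    refine LinearMap.ext_basis I I fun i j => ?_
    rcases i with i | i <;> rcases j with j | j
    · simp only [LinearMap.compr₂_apply, LinearMap.mul_apply_apply, LinearMap.compl₁₂_apply,
        functional_inl, hI.idem_mul_idem]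
      split_ifs <;> simp_all [functional_inl]
    · simp only [LinearMap.compr₂_apply, LinearMap.mul_apply_apply, LinearMap.compl₁₂_apply,
        functional_inr, hI.idem_mul_nil]
      split_ifs <;> simp [functional_inr]
    · simp only [LinearMap.compr₂_apply, LinearMap.mul_apply_apply, LinearMap.compl₁₂_apply,
        functional_inr, mul_comm (I (Sum.inr i)), hI.idem_mul_nil]
      split_ifs <;> simp [functional_inr]
    · simp only [LinearMap.compr₂_apply, LinearMap.mul_apply_apply, LinearMap.compl₁₂_apply,
        functional_inr, mul_zero]
      exact hI.repr_nil_mul_nil_inl i j v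
  exact LinearMap.congr_fun₂ key a b

/-- The first `j` nilpotent coordinates and all the idempotent coordinates of `b` vanish. -/
def VanishesBelow (I : Module.Basis (Fin m ⊕ Fin d) ℂ A) (j : ℕ) (b : A) : Prop :=
  (∀ v, functional I v b = 0) ∧ ∀ q : Fin d, (q : ℕ) < j → I.repr b (Sum.inr q) = 0

theorem VanishesBelow.mono {i j : ℕ} (hij : i ≤ j) {b : A} (hb : VanishesBelow I j b) :
    VanishesBelow I i b :=
  ⟨hb.1, fun q hq => hb.2 q (hq.trans_le hij)⟩

/-- A product of nilpotent basis vectors only has components beyond both indices, so coordinates of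
`b` from `q` on cannot reach coordinate `q` through nilpotent factors. Only the idempotent `I_{u_q}`
acting on `b_q` contributes. -/
theorem IsCartanBasis.repr_mul_inr (hI : IsCartanBasis I u) (q : Fin d) (a : A) {b : A}
    (hb : VanishesBelow I q b) :
    I.repr (a * b) (Sum.inr q) = functional I (u q) a * I.repr b (Sum.inr q) := by
  have key : (I.coord (Sum.inr q)).comp (LinearMap.mulRight ℂ b) =
      I.repr b (Sum.inr q) • functional I (u q) := by
    refine I.ext fun i => ?_
    rcases i with r | r
    · simp only [LinearMap.comp_apply, LinearMap.mulRight_apply, LinearMap.smul_apply,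
        functional_inl, hI.idem_mul, Module.Basis.coord_apply]
      simp only [map_add, map_smul, map_sum, Finsupp.add_apply, Finsupp.smul_apply,
        Finsupp.finsetSum_apply, Module.Basis.repr_self]
      rw [Finset.sum_eq_single q]
      · split_ifs <;> simp
      · intro s _ hs
        split_ifs <;> simp [hs]
      · simp
    · simp only [LinearMap.comp_apply, LinearMap.mulRight_apply, LinearMap.smul_apply,
        functional_inr, smul_zero, Module.Basis.coord_apply]
      conv_lhs => rw [eq_sum_add_sum (I := I) b]
      simp only [hb.1, zero_smul, Finset.sum_const_zero, zero_add, Finset.mul_sum, mul_smul_comm,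
        map_sum, map_smul, Finsupp.finsetSum_apply, Finsupp.smul_apply]
      refine Finset.sum_eq_zero fun s _ => ?_
      by_cases hs : s < q
      · rw [hb.2 s hs, zero_smul]
      · have : structConst I r q s = 0 :=
          hI.structConst_eq_zero fun h => hs ((le_max_right _ _).trans_lt h)
        rw [structConst] at this
        rw [this, smul_zero]
  have h := LinearMap.congr_fun key a
  simp only [LinearMap.comp_apply, LinearMap.mulRight_apply, LinearMap.smul_apply,
    Module.Basis.coord_apply, smul_eq_mul] at h
  rw [h, mul_comm]

theorem IsCartanBasis.vanishesBelow_mul (hI : IsCartanBasis I u) {j : ℕ} (a : A) {b : A}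
    (hb : VanishesBelow I j b) : VanishesBelow I j (a * b) := by
  refine ⟨fun v => by rw [hI.functional_mul, hb.1, mul_zero], fun q hq => ?_⟩
  rw [hI.repr_mul_inr q a (hb.mono hq.le), hb.2 q hq, mul_zero]

/-- The nilpotent part of an element. -/
def nilPart (I : Module.Basis (Fin m ⊕ Fin d) ℂ A) : A →ₗ[ℂ] A :=
  ∑ s : Fin d, (I.coord (Sum.inr s)).smulRight (I (Sum.inr s))

theorem nilPart_apply (ζ : A) :
    nilPart I ζ = ∑ s, I.repr ζ (Sum.inr s) • I (Sum.inr s) := by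
  simp [nilPart]

/-- For `r ≥ 1` the range of summation is empty. This is what truncates the explicit formula and
makes `N` nilpotent. -/
theorem coeffQ_eq_zero (ζ : A) {r : ℕ} {s : Fin d} (h : (s : ℕ) < r) :
    coeffQ I ζ (r + 2) s = 0 := by
  cases r with
  | zero => exact absurd h (Nat.not_lt_zero _)
  | succ r =>
    rw [coeffQ]
    refine Finset.sum_eq_zero fun q hq => ?_
    have := (Finset.mem_filter.1 hq).2
    have h2 : (q : ℕ) < s := this.2
    omega

theorem repr_sum_smul_inr (c : Fin d → ℂ) (s : Fin d) :
    I.repr (∑ q, c q • I (Sum.inr q)) (Sum.inr s) = c s := by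
  simp only [map_sum, map_smul, Finsupp.finsetSum_apply, Finsupp.smul_apply,
    Module.Basis.repr_self]
  rw [Finset.sum_eq_single s]
  · simp
  · intro q _ hq
    simp [hq]
  · simp

theorem IsCartanBasis.sum_mul_sum (hI : IsCartanBasis I u) (c c' : Fin d → ℂ) :
    (∑ q, c q • I (Sum.inr q)) * (∑ p, c' p • I (Sum.inr p)) =
      ∑ s, (∑ q, ∑ p, c q * c' p * structConst I q s p) • I (Sum.inr s) := by
  refine I.ext_elem fun i => ?_
  rw [Finset.sum_mul_sum]
  rcases i with v | s
  · simp only [map_sum, map_smul, smul_mul_smul_comm, Finsupp.finsetSum_apply,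
      Finsupp.smul_apply, hI.repr_nil_mul_nil_inl, smul_zero, Finset.sum_const_zero,
      Module.Basis.repr_self]
    simp
  · rw [repr_sum_smul_inr]
    simp only [map_sum, map_smul, smul_mul_smul_comm, Finsupp.finsetSum_apply,
      Finsupp.smul_apply, smul_eq_mul, structConst]

/-- The coefficients of the powers of the nilpotent part. -/
theorem IsCartanBasis.nilPart_pow (hI : IsCartanBasis I u) (ζ : A) (r : ℕ) :
    nilPart I ζ ^ (r + 1) = ∑ s, coeffQ I ζ (r + 2) s • I (Sum.inr s) := by
  induction r with
  | zero => rw [zero_add, pow_one, nilPart_apply]; rfl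
  | succ r ih =>
    rw [pow_succ, ih, nilPart_apply, hI.sum_mul_sum]
    refine Finset.sum_congr rfl fun s _ => ?_
    congr 1
    rw [coeffQ, Finset.sum_filter]
    refine Finset.sum_congr rfl fun q _ => ?_
    have hp : ∑ p, coeffQ I ζ (r + 2) q * I.repr ζ (Sum.inr p) * structConst I q s p =
        coeffQ I ζ (r + 2) q * coeffB I ζ q s := by
      rw [coeffB, Finset.mul_sum, Finset.sum_filter]
      refine Finset.sum_congr rfl fun p _ => ?_
      split_ifs with hps
      · ring
      · rw [hI.structConst_eq_zero fun h => hps ((le_max_right _ _).trans_lt h), mul_zero]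
    rw [hp]
    split_ifs with hq
    · rfl
    -- Terms outside the range prescribed for `Q` vanish: for small `q` the earlier coefficient is
    -- zero, and for `q ≥ s` the structure constants are.
    · rw [not_and_or, not_le] at hq
      rcases hq with hq | hq
      · rw [coeffQ_eq_zero ζ hq, zero_mul]
      · rw [coeffB, Finset.sum_eq_zero, mul_zero]
        intro p _
        rw [hI.structConst_eq_zero fun h => hq ((le_max_left _ _).trans_lt h), mul_zero]

theorem IsCartanBasis.nilPart_pow_eq_zero (hI : IsCartanBasis I u) (ζ : A) {r : ℕ} (hr : d < r) :
    nilPart I ζ ^ r = 0 := by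
  obtain ⟨k, rfl⟩ : ∃ k, r = k + 1 := ⟨r - 1, by omega⟩
  rw [hI.nilPart_pow]
  refine Finset.sum_eq_zero fun s _ => ?_
  rw [coeffQ_eq_zero ζ (by omega), zero_smul]

theorem IsCartanBasis.mul_idem (hI : IsCartanBasis I u) (v : Fin m) (ζ : A) :
    ζ * I (Sum.inl v) = functional I v ζ • I (Sum.inl v) + nilPart I ζ * I (Sum.inl v) := by
  conv_lhs => rw [eq_sum_add_sum (I := I) ζ, add_mul, ← nilPart_apply]
  congr 1
  rw [Finset.sum_mul, Finset.sum_eq_single v]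
  · rw [smul_mul_assoc, hI.idem_mul_idem, if_pos rfl]
  · intro w _ hw
    rw [smul_mul_assoc, hI.idem_mul_idem, if_neg hw, smul_zero]
  · simp

theorem IsCartanBasis.idem_mul_idem_self (hI : IsCartanBasis I u) (v : Fin m) :
    I (Sum.inl v) * I (Sum.inl v) = I (Sum.inl v) := by
  rw [hI.idem_mul_idem, if_pos rfl]

theorem IsCartanBasis.nil_mul_idem (hI : IsCartanBasis I u) (s : Fin d) :
    I (Sum.inr s) * I (Sum.inl (u s)) = I (Sum.inr s) := by
  rw [mul_comm, hI.idem_mul_nil, if_pos rfl]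

end CartanBasis

/-! ### Principal extensions and the explicit formula -/

section PrincipalExtension

variable {A : Type*} [NormedCommRing A] [NormedAlgebra ℂ A] {m d : ℕ}
  {I : Module.Basis (Fin m ⊕ Fin d) ℂ A} {u : Fin d → Fin m}

/-- The component along `I_v` of the principal extension of the function `F` to the algebra. -/
def extension (I : Module.Basis (Fin m ⊕ Fin d) ℂ A) (v : Fin m) (F : ℂ → ℂ) (ζ : A) : A :=
  ∑ r ∈ Finset.range (d + 1), ((r.factorial : ℂ)⁻¹ * iteratedDeriv r F (functional I v ζ)) •
    (nilPart I ζ ^ r * I (Sum.inl v))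

theorem extension_eq (v : Fin m) (F : ℂ → ℂ) (ζ : A) :
    extension I v F ζ = F (functional I v ζ) • I (Sum.inl v) +
      ∑ r ∈ Finset.range d, (((r + 1).factorial : ℂ)⁻¹ *
        iteratedDeriv (r + 1) F (functional I v ζ)) • (nilPart I ζ ^ (r + 1) * I (Sum.inl v)) := by
  rw [extension, Finset.sum_range_succ', add_comm]
  simp

/-- Reindexing of the sum over `2 ≤ r ≤ s + 2` in the explicit representation. -/
theorem sum_Icc_eq_sum_range (ζ : A) (c : ℕ → ℂ) (s : Fin d) (x : A) :
    ∑ r ∈ Finset.Icc 2 ((s : ℕ) + 2), (((r - 1).factorial : ℂ)⁻¹ * coeffQ I ζ r s *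
      c (r - 1)) • x =
    ∑ r ∈ Finset.range d, (((r + 1).factorial : ℂ)⁻¹ * c (r + 1) * coeffQ I ζ (r + 2) s) • x := by
  have h1 : Finset.Icc 2 ((s : ℕ) + 2) = (Finset.range ((s : ℕ) + 1)).map (addRightEmbedding 2) := by
    ext r
    simp only [Finset.mem_Icc, Finset.mem_map, Finset.mem_range, addRightEmbedding_apply]
    constructor
    · rintro ⟨h1, h2⟩
      exact ⟨r - 2, by omega, by omega⟩
    · rintro ⟨k, hk, rfl⟩
      omega
  rw [h1, Finset.sum_map]
  have hs : (s : ℕ) + 1 ≤ d := s.2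
  rw [← Finset.sum_subset (Finset.range_subset_range.2 hs)]
  · refine Finset.sum_congr rfl fun r _ => ?_
    simp only [addRightEmbedding_apply, show r + 2 - 1 = r + 1 from rfl]
    ring_nf
  · intro r _ hr
    rw [Finset.mem_range, not_lt] at hr
    rw [coeffQ_eq_zero ζ (by omega), mul_zero, zero_smul]

/-- The powers of `N` are expanded in the nilpotent basis. The factor `I_v` retains exactly the
`I_s` with `u_s = v`, while in the `G`-terms `I_q` absorbs `I_{u_q}`. -/
theorem IsCartanBasis.explicitExpr_eq (hI : IsCartanBasis I u) (F : Fin m → ℂ → ℂ)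
    (G : Fin d → ℂ → ℂ) (ζ : A) :
    explicitExpr I u F G ζ = ∑ v, extension I v (F v) ζ +
      ∑ s, I (Sum.inr s) * extension I (u s) (G s) ζ := by
  have hF : ∑ v, extension I v (F v) ζ = ∑ v, F v (functional I v ζ) • I (Sum.inl v) +
      ∑ s : Fin d, ∑ r ∈ Finset.Icc 2 ((s : ℕ) + 2),
        (((r - 1).factorial : ℂ)⁻¹ * coeffQ I ζ r s *
          iteratedDeriv (r - 1) (F (u s)) (functional I (u s) ζ)) • I (Sum.inr s) := by
    simp only [extension_eq, Finset.sum_add_distrib]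
    congr 1
    have h1 : ∀ s : Fin d, ∑ r ∈ Finset.Icc 2 ((s : ℕ) + 2),
        (((r - 1).factorial : ℂ)⁻¹ * coeffQ I ζ r s *
          iteratedDeriv (r - 1) (F (u s)) (functional I (u s) ζ)) • I (Sum.inr s) =
        ∑ r ∈ Finset.range d, (((r + 1).factorial : ℂ)⁻¹ *
          iteratedDeriv (r + 1) (F (u s)) (functional I (u s) ζ) *
            coeffQ I ζ (r + 2) s) • I (Sum.inr s) := fun s =>
      sum_Icc_eq_sum_range ζ (fun r => iteratedDeriv r (F (u s)) (functional I (u s) ζ)) s _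
    rw [Finset.sum_congr rfl fun s _ => h1 s, Finset.sum_comm, Finset.sum_comm (s := Finset.univ)]
    refine Finset.sum_congr rfl fun r _ => ?_
    simp only [hI.nilPart_pow, Finset.sum_mul, smul_mul_assoc, mul_comm (I (Sum.inr _)),
      hI.idem_mul_nil, Finset.smul_sum]
    rw [Finset.sum_comm]
    refine Finset.sum_congr rfl fun s _ => ?_
    rw [Finset.sum_eq_single (u s)]
    · rw [if_pos rfl, smul_smul]
    · intro v _ hv
      rw [if_neg hv, smul_zero, smul_zero]
    · simp
  have hG : ∑ q, I (Sum.inr q) * extension I (u q) (G q) ζ =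
      ∑ q, G q (functional I (u q) ζ) • I (Sum.inr q) +
      ∑ q : Fin d, ∑ s : Fin d, ∑ r ∈ Finset.Icc 2 ((s : ℕ) + 2),
        (((r - 1).factorial : ℂ)⁻¹ * coeffQ I ζ r s *
          iteratedDeriv (r - 1) (G q) (functional I (u q) ζ)) •
            (I (Sum.inr q) * I (Sum.inr s)) := by
    rw [← Finset.sum_add_distrib]
    refine Finset.sum_congr rfl fun q _ => ?_
    rw [extension_eq, mul_add, mul_smul_comm, hI.nil_mul_idem]
    congr 1
    have h1 : ∀ s : Fin d, ∑ r ∈ Finset.Icc 2 ((s : ℕ) + 2),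
        (((r - 1).factorial : ℂ)⁻¹ * coeffQ I ζ r s *
          iteratedDeriv (r - 1) (G q) (functional I (u q) ζ)) • (I (Sum.inr q) * I (Sum.inr s)) =
        ∑ r ∈ Finset.range d, (((r + 1).factorial : ℂ)⁻¹ *
          iteratedDeriv (r + 1) (G q) (functional I (u q) ζ) *
            coeffQ I ζ (r + 2) s) • (I (Sum.inr q) * I (Sum.inr s)) := fun s =>
      sum_Icc_eq_sum_range ζ (fun r => iteratedDeriv r (G q) (functional I (u q) ζ)) s _
    rw [Finset.sum_congr rfl fun s _ => h1 s, Finset.sum_comm, Finset.mul_sum]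
    refine Finset.sum_congr rfl fun r _ => ?_
    rw [mul_smul_comm, mul_left_comm, hI.nil_mul_idem, hI.nilPart_pow, Finset.sum_mul,
      Finset.smul_sum]
    refine Finset.sum_congr rfl fun s _ => ?_
    rw [smul_mul_assoc, smul_smul, mul_comm (I (Sum.inr s))]
  rw [hF, hG, explicitExpr, add_assoc (_ + _)]

end PrincipalExtension

theorem curveInt_finset_sum {F ι : Type*} [NormedAddCommGroup F] [NormedSpace ℂ F] {γ : ℝ → ℂ}
    {K : NNReal} (hγ : LipschitzOnWith K γ (Icc 0 1)) {s : Finset ι} {g : ι → ℂ → F}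
    (hg : ∀ i ∈ s, ContinuousOn (g i) (trace γ)) :
    curveInt γ (fun t => ∑ i ∈ s, g i t) = ∑ i ∈ s, curveInt γ (g i) := by
  simp only [curveInt, Finset.smul_sum]
  exact intervalIntegral.integral_finsetSum fun i hi => intervalIntegrable_deriv_smul hγ (hg i hi)

/-! ### The resolvent and the integral formula -/

section Resolvent

variable {A : Type*} [NormedCommRing A] [NormedAlgebra ℂ A] {m d : ℕ}
  {I : Module.Basis (Fin m ⊕ Fin d) ℂ A} {u : Fin d → Fin m}

/-- On the ideal of `I_v` the element `t - ζ` acts as `(t - ξ_v) - N`, so its inverse is a geometric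
series, which terminates because `N ^ (d + 1) = 0`. -/
theorem IsCartanBasis.inverse_eq (hI : IsCartanBasis I u) {ζ : A} {t : ℂ}
    (ht : ∀ v, t ≠ functional I v ζ) :
    Ring.inverse (t • (1 : A) - ζ) = ∑ v, ∑ r ∈ Finset.range (d + 1),
      ((t - functional I v ζ) ^ (r + 1))⁻¹ • (nilPart I ζ ^ r * I (Sum.inl v)) := by
  set b := ∑ v, ∑ r ∈ Finset.range (d + 1),
    ((t - functional I v ζ) ^ (r + 1))⁻¹ • (nilPart I ζ ^ r * I (Sum.inl v)) with hb
  have hmul : (t • (1 : A) - ζ) * b = 1 := by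
    rw [hb, Finset.mul_sum]
    conv_rhs => rw [← hI.sum_idem]
    refine Finset.sum_congr rfl fun v _ => ?_
    rw [Finset.mul_sum]
    set g : ℕ → A := fun r =>
      ((t - functional I v ζ) ^ r)⁻¹ • (nilPart I ζ ^ r * I (Sum.inl v)) with hg
    have hterm : ∀ r, (t • (1 : A) - ζ) *
        (((t - functional I v ζ) ^ (r + 1))⁻¹ • (nilPart I ζ ^ r * I (Sum.inl v))) =
        g r - g (r + 1) := fun r => by
      have hne : t - functional I v ζ ≠ 0 := sub_ne_zero.2 (ht v)
      have h1 : (t • (1 : A) - ζ) * I (Sum.inl v) =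
          (t - functional I v ζ) • I (Sum.inl v) - nilPart I ζ * I (Sum.inl v) := by
        rw [sub_mul, hI.mul_idem v ζ, smul_mul_assoc, one_mul, sub_smul]
        abel
      rw [mul_smul_comm, mul_left_comm, h1, mul_sub, smul_sub, mul_smul_comm, smul_smul, hg]
      congr 1
      · congr 1
        rw [pow_succ]
        field_simp
      · rw [← mul_assoc, ← pow_succ]
    rw [Finset.sum_congr rfl fun r _ => hterm r, Finset.sum_range_sub']
    simp [hg, hI.nilPart_pow_eq_zero ζ (Nat.lt_succ_self d)]
  have := Ring.inverse_unit (⟨t • (1 : A) - ζ, b, hmul, by rw [mul_comm]; exact hmul⟩ : Aˣ)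
  exact this

/-- The factor `I_v` kills the other blocks of the resolvent, so only the pole `ξ_v` has to be
surrounded. The remaining points must be avoided for the resolvent to exist along the curve. -/
theorem IsCartanBasis.idem_mul_resolventInt (hI : IsCartanBasis I u) {ζ : A} {v : Fin m}
    {γ : ℝ → ℂ} {U : Set ℂ} {f : ℂ → ℂ} (hγ : IsRectifiableJordan γ) (hpos : PositivelyOriented γ)
    (hU : IsOpen U) (hf : DifferentiableOn ℂ f U) (hγU : trace γ ∪ inside γ ⊆ U)
    (hin : functional I v ζ ∈ inside γ) (hno : ∀ w, functional I w ζ ∉ trace γ) :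
    I (Sum.inl v) * resolventInt γ f ζ = extension I v f ζ := by
  obtain ⟨K, hK⟩ := hγ.lipschitz
  have hfT : ContinuousOn f (trace γ) := hf.continuousOn.mono (subset_union_left.trans hγU)
  have : FiniteDimensional ℂ A := I.finiteDimensional_of_finite
  have : CompleteSpace A := FiniteDimensional.complete ℂ A
  have h1 : curveInt γ (fun t => f t • Ring.inverse (t • (1 : A) - ζ)) =
      ∑ w, ∑ r ∈ Finset.range (d + 1),
        curveInt γ (fun t => f t * ((t - functional I w ζ) ^ (r + 1))⁻¹) •
          (nilPart I ζ ^ r * I (Sum.inl w)) := by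
    have e1 : curveInt γ (fun t => f t • Ring.inverse (t • (1 : A) - ζ)) =
        curveInt γ (fun t => ∑ w, ∑ r ∈ Finset.range (d + 1),
          (f t * ((t - functional I w ζ) ^ (r + 1))⁻¹) •
            (nilPart I ζ ^ r * I (Sum.inl w))) := by
      refine curveInt_congr fun t ht => ?_
      rw [hI.inverse_eq fun w h => hno w (h ▸ ht)]
      simp only [Finset.smul_sum, smul_smul]
    have hcont : ∀ w r, ContinuousOn (fun t => (f t * ((t - functional I w ζ) ^ (r + 1))⁻¹) •
        (nilPart I ζ ^ r * I (Sum.inl w))) (trace γ) := fun w r =>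
      (continuousOn_cauchyKernel hfT (hno w) (r + 1)).smul continuousOn_const
    rw [e1, curveInt_finset_sum hK fun w _ => continuousOn_finsetSum _ fun r _ => hcont w r]
    refine Finset.sum_congr rfl fun w _ => ?_
    rw [curveInt_finset_sum hK fun r _ => hcont w r]
    refine Finset.sum_congr rfl fun r _ => ?_
    simp only [curveInt]
    rw [← intervalIntegral.integral_smul_const]
    simp only [smul_assoc]
  rw [resolventInt, h1, mul_smul_comm, Finset.mul_sum, Finset.sum_eq_single v]
  · rw [Finset.mul_sum, extension, Finset.smul_sum]
    refine Finset.sum_congr rfl fun r _ => ?_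
    rw [mul_smul_comm, mul_left_comm, hI.idem_mul_idem_self, smul_smul,
      curveInt_cauchyKernel_pow hK hγ.closed hpos hU hf hγU r hin]
  · intro w _ hw
    rw [Finset.mul_sum]
    refine Finset.sum_eq_zero fun r _ => ?_
    rw [mul_smul_comm, mul_left_comm, hI.idem_mul_idem, if_neg (Ne.symm hw), mul_zero, smul_zero]
  · simp

theorem IsCartanBasis.integralExpr_eq (hI : IsCartanBasis I u) {E : Submodule ℝ A} {Ω : Set E}
    (hD : ∀ v, IsOpen (imageD I Ω v)) {F : Fin m → ℂ → ℂ} {G : Fin d → ℂ → ℂ}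
    (hFG : HolomorphicData I u Ω F G) {ζ : E} {Γ : Fin m → ℝ → ℂ} (hΓ : AreContours I Ω ζ Γ) :
    integralExpr I u F G Γ (ζ : A) = explicitExpr I u F G (ζ : A) := by
  rw [hI.explicitExpr_eq, integralExpr]
  congr 1
  · refine Finset.sum_congr rfl fun v _ => ?_
    obtain ⟨h1, h2, h3, h4, h5⟩ := hΓ v
    exact hI.idem_mul_resolventInt h1 h2 (hD v) (hFG.1 v) h3 h4 h5
  · refine Finset.sum_congr rfl fun s _ => ?_
    obtain ⟨h1, h2, h3, h4, h5⟩ := hΓ (u s)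
    conv_lhs => rw [← hI.nil_mul_idem, mul_assoc]
    rw [hI.idem_mul_resolventInt h1 h2 (hD (u s)) (hFG.2 s) h3 h4 h5]

end Resolvent

/-! ### Existence of contours -/

section Contours

variable {A : Type*} [NormedCommRing A] [NormedAlgebra ℂ A] {m d : ℕ}
  {I : Module.Basis (Fin m ⊕ Fin d) ℂ A}

/-- Small circles about `ξ_q` serve: only finitely many radii hit some `ξ_l`. -/
theorem exists_areContours {E : Submodule ℝ A} {Ω : Set E} (hD : ∀ v, IsOpen (imageD I Ω v))
    {ζ : E} (hζ : ζ ∈ Ω) : ∃ Γ : Fin m → ℝ → ℂ, AreContours I Ω ζ Γ := by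
  have h : ∀ q : Fin m, ∃ R > 0, Metric.closedBall (functional I q (ζ : A)) R ⊆ imageD I Ω q ∧
      ∀ l, functional I l (ζ : A) ∉ Metric.sphere (functional I q (ζ : A)) R := fun q => by
    have h1 : ∀ᶠ R in 𝓝[>] (0 : ℝ),
        Metric.closedBall (functional I q (ζ : A)) R ⊆ imageD I Ω q := by
      obtain ⟨ε, hε, hball⟩ := Metric.isOpen_iff.1 (hD q) _ (mem_image_of_mem _ hζ)
      filter_upwards [Ioo_mem_nhdsGT hε] with R hR
      exact (Metric.closedBall_subset_ball hR.2).trans hball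
    have h2 : ∀ l, ∀ᶠ R in 𝓝[>] (0 : ℝ),
        functional I l (ζ : A) ∉ Metric.sphere (functional I q (ζ : A)) R := fun l => by
      by_cases hl : dist (functional I l (ζ : A)) (functional I q (ζ : A)) = 0
      · filter_upwards [self_mem_nhdsWithin] with R hR
        rw [Metric.mem_sphere, hl]
        exact (ne_of_gt hR).symm
      · filter_upwards [mem_nhdsWithin_of_mem_nhds (isOpen_ne.mem_nhds (Ne.symm hl))] with R hR
        rw [Metric.mem_sphere]
        exact Ne.symm hR
    obtain ⟨R, ⟨e1, e2⟩, e3⟩ :=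
      ((h1.and (eventually_all.2 h2)).and self_mem_nhdsWithin).exists
    exact ⟨R, e3, e1, e2⟩
  choose R hR hsub hno using h
  refine ⟨fun q => circleCurve (functional I q (ζ : A)) (R q), fun q => ?_⟩
  refine ⟨isRectifiableJordan_circleCurve (hR q), positivelyOriented_circleCurve (hR q), ?_, ?_, ?_⟩
  · rw [trace_circleCurve (hR q), inside_circleCurve (hR q), union_comm, Metric.ball_union_sphere]
    exact hsub q
  · rw [inside_circleCurve (hR q)]
    exact Metric.mem_ball_self (hR q)
  · intro l
    rw [trace_circleCurve (hR q)]
    exact hno q l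

end Contours

/-! ### Functions that factor through a linear functional -/

section Gateaux

/-- Monogenicity gives right-hand limits only; applying it to `h` and `-h` yields the two-sided
derivative. -/
theorem hasDerivAt_of_tendsto_right {F : Type*} [NormedAddCommGroup F] [NormedSpace ℝ F]
    {g : ℝ → F} {c : F}
    (h₁ : Tendsto (fun ε : ℝ => ε⁻¹ • (g ε - g 0)) (𝓝[>] 0) (𝓝 c))
    (h₂ : Tendsto (fun ε : ℝ => ε⁻¹ • (g (-ε) - g 0)) (𝓝[>] 0) (𝓝 (-c))) :
    HasDerivAt g c 0 := by
  rw [hasDerivAt_iff_tendsto_slope_zero, ← Iio_union_Ioi, nhdsWithin_union]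
  simp only [zero_add]
  refine Tendsto.sup ?_ h₁
  have h3 : Tendsto (fun t : ℝ => -t) (𝓝[<] 0) (𝓝[>] 0) := by
    simpa using tendsto_neg_nhdsLT (a := (0 : ℝ))
  refine ((h₂.comp h3).neg).congr' ?_ |>.trans (by rw [neg_neg])
  refine Eventually.of_forall fun t => ?_
  simp [inv_neg]

variable {E : Type*} [NormedAddCommGroup E] [NormedSpace ℝ E]

/-- A function that is continuous on an open set and whose directional derivatives are the
multiples `L h * c` of a linear functional `L` is a holomorphic function of `L`. -/
theorem exists_differentiableOn_eq_comp [FiniteDimensional ℝ E] (L : E →ₗ[ℝ] ℂ)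
    (hL : Function.Surjective L) {Ω : Set E} (hΩo : IsOpen Ω)
    (hΩ : ∀ ζ₁ ∈ Ω, ∀ ζ₂ ∈ Ω, L (ζ₂ - ζ₁) = 0 → segment ℝ ζ₁ ζ₂ ⊆ Ω) {φ : E → ℂ}
    (hφ : ContinuousOn φ Ω)
    (hd : ∀ ζ ∈ Ω, ∃ c : ℂ, ∀ h : E, HasDerivAt (fun t : ℝ => φ (ζ + t • h)) (L h * c) 0) :
    ∃ G : ℂ → ℂ, DifferentiableOn ℂ G (L '' Ω) ∧ ∀ ζ ∈ Ω, φ ζ = G (L ζ) := by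
  have hLc : Continuous L := L.continuous_of_finiteDimensional
  have hfib : ∀ ζ₁ ∈ Ω, ∀ ζ₂ ∈ Ω, L ζ₁ = L ζ₂ → φ ζ₁ = φ ζ₂ := by
    intro ζ₁ h₁ ζ₂ h₂ heq
    have h0 : L (ζ₂ - ζ₁) = 0 := by rw [map_sub, heq, sub_self]
    have hseg := hΩ ζ₁ h₁ ζ₂ h₂ h0
    have hmem : ∀ t ∈ Icc (0 : ℝ) 1, ζ₁ + t • (ζ₂ - ζ₁) ∈ Ω := fun t ht => by
      refine hseg ?_
      rw [segment_eq_image']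
      exact ⟨t, ht, rfl⟩
    -- Along a direction in the kernel of `L` the derivative `L h * c` is zero.
    have hconst := constant_of_has_deriv_right_zero (f := fun t : ℝ => φ (ζ₁ + t • (ζ₂ - ζ₁)))
      (a := 0) (b := 1) (hφ.comp (by fun_prop) hmem) (fun t ht => by
        obtain ⟨c, hc⟩ := hd _ (hmem t (Ico_subset_Icc_self ht))
        have h3 : HasDerivAt (fun s : ℝ => φ (ζ₁ + t • (ζ₂ - ζ₁) + s • (ζ₂ - ζ₁))) 0 (t - t) := by
          have := hc (ζ₂ - ζ₁)
          rwa [h0, zero_mul, ← sub_self t] at this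
        have h4 := h3.comp_sub_const t t
        refine (h4.congr_of_eventuallyEq (Eventually.of_forall fun s => ?_)).hasDerivWithinAt
        simp only
        congr 1
        module)
    have := hconst 1 (right_mem_Icc.2 zero_le_one)
    simp only [one_smul, zero_smul, add_zero, add_sub_cancel] at this
    exact this.symm
  set G : ℂ → ℂ := fun w => φ (Function.invFunOn L Ω w) with hG
  have hGL : ∀ ζ ∈ Ω, φ ζ = G (L ζ) := fun ζ hζ =>
    hfib ζ hζ _ (Function.invFunOn_mem ⟨ζ, hζ, rfl⟩) (Function.invFunOn_eq ⟨ζ, hζ, rfl⟩).symm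
  refine ⟨G, ?_, hGL⟩
  -- The section `σ` lifts a neighbourhood of `L ζ` into `Ω`, so continuity and the directional
  -- derivatives pass from `φ` to `G`, whose definition by arbitrary preimages shows no regularity.
  obtain ⟨σ, hσ⟩ := L.exists_rightInverse_of_surjective (LinearMap.range_eq_top.2 hL)
  have hσL : ∀ w, L (σ w) = w := fun w => LinearMap.congr_fun hσ w
  have hσc : Continuous σ := σ.continuous_of_finiteDimensional
  have hlocal : ∀ ζ ∈ Ω, ∀ᶠ w in 𝓝 (L ζ), ζ + σ (w - L ζ) ∈ Ω := fun ζ hζ => by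
    have hc : ContinuousAt (fun w => ζ + σ (w - L ζ)) (L ζ) := by fun_prop
    refine hc (hΩo.mem_nhds ?_)
    simpa using hζ
  have hGσ : ∀ ζ w, ζ + σ (w - L ζ) ∈ Ω → G w = φ (ζ + σ (w - L ζ)) := fun ζ w hw => by
    rw [hGL _ hw, map_add, hσL, add_sub_cancel]
  have hdir : ∀ ζ ∈ Ω, ∀ c : ℂ, (∀ h : E, HasDerivAt (fun t : ℝ => φ (ζ + t • h)) (L h * c) 0) →
      ∀ v : ℂ, HasDerivAt (fun t : ℝ => G (L ζ + t * v)) (v * c) 0 := by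
    intro ζ hζ c hc v
    have h1 := hc (σ v)
    rw [hσL] at h1
    refine h1.congr_of_eventuallyEq ?_
    have h2 : Tendsto (fun t : ℝ => L ζ + t * v) (𝓝 0) (𝓝 (L ζ)) := by
      have : ContinuousAt (fun t : ℝ => L ζ + t * v) 0 := by fun_prop
      simpa [ContinuousAt] using this
    filter_upwards [h2.eventually (hlocal ζ hζ)] with t ht
    rw [hGσ _ _ ht]
    congr 2
    rw [add_sub_cancel_left, ← map_smul, Complex.real_smul]
  have hopen : IsOpen (L '' Ω) := L.isOpenMap_of_finiteDimensional hL Ω hΩo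
  choose! c hc using hd
  refine differentiableOn_of_cauchyRiemann (F' := fun w => c (Function.invFunOn L Ω w)) hopen ?_
    ?_ ?_
  · rintro _ ⟨ζ, hζ, rfl⟩
    refine ContinuousAt.continuousWithinAt ?_
    have h1 : ContinuousAt (fun w => φ (ζ + σ (w - L ζ))) (L ζ) := by
      refine ContinuousAt.comp (g := φ) ?_ (by fun_prop)
      simpa using hφ.continuousAt (hΩo.mem_nhds hζ)
    refine h1.congr ?_
    filter_upwards [hlocal ζ hζ] with w hw
    exact (hGσ ζ w hw).symm
  · intro w hw
    have hmem := Function.invFunOn_mem hw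
    have h1 := hdir _ hmem _ (hc _ hmem) 1
    rw [Function.invFunOn_eq hw] at h1
    simpa using h1
  · intro w hw
    have hmem := Function.invFunOn_mem hw
    have h1 := hdir _ hmem _ (hc _ hmem) Complex.I
    rw [Function.invFunOn_eq hw] at h1
    exact h1

end Gateaux

/-! ### Gateaux derivatives of principal extensions -/

section MonogenicFunctions

variable {A : Type*} [NormedCommRing A] [NormedAlgebra ℂ A] {m d : ℕ}
  {I : Module.Basis (Fin m ⊕ Fin d) ℂ A} {u : Fin d → Fin m} {E : Submodule ℝ A}

/-- The derivative of `Φ` at `ζ` in the direction `h` is `h * Φ'` for all `h`. -/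
def HasGateauxDeriv (Φ : E → A) (Φ' : A) (ζ : E) : Prop :=
  ∀ h : E, HasDerivAt (fun t : ℝ => Φ (ζ + t • h)) ((h : A) * Φ') 0

theorem Monogenic.exists_hasGateauxDeriv {Ω : Set E} {Φ : E → A} (hΦ : Monogenic Ω Φ) {ζ : E}
    (hζ : ζ ∈ Ω) : ∃ Φ' : A, HasGateauxDeriv Φ Φ' ζ := by
  obtain ⟨Φ', hΦ'⟩ := hΦ.2 ζ hζ
  refine ⟨Φ', fun h => hasDerivAt_of_tendsto_right ?_ ?_⟩
  · simpa using hΦ' h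
  · simpa using hΦ' (-h)

theorem HasGateauxDeriv.sub {Φ Ψ : E → A} {Φ' Ψ' : A} {ζ : E} (hΦ : HasGateauxDeriv Φ Φ' ζ)
    (hΨ : HasGateauxDeriv Ψ Ψ' ζ) : HasGateauxDeriv (fun ζ => Φ ζ - Ψ ζ) (Φ' - Ψ') ζ := fun h => by
  rw [mul_sub]
  exact (hΦ h).sub (hΨ h)

theorem HasGateauxDeriv.sum {ι : Type*} {s : Finset ι} {Φ : ι → E → A} {Φ' : ι → A} {ζ : E}
    (hΦ : ∀ i ∈ s, HasGateauxDeriv (Φ i) (Φ' i) ζ) :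
    HasGateauxDeriv (fun ζ => ∑ i ∈ s, Φ i ζ) (∑ i ∈ s, Φ' i) ζ := fun h => by
  rw [Finset.mul_sum]
  exact HasDerivAt.fun_sum fun i hi => hΦ i hi h

theorem HasGateauxDeriv.const_mul (a : A) {Φ : E → A} {Φ' : A} {ζ : E}
    (hΦ : HasGateauxDeriv Φ Φ' ζ) : HasGateauxDeriv (fun ζ => a * Φ ζ) (a * Φ') ζ := fun h => by
  rw [mul_left_comm]
  exact (hΦ h).const_mul a

/-- The added term is zero; it provides room for the shift of index caused by differentiation. -/
theorem IsCartanBasis.extension_eq_sum_range_add_two (hI : IsCartanBasis I u) (v : Fin m)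
    (F : ℂ → ℂ) (ζ : A) : extension I v F ζ =
      ∑ r ∈ Finset.range (d + 2), ((r.factorial : ℂ)⁻¹ * iteratedDeriv r F (functional I v ζ)) •
        (nilPart I ζ ^ r * I (Sum.inl v)) := by
  rw [Finset.sum_range_succ, hI.nilPart_pow_eq_zero ζ (Nat.lt_succ_self d), zero_mul, smul_zero,
    add_zero, extension]

theorem analyticAt_iteratedDeriv {F : ℂ → ℂ} {z : ℂ} (hF : AnalyticAt ℂ F z) (r : ℕ) :
    AnalyticAt ℂ (iteratedDeriv r F) z := by
  rw [iteratedDeriv_eq_iterate]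
  exact hF.iterated_deriv r

/-- Termwise differentiation gives one sum with `H`, from the powers of `N`, and one with `η`, from
the coefficients. After a shift of index they combine through `h * I_v = η I_v + H I_v`. -/
theorem IsCartanBasis.hasGateauxDeriv_extension (hI : IsCartanBasis I u) {v : Fin m}
    {F : ℂ → ℂ} {ζ : E} (hF : AnalyticAt ℂ F (functional I v (ζ : A))) :
    HasGateauxDeriv (fun ζ : E => extension I v F (ζ : A)) (extension I v (deriv F) (ζ : A)) ζ := by
  intro h
  set ξ := functional I v (ζ : A) with hξ
  set η := functional I v (h : A) with hη
  set N := nilPart I (ζ : A) with hN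
  set H := nilPart I (h : A) with hH
  have hterm : ∀ r : ℕ, HasDerivAt (fun t : ℝ => ((r.factorial : ℂ)⁻¹ *
      iteratedDeriv r F (functional I v ((ζ + t • h : E) : A))) •
        (nilPart I ((ζ + t • h : E) : A) ^ r * I (Sum.inl v)))
      (((r.factorial : ℂ)⁻¹ * iteratedDeriv r F ξ) • (r * N ^ (r - 1) * H * I (Sum.inl v)) +
        ((r.factorial : ℂ)⁻¹ * (iteratedDeriv (r + 1) F ξ * η)) • (N ^ r * I (Sum.inl v))) 0 := by
    intro r
    have e1 : ∀ t : ℝ, ((ζ + t • h : E) : A) = (ζ : A) + (t : ℂ) • (h : A) := fun t => by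
      simp
    have hscal : HasDerivAt (fun t : ℝ => functional I v ((ζ + t • h : E) : A)) η 0 := by
      have h1 : HasDerivAt (fun t : ℝ => ξ + (t : ℂ) * η) (1 * η) 0 :=
        ((Complex.ofRealCLM.hasDerivAt (x := (0 : ℝ))).mul_const η).const_add ξ
      rw [one_mul] at h1
      refine h1.congr_of_eventuallyEq (Eventually.of_forall fun t => ?_)
      simp only [e1, map_add, map_smul, smul_eq_mul, hξ, hη]
    have hnil : HasDerivAt (fun t : ℝ => nilPart I ((ζ + t • h : E) : A)) H 0 := by
      have h1 : HasDerivAt (fun t : ℝ => N + (t : ℂ) • H) ((1 : ℂ) • H) 0 :=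
        ((Complex.ofRealCLM.hasDerivAt (x := (0 : ℝ))).smul_const H).const_add N
      rw [one_smul] at h1
      refine h1.congr_of_eventuallyEq (Eventually.of_forall fun t => ?_)
      simp only [e1, map_add, map_smul, hN, hH]
    have hF1 : HasDerivAt (iteratedDeriv r F) (iteratedDeriv (r + 1) F ξ)
        (functional I v ((ζ + (0 : ℝ) • h : E) : A)) := by
      rw [zero_smul, add_zero, iteratedDeriv_succ]
      exact (analyticAt_iteratedDeriv hF r).differentiableAt.hasDerivAt
    have h2 := (hF1.comp (0 : ℝ) hscal).const_mul (r.factorial : ℂ)⁻¹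
    have h3 := (hnil.pow r).mul_const (I (Sum.inl v))
    have h4 := h2.smul h3
    refine h4.congr_deriv ?_
    simp only [zero_smul, add_zero, Function.comp, Pi.pow_apply, ← hξ, ← hN]
  have hsum := HasDerivAt.fun_sum fun r (_ : r ∈ Finset.range (d + 2)) => hterm r
  have hfun : (fun t : ℝ => extension I v F ((ζ + t • h : E) : A)) = fun t : ℝ =>
      ∑ r ∈ Finset.range (d + 2), ((r.factorial : ℂ)⁻¹ *
      iteratedDeriv r F (functional I v ((ζ + t • h : E) : A))) •
        (nilPart I ((ζ + t • h : E) : A) ^ r * I (Sum.inl v)) := by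
    ext t
    rw [hI.extension_eq_sum_range_add_two]
  rw [hfun]
  refine hsum.congr_deriv ?_
  -- The first sum loses its term `r = 0` because of the factor `r`, the second its term `r = d + 1`
  -- because `N ^ (d + 1) = 0`.
  rw [Finset.sum_add_distrib, Finset.sum_range_succ', Finset.sum_range_succ (n := d + 1),
    hI.nilPart_pow_eq_zero (ζ : A) (Nat.lt_succ_self d), extension, Finset.mul_sum]
  simp only [Nat.cast_zero, zero_mul, smul_zero, add_zero]
  rw [← Finset.sum_add_distrib]
  refine Finset.sum_congr rfl fun r _ => ?_
  have hrhs : ∀ c : ℂ, (h : A) * (c • (N ^ r * I (Sum.inl v))) =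
      c • (N ^ r * (H * I (Sum.inl v))) + c • (N ^ r * (η • I (Sum.inl v))) := fun c => by
    rw [mul_smul_comm, mul_left_comm, hI.mul_idem v (h : A), mul_add, smul_add, add_comm]
  rw [← hξ, ← hN, ← iteratedDeriv_succ', hrhs, Nat.add_sub_cancel]
  congr 1
  · have hr : ((r + 1 : ℕ) : A) = ((r + 1 : ℕ) : ℂ) • (1 : A) := by
      rw [← Algebra.algebraMap_eq_smul_one, map_natCast]
    rw [hr, smul_mul_assoc, one_mul, smul_mul_assoc, smul_mul_assoc, smul_smul, mul_assoc]
    have hf : ((r + 1).factorial : ℂ)⁻¹ * ((r + 1 : ℕ) : ℂ) = (r.factorial : ℂ)⁻¹ := by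
      rw [Nat.factorial_succ, Nat.cast_mul, mul_inv, mul_comm, mul_inv_cancel_left₀]
      exact_mod_cast r.succ_ne_zero
    congr 1
    · rw [← hf]
      ring
    · rw [mul_assoc]
  · rw [mul_smul_comm, smul_smul, mul_assoc]

end MonogenicFunctions

/-! ### Peeling off the coordinates of a monogenic function -/

section Representation

variable {A : Type*} [NormedCommRing A] [NormedAlgebra ℂ A] {m d : ℕ}
  {I : Module.Basis (Fin m ⊕ Fin d) ℂ A} {u : Fin d → Fin m} {E : Submodule ℝ A} {Ω : Set E}

theorem HasGateauxDeriv.comp_linear (hfin : FiniteDimensional ℂ A) (ℓ : A →ₗ[ℂ] ℂ) {Φ : E → A}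
    {Φ' : A} {ζ : E} (hΦ : HasGateauxDeriv Φ Φ' ζ) (h : E) :
    HasDerivAt (fun t : ℝ => ℓ (Φ (ζ + t • h))) (ℓ ((h : A) * Φ')) 0 :=
  ((LinearMap.toContinuousLinearMap ℓ).restrictScalars ℝ).hasFDerivAt.comp_hasDerivAt 0 (hΦ h)

/-- The linear functional `f_v` on `E`. -/
def functionalOn (I : Module.Basis (Fin m ⊕ Fin d) ℂ A) (E : Submodule ℝ A) (v : Fin m) :
    E →ₗ[ℝ] ℂ :=
  ((functional I v).restrictScalars ℝ).comp E.subtype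

theorem surjective_functionalOn {v : Fin m} (h : functional I v '' (E : Set A) = univ) :
    Function.Surjective (functionalOn I E v) := fun w => by
  obtain ⟨ζ, hζ, rfl⟩ := (h ▸ mem_univ w : w ∈ functional I v '' (E : Set A))
  exact ⟨⟨ζ, hζ⟩, rfl⟩

theorem finiteDimensional_submodule (I : Module.Basis (Fin m ⊕ Fin d) ℂ A) (E : Submodule ℝ A) :
    FiniteDimensional ℝ E := by
  have : FiniteDimensional ℂ A := I.finiteDimensional_of_finite
  have : FiniteDimensional ℝ A := FiniteDimensional.complexToReal A
  infer_instance

theorem isOpen_imageD {v : Fin m} (h : functional I v '' (E : Set A) = univ) (hΩ : IsOpen Ω) :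
    IsOpen (imageD I Ω v) := by
  have := finiteDimensional_submodule I E
  exact (functionalOn I E v).isOpenMap_of_finiteDimensional (surjective_functionalOn h) Ω hΩ

theorem exists_differentiableOn_imageD {v : Fin m} (hs : functional I v '' (E : Set A) = univ)
    (hΩo : IsOpen Ω) (hΩ : ConvexWrt Ω (directions I E v)) {φ : E → ℂ} (hφ : ContinuousOn φ Ω)
    (hd : ∀ ζ ∈ Ω, ∃ c : ℂ, ∀ h : E,
      HasDerivAt (fun t : ℝ => φ (ζ + t • h)) (functional I v (h : A) * c) 0) :
    ∃ G : ℂ → ℂ, DifferentiableOn ℂ G (imageD I Ω v) ∧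
      ∀ ζ ∈ Ω, φ ζ = G (functional I v (ζ : A)) := by
  have := finiteDimensional_submodule I E
  exact exists_differentiableOn_eq_comp (functionalOn I E v) (surjective_functionalOn hs) hΩo
    (fun ζ₁ h₁ ζ₂ h₂ h => hΩ ζ₁ h₁ ζ₂ h₂ h) hφ hd

theorem analyticAt_of_imageD {v : Fin m} (hD : IsOpen (imageD I Ω v)) {F : ℂ → ℂ}
    (hF : DifferentiableOn ℂ F (imageD I Ω v)) {ζ : E} (hζ : ζ ∈ Ω) :
    AnalyticAt ℂ F (functional I v (ζ : A)) :=
  hF.analyticAt (hD.mem_nhds (mem_image_of_mem _ hζ))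

theorem continuousOn_extension {v : Fin m} (hD : IsOpen (imageD I Ω v)) {F : ℂ → ℂ}
    (hF : DifferentiableOn ℂ F (imageD I Ω v)) :
    ContinuousOn (fun ζ : E => extension I v F (ζ : A)) Ω := by
  have : FiniteDimensional ℂ A := I.finiteDimensional_of_finite
  have hf : Continuous (functional I v) := (functional I v).continuous_of_finiteDimensional
  have hn : Continuous (nilPart I) := (nilPart I).continuous_of_finiteDimensional
  simp only [extension]
  refine continuousOn_finsetSum _ fun r _ => ContinuousOn.smul ?_ ?_
  · refine continuousOn_const.mul fun ζ hζ => ContinuousAt.continuousWithinAt ?_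
    exact ContinuousAt.comp (g := iteratedDeriv r F)
      (analyticAt_iteratedDeriv (analyticAt_of_imageD hD hF hζ) r).continuousAt
      (hf.comp continuous_subtype_val).continuousAt
  · exact (((hn.comp continuous_subtype_val).pow r).mul continuous_const).continuousOn

theorem functional_nilPart (v : Fin m) (ζ : A) : functional I v (nilPart I ζ) = 0 := by
  rw [nilPart_apply, map_sum]
  exact Finset.sum_eq_zero fun s _ => by rw [map_smul, functional_inr, smul_zero]

theorem IsCartanBasis.functional_extension (hI : IsCartanBasis I u) (v w : Fin m) (F : ℂ → ℂ)
    (ζ : A) : functional I v (extension I w F ζ) =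
      if w = v then F (functional I v ζ) else 0 := by
  rw [extension_eq, map_add, map_smul, functional_inl, map_sum, Finset.sum_eq_zero, add_zero]
  · split_ifs with h
    · rw [h, smul_eq_mul, mul_one]
    · rw [smul_zero]
  · intro r _
    rw [map_smul, hI.functional_mul, pow_succ, hI.functional_mul, functional_nilPart, mul_zero,
      zero_mul, smul_zero]

theorem vanishesBelow_inr (j : Fin d) : VanishesBelow I j (I (Sum.inr j)) := by
  refine ⟨fun v => functional_inr v j, fun q hq => ?_⟩
  have : j ≠ q := fun h => by rw [h] at hq; exact lt_irrefl _ hq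
  simp [this]

/-- A Gateaux derivative inherits the vanishing coordinates of the function. -/
theorem HasGateauxDeriv.vanishesBelow (h1 : (1 : A) ∈ E) (hΩo : IsOpen Ω) {Φ : E → A} {Φ' : A}
    {ζ : E} (hζ : ζ ∈ Ω) (hΦ : HasGateauxDeriv Φ Φ' ζ) {j : ℕ}
    (hv : ∀ ζ ∈ Ω, VanishesBelow I j (Φ ζ)) : VanishesBelow I j Φ' := by
  have hfin : FiniteDimensional ℂ A := I.finiteDimensional_of_finite
  have hnear : ∀ᶠ t : ℝ in 𝓝 0, ζ + t • (⟨1, h1⟩ : E) ∈ Ω := by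
    have hc : ContinuousAt (fun t : ℝ => ζ + t • (⟨1, h1⟩ : E)) 0 := by fun_prop
    refine hc (hΩo.mem_nhds ?_)
    simpa using hζ
  have key : ∀ ℓ : A →ₗ[ℂ] ℂ, (∀ ζ ∈ Ω, ℓ (Φ ζ) = 0) → ℓ Φ' = 0 := fun ℓ hℓ => by
    -- In the direction `1` the derivative is `Φ'` itself.
    have h2 := hΦ.comp_linear hfin ℓ (⟨1, h1⟩ : E)
    have h3 : HasDerivAt (fun t : ℝ => ℓ (Φ (ζ + t • (⟨1, h1⟩ : E)))) 0 0 := by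
      refine (hasDerivAt_const (0 : ℝ) (0 : ℂ)).congr_of_eventuallyEq ?_
      filter_upwards [hnear] with t ht
      exact hℓ _ ht
    simpa using h2.unique h3
  exact ⟨fun v => key (functional I v) fun ζ hζ => (hv ζ hζ).1 v,
    fun q hq => key (I.coord (Sum.inr q)) fun ζ hζ => (hv ζ hζ).2 q hq⟩

/-- A function with values in the radical, whose first `j` nilpotent coordinates vanish, has a
holomorphic `j`-th coordinate. -/
theorem exists_holomorphic_coordinate (hI : IsCartanBasis I u) (h1 : (1 : A) ∈ E)
    (hs : ∀ v, functional I v '' (E : Set A) = univ) (hΩo : IsOpen Ω)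
    (hΩ : ∀ v, ConvexWrt Ω (directions I E v)) {Ψ : E → A} (hc : ContinuousOn Ψ Ω)
    (hd : ∀ ζ ∈ Ω, ∃ Ψ' : A, HasGateauxDeriv Ψ Ψ' ζ) (j : Fin d)
    (hv : ∀ ζ ∈ Ω, VanishesBelow I j (Ψ ζ)) :
    ∃ G : ℂ → ℂ, DifferentiableOn ℂ G (imageD I Ω (u j)) ∧
      ∀ ζ ∈ Ω, I.repr (Ψ ζ) (Sum.inr j) = G (functional I (u j) (ζ : A)) := by
  have hfin : FiniteDimensional ℂ A := I.finiteDimensional_of_finite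
  refine exists_differentiableOn_imageD (φ := fun ζ => I.coord (Sum.inr j) (Ψ ζ)) (hs (u j)) hΩo
    (hΩ (u j)) ((I.coord (Sum.inr j)).continuous_of_finiteDimensional.comp_continuousOn hc) ?_
  intro ζ hζ
  obtain ⟨Ψ', hΨ'⟩ := hd ζ hζ
  refine ⟨I.repr Ψ' (Sum.inr j), fun h => ?_⟩
  have h2 := hΨ'.comp_linear hfin (I.coord (Sum.inr j)) h
  rw [Module.Basis.coord_apply,
    hI.repr_mul_inr j (h : A) (hΨ'.vanishesBelow h1 hΩo hζ hv)] at h2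
  exact h2

theorem exists_holomorphic_functional (hI : IsCartanBasis I u)
    (hs : ∀ v, functional I v '' (E : Set A) = univ) (hΩo : IsOpen Ω)
    (hΩ : ∀ v, ConvexWrt Ω (directions I E v)) {Ψ : E → A} (hc : ContinuousOn Ψ Ω)
    (hd : ∀ ζ ∈ Ω, ∃ Ψ' : A, HasGateauxDeriv Ψ Ψ' ζ) (v : Fin m) :
    ∃ F : ℂ → ℂ, DifferentiableOn ℂ F (imageD I Ω v) ∧
      ∀ ζ ∈ Ω, functional I v (Ψ ζ) = F (functional I v (ζ : A)) := by
  have hfin : FiniteDimensional ℂ A := I.finiteDimensional_of_finite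
  refine exists_differentiableOn_imageD (φ := fun ζ => functional I v (Ψ ζ)) (hs v) hΩo
    (hΩ v) ((functional I v).continuous_of_finiteDimensional.comp_continuousOn hc) ?_
  intro ζ hζ
  obtain ⟨Ψ', hΨ'⟩ := hd ζ hζ
  refine ⟨functional I v Ψ', fun h => ?_⟩
  have h2 := hΨ'.comp_linear hfin (functional I v) h
  rwa [hI.functional_mul] at h2

/-- A function with values in the radical, whose first `j` nilpotent coordinates vanish, is a sum
of principal extensions multiplied by nilpotent basis vectors. -/
theorem exists_eq_sum_nil_mul_extension (hI : IsCartanBasis I u) (h1 : (1 : A) ∈ E)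
    (hs : ∀ v, functional I v '' (E : Set A) = univ) (hΩo : IsOpen Ω)
    (hΩ : ∀ v, ConvexWrt Ω (directions I E v)) (k j : ℕ) (hk : d ≤ j + k) {Ψ : E → A}
    (hc : ContinuousOn Ψ Ω) (hd : ∀ ζ ∈ Ω, ∃ Ψ' : A, HasGateauxDeriv Ψ Ψ' ζ)
    (hv : ∀ ζ ∈ Ω, VanishesBelow I j (Ψ ζ)) :
    ∃ G : Fin d → ℂ → ℂ, (∀ s, DifferentiableOn ℂ (G s) (imageD I Ω (u s))) ∧
      ∀ ζ ∈ Ω, Ψ ζ = ∑ s ∈ Finset.univ.filter (fun s : Fin d => j ≤ (s : ℕ)),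
        I (Sum.inr s) * extension I (u s) (G s) (ζ : A) := by
  induction k generalizing j Ψ with
  | zero =>
    refine ⟨fun _ _ => 0, fun s => differentiableOn_const 0, fun ζ hζ => ?_⟩
    have hempty : Finset.univ.filter (fun s : Fin d => j ≤ (s : ℕ)) = ∅ := by
      ext s
      simp only [Finset.mem_filter, Finset.mem_univ, true_and, Finset.notMem_empty, iff_false]
      omega
    rw [hempty, Finset.sum_empty, eq_sum_add_sum (I := I) (Ψ ζ)]
    simp only [(hv ζ hζ).1, zero_smul, Finset.sum_const_zero, zero_add]
    refine Finset.sum_eq_zero fun s _ => ?_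
    rw [(hv ζ hζ).2 s (by omega), zero_smul]
  | succ k ih =>
    by_cases hj : d ≤ j + k
    · exact ih j hj hc hd hv
    obtain ⟨i, hi⟩ : ∃ i : Fin d, (i : ℕ) = j := ⟨⟨j, by omega⟩, rfl⟩
    subst hi
    obtain ⟨g, hg, hgΨ⟩ := exists_holomorphic_coordinate hI h1 hs hΩo hΩ hc hd i hv
    -- Subtracting `I_i` times the extension of `g` removes coordinate `i`, which in the product is
    -- exactly `g(ξ)`, and leaves the earlier coordinates zero.
    have hD := fun v => isOpen_imageD (hs v) hΩo
    obtain ⟨G, hG, hGΨ⟩ := ih (i + 1) (by omega)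
      (Ψ := fun ζ => Ψ ζ - I (Sum.inr i) * extension I (u i) g (ζ : A))
      (hc.sub (continuousOn_const.mul (continuousOn_extension (hD (u i)) hg)))
      (fun ζ hζ => by
        obtain ⟨Ψ', hΨ'⟩ := hd ζ hζ
        exact ⟨_, hΨ'.sub ((hI.hasGateauxDeriv_extension
          (analyticAt_of_imageD (hD (u i)) hg hζ)).const_mul (I (Sum.inr i)))⟩)
      (fun ζ hζ => by
        have hb := hI.vanishesBelow_mul (extension I (u i) g (ζ : A)) (vanishesBelow_inr i)
        rw [mul_comm] at hb
        refine ⟨fun v => by rw [map_sub, (hv ζ hζ).1, hb.1, sub_zero], fun q hq => ?_⟩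
        rw [map_sub, Finsupp.sub_apply]
        rcases Nat.lt_succ_iff_lt_or_eq.1 hq with hlt | heq
        · rw [(hv ζ hζ).2 q hlt, hb.2 q hlt, sub_zero]
        · obtain rfl : q = i := Fin.ext heq
          rw [hgΨ ζ hζ, mul_comm, hI.repr_mul_inr q _ (vanishesBelow_inr q),
            hI.functional_extension, if_pos rfl]
          simp)
    refine ⟨Function.update G i g, fun s => ?_, fun ζ hζ => ?_⟩
    · by_cases h : s = i
      · subst h
        rw [Function.update_self]
        exact hg
      · rw [Function.update_of_ne h]
        exact hG s
    · have hfil : Finset.univ.filter (fun s : Fin d => (i : ℕ) ≤ (s : ℕ)) =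
          insert i (Finset.univ.filter (fun s : Fin d => (i : ℕ) + 1 ≤ (s : ℕ))) := by
        ext s
        simp only [Finset.mem_filter, Finset.mem_univ, true_and, Finset.mem_insert, Fin.ext_iff]
        omega
      rw [hfil, Finset.sum_insert (by simp), Function.update_self,
        Finset.sum_congr rfl fun s hs => by
          rw [Function.update_of_ne (by
            rintro rfl
            simp at hs)], ← hGΨ ζ hζ]
      abel

/-- Every monogenic function is a combination of principal extensions. -/
theorem Monogenic.exists_eq_explicitExpr (hI : IsCartanBasis I u) (h1 : (1 : A) ∈ E)
    (hs : ∀ v, functional I v '' (E : Set A) = univ) (hΩo : IsOpen Ω)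
    (hΩ : ∀ v, ConvexWrt Ω (directions I E v)) {Φ : E → A} (hΦ : Monogenic Ω Φ) :
    ∃ (F : Fin m → ℂ → ℂ) (G : Fin d → ℂ → ℂ), HolomorphicData I u Ω F G ∧
      ∀ ζ ∈ Ω, Φ ζ = explicitExpr I u F G (ζ : A) := by
  have hD := fun v => isOpen_imageD (hs v) hΩo
  have hd : ∀ ζ ∈ Ω, ∃ Φ' : A, HasGateauxDeriv Φ Φ' ζ := fun ζ hζ => hΦ.exists_hasGateauxDeriv hζ
  choose F hF hFΦ using fun v => exists_holomorphic_functional hI hs hΩo hΩ hΦ.1 hd v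
  -- Removing the extensions of the `F_v` annihilates all idempotent coordinates; the peeling then
  -- starts at `j = 0`.
  obtain ⟨G, hG, hGΦ⟩ := exists_eq_sum_nil_mul_extension hI h1 hs hΩo hΩ d 0 (by omega)
    (Ψ := fun ζ => Φ ζ - ∑ v, extension I v (F v) (ζ : A))
    (hΦ.1.sub (continuousOn_finsetSum _ fun v _ => continuousOn_extension (hD v) (hF v)))
    (fun ζ hζ => by
      obtain ⟨Φ', hΦ'⟩ := hd ζ hζ
      exact ⟨_, hΦ'.sub (HasGateauxDeriv.sum fun v _ =>
        hI.hasGateauxDeriv_extension (analyticAt_of_imageD (hD v) (hF v) hζ))⟩)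
    (fun ζ hζ => by
      refine ⟨fun v => ?_, fun q hq => absurd hq (Nat.not_lt_zero _)⟩
      rw [map_sub, map_sum, hFΦ v ζ hζ]
      simp [hI.functional_extension])
  refine ⟨F, G, ⟨hF, hG⟩, fun ζ hζ => ?_⟩
  have h2 := hGΦ ζ hζ
  simp only [Nat.zero_le, Finset.filter_true] at h2
  rw [hI.explicitExpr_eq, ← h2]
  abel

end Representation

end CommAlg

end

theorem theorem1 {A : Type*} [NormedCommRing A] [NormedAlgebra ℂ A] {m d : ℕ}
    (I : Module.Basis (Fin m ⊕ Fin d) ℂ A) (u : Fin d → Fin m)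
    (hI : CommAlg.IsCartanBasis I u)
    {k : ℕ} (hk : 2 ≤ k) (e : Fin k → A) (he : LinearIndependent ℝ e)
    (he1 : e ⟨0, by omega⟩ = 1)
    (hsurj : ∀ v : Fin m, (CommAlg.functional I v) '' (CommAlg.spanE e : Set A) = Set.univ)
    (Ω : Set (CommAlg.spanE e)) (hΩo : IsOpen Ω) (hΩc : IsConnected Ω)
    (hΩ : ∀ v : Fin m, CommAlg.ConvexWrt Ω (CommAlg.directions I (CommAlg.spanE e) v))
    (Φ : CommAlg.spanE e → A) (hΦ : CommAlg.Monogenic Ω Φ) :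
    (∀ ζ ∈ Ω, ∃ Γ : Fin m → ℝ → ℂ, CommAlg.AreContours I Ω ζ Γ) ∧
    (∃ (F : Fin m → ℂ → ℂ) (G : Fin d → ℂ → ℂ), CommAlg.HolomorphicData I u Ω F G ∧
      (∀ ζ ∈ Ω, ∀ Γ : Fin m → ℝ → ℂ, CommAlg.AreContours I Ω ζ Γ →
        Φ ζ = CommAlg.integralExpr I u F G Γ (ζ : A)) ∧
      (∀ ζ ∈ Ω, Φ ζ = CommAlg.explicitExpr I u F G (ζ : A))) ∧
    (∀ (F : Fin m → ℂ → ℂ) (G : Fin d → ℂ → ℂ), CommAlg.HolomorphicData I u Ω F G →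
      ∀ ζ ∈ Ω, ∀ Γ : Fin m → ℝ → ℂ, CommAlg.AreContours I Ω ζ Γ →
        CommAlg.integralExpr I u F G Γ (ζ : A) = CommAlg.explicitExpr I u F G (ζ : A)) := by
  have h1 : (1 : A) ∈ CommAlg.spanE e := he1 ▸ Submodule.subset_span (mem_range_self _)
  have hD := fun v => CommAlg.isOpen_imageD (hsurj v) hΩo
  obtain ⟨F, G, hFG, hrep⟩ := hΦ.exists_eq_explicitExpr hI h1 hsurj hΩo hΩ
  refine ⟨fun ζ hζ => CommAlg.exists_areContours hD hζ, ⟨F, G, hFG, fun ζ hζ Γ hΓ => ?_, hrep⟩,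
    fun F G hFG ζ _ Γ hΓ => hI.integralExpr_eq hD hFG hΓ⟩
  rw [hI.integralExpr_eq hD hFG hΓ]
  exact hrep ζ hζ
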